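/- Let $v>1$. A speed-$v$ highway is a straight line $h$ in the Euclidean plane. The travel time between two points $p,q$ with respect to $h$ is the infimum of the times needed to move from $p$ to $q$ when one can move with speed at most $v$ on $h$ and with speed at most $1$ elsewhere. The travel-time diameter of a finite set $S$ with respect to $h$ is the maximum travel time over all pairs of points of $S$. Put $\alpha=\arccos(1/v)$. A $(\tan\alpha)$-rhombus is a (non-degenerate) rhombus, of arbitrary position and orientation, with one diagonal, called the main diagonal, $\tan\alpha$ times as long as the other one, that is, forming the angle $\pi/2-\alpha$ with the sides. (The main diagonal is the shorter one if $v<\sqrt2$.) Below, the main diagonal is extended to a line when it is used as a highway. Theorem. For every $v>1$, $$\min\Bigl\{v,\sqrt{v^2/(v^2-1)}\Bigr\}\le\sqrt2 .$$ Let $S$ be a set of $n\ge3$ points in the plane. If $R$ is a smallest $(\tan\alpha)$-rhombus containing $S$, over all positions and orientations, then the travel-time diameter of $S$ with respect to the main diagonal of $R$ is at most $\min\{v,\sqrt{v^2/(v^2-1)}\}$ times the travel-time diameter of $S$ with respect to any speed-$v$ highway. Moreover, there is an algorithm on the real RAM (exact real arithmetic $+,-,\times,/,\sqrt{\ }$,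 comparisons, index additions and subtractions, and memory accesses at unit cost) that, given $v$ and $S$, computes in $O(n\log n)$ time two distinct points spanning the main diagonal of a smallest $(\tan\alpha)$-rhombus containing $S$, and thus a highway with this approximation guarantee. The algorithm and the constant in the $O$-bound do not depend on $v$, $n$ or $S$. -/

import Mathlib

/-! ### Highways and travel time -/

/-- The Euclidean plane. -/
abbrev Plane : Type := EuclideanSpace ℝ (Fin 2)

/-- A highway is a straight line in the plane. -/
def IsHighway (h : AffineSubspace ℝ Plane) : Prop :=
  Module.finrank ℝ h.direction = 1

/-- `γ`, restricted to the time interval `[0, T]`, is the motion of a traveller who moves with speed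
at most `v` on the highway `h` and with speed at most `1` elsewhere: he never moves faster than `v`,
and during every period in which he is off the highway he never moves faster than `1`. -/
def IsTravel (v : ℝ) (h : AffineSubspace ℝ Plane) (T : ℝ) (γ : ℝ → Plane) : Prop :=
  (∀ s t : ℝ, 0 ≤ s → s ≤ t → t ≤ T → dist (γ s) (γ t) ≤ v * (t - s)) ∧
  (∀ s t : ℝ, 0 ≤ s → s ≤ t → t ≤ T → (∀ r ∈ Set.Ioo s t, γ r ∉ h) →
    dist (γ s) (γ t) ≤ t - s)

/-- The travel time from `p` to `q`: the least time in which one can travel from `p` to `q`, using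
the highway `h` of speed `v`. -/
noncomputable def travelTime (v : ℝ) (h : AffineSubspace ℝ Plane) (p q : Plane) : ℝ :=
  sInf {T : ℝ | 0 ≤ T ∧ ∃ γ : ℝ → Plane, IsTravel v h T γ ∧ γ 0 = p ∧ γ T = q}

/-- The travel-time diameter of `S`: the maximum travel time over all pairs of points of `S`. -/
noncomputable def travelDiam (v : ℝ) (h : AffineSubspace ℝ Plane) (S : Set Plane) : ℝ :=
  sSup {τ : ℝ | ∃ p ∈ S, ∃ q ∈ S, τ = travelTime v h p q}

/-- The factor `min {v, √(v² / (v² - 1))}`. -/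
noncomputable def approxFactor (v : ℝ) : ℝ :=
  min v (Real.sqrt (v ^ 2 / (v ^ 2 - 1)))

/-! ### Rhombi -/

/-- The vector `e` turned by a right angle. -/
noncomputable def perp (e : Plane) : Plane := !₂[-(e 1), e 0]

/-- A rhombus of aspect ratio `ρ`, of arbitrary orientation: its main diagonal has the direction of
the unit vector `axis` and half-length `ρ * size`, the other diagonal has half-length `size`. -/
structure Rhombus (ρ : ℝ) where
  center : Plane
  axis : Plane
  size : ℝ
  norm_axis : ‖axis‖ = 1
  size_pos : 0 < size

/-- The region of the plane covered by the rhombus, the convex hull of its four corners. -/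
noncomputable def Rhombus.carrier {ρ : ℝ} (R : Rhombus ρ) : Set Plane :=
  convexHull ℝ {R.center + (ρ * R.size) • R.axis, R.center - (ρ * R.size) • R.axis,
    R.center + R.size • perp R.axis, R.center - R.size • perp R.axis}

/-- The line through the two corners on the main diagonal. -/
noncomputable def Rhombus.mainDiagonal {ρ : ℝ} (R : Rhombus ρ) : AffineSubspace ℝ Plane :=
  line[ℝ, R.center - (ρ * R.size) • R.axis, R.center + (ρ * R.size) • R.axis]

/-- `R` is smallest among all rhombi of aspect ratio `ρ`, of whatever position and orientation, that
contain `S`. (Rhombi of the same aspect ratio are similar, so `size` compares them.) -/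
def Rhombus.IsSmallestEnclosing {ρ : ℝ} (R : Rhombus ρ) (S : Set Plane) : Prop :=
  S ⊆ R.carrier ∧ ∀ R' : Rhombus ρ, S ⊆ R'.carrier → R.size ≤ R'.size

/-! ### The real RAM

Structured programs over index registers and arrays (holding natural numbers) and real registers and
arrays (holding real numbers). Real arithmetic and square roots are exact and, like comparisons,
index additions and subtractions, and memory accesses, are counted at unit cost. There is no rounding
and no conversion between the two sorts of data. -/

namespace RealRAM

/-- Index expressions; subtraction is truncated. Registers and arrays are named by numbers. -/
inductive NExpr : Type
  | const (k : ℕ)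
  | reg (x : ℕ)
  | load (a : ℕ) (i : NExpr)
  | add (e f : NExpr)
  | sub (e f : NExpr)

/-- Real expressions; the constants are integers. -/
inductive RExpr : Type
  | const (k : ℤ)
  | reg (x : ℕ)
  | load (a : ℕ) (i : NExpr)
  | add (e f : RExpr)
  | sub (e f : RExpr)
  | mul (e f : RExpr)
  | div (e f : RExpr)
  | sqrt (e : RExpr)

/-- Tests. -/
inductive Test : Type
  | natLe (e f : NExpr)
  | realLe (e f : RExpr)
  | neg (b : Test)
  | both (b c : Test)

/-- Programs. -/
inductive Prog : Type
  | skip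
  | setNat (x : ℕ) (e : NExpr)
  | setReal (x : ℕ) (e : RExpr)
  | storeNat (a : ℕ) (i e : NExpr)
  | storeReal (a : ℕ) (i : NExpr) (e : RExpr)
  | seq (P Q : Prog)
  | cond (b : Test) (P Q : Prog)
  | loop (b : Test) (P : Prog)

/-- A memory configuration; `natArr a i` is the `i`-th cell of the array named `a`. -/
structure State where
  natReg : ℕ → ℕ
  realReg : ℕ → ℝ
  natArr : ℕ → ℕ → ℕ
  realArr : ℕ → ℕ → ℝ

def NExpr.eval (s : State) : NExpr → ℕ
  | .const k => k
  | .reg x => s.natReg x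
  | .load a i => s.natArr a (i.eval s)
  | .add e f => e.eval s + f.eval s
  | .sub e f => e.eval s - f.eval s

/-- The number of operations needed to evaluate an index expression. -/
def NExpr.cost : NExpr → ℕ
  | .const _ => 1
  | .reg _ => 1
  | .load _ i => i.cost + 1
  | .add e f => e.cost + f.cost + 1
  | .sub e f => e.cost + f.cost + 1

/-- Quotients by zero and square roots of negative numbers are `0`; a program can test for these
cases at unit cost, so this convention gives the machine no extra power. -/
noncomputable def RExpr.eval (s : State) : RExpr → ℝ
  | .const k => (k : ℝ)
  | .reg x => s.realReg x
  | .load a i => s.realArr a (i.eval s)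
  | .add e f => e.eval s + f.eval s
  | .sub e f => e.eval s - f.eval s
  | .mul e f => e.eval s * f.eval s
  | .div e f => e.eval s / f.eval s
  | .sqrt e => Real.sqrt (e.eval s)

/-- The number of operations needed to evaluate a real expression. -/
def RExpr.cost : RExpr → ℕ
  | .const _ => 1
  | .reg _ => 1
  | .load _ i => i.cost + 1
  | .add e f => e.cost + f.cost + 1
  | .sub e f => e.cost + f.cost + 1
  | .mul e f => e.cost + f.cost + 1
  | .div e f => e.cost + f.cost + 1
  | .sqrt e => e.cost + 1

/-- The test succeeds. -/
def Test.Holds (s : State) : Test → Prop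
  | .natLe e f => e.eval s ≤ f.eval s
  | .realLe e f => e.eval s ≤ f.eval s
  | .neg b => ¬ b.Holds s
  | .both b c => b.Holds s ∧ c.Holds s

/-- The number of operations needed to carry out a test. -/
def Test.cost : Test → ℕ
  | .natLe e f => e.cost + f.cost + 1
  | .realLe e f => e.cost + f.cost + 1
  | .neg b => b.cost + 1
  | .both b c => b.cost + c.cost + 1

def State.setNat (s : State) (x k : ℕ) : State :=
  { s with natReg := Function.update s.natReg x k }

noncomputable def State.setReal (s : State) (x : ℕ) (r : ℝ) : State :=
  { s with realReg := Function.update s.realReg x r }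

def State.storeNat (s : State) (a i k : ℕ) : State :=
  { s with natArr := Function.update s.natArr a (Function.update (s.natArr a) i k) }

noncomputable def State.storeReal (s : State) (a i : ℕ) (r : ℝ) : State :=
  { s with realArr := Function.update s.realArr a (Function.update (s.realArr a) i r) }

/-- `Runs P s t s'`: started in `s`, the program `P` halts in `s'` after `t` steps. -/
inductive Runs : Prog → State → ℕ → State → Prop
  | skip (s : State) : Runs .skip s 1 s
  | setNat (s : State) (x : ℕ) (e : NExpr) :
      Runs (.setNat x e) s (e.cost + 1) (s.setNat x (e.eval s))
  | setReal (s : State) (x : ℕ) (e : RExpr) :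
      Runs (.setReal x e) s (e.cost + 1) (s.setReal x (e.eval s))
  | storeNat (s : State) (a : ℕ) (i e : NExpr) :
      Runs (.storeNat a i e) s (i.cost + e.cost + 1) (s.storeNat a (i.eval s) (e.eval s))
  | storeReal (s : State) (a : ℕ) (i : NExpr) (e : RExpr) :
      Runs (.storeReal a i e) s (i.cost + e.cost + 1) (s.storeReal a (i.eval s) (e.eval s))
  | seq {P Q : Prog} {s s' s'' : State} {t t' : ℕ} (hP : Runs P s t s') (hQ : Runs Q s' t' s'') :
      Runs (.seq P Q) s (t + t') s''
  | condTrue {b : Test} {P Q : Prog} {s s' : State} {t : ℕ} (hb : b.Holds s)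
      (hP : Runs P s t s') : Runs (.cond b P Q) s (b.cost + t + 1) s'
  | condFalse {b : Test} {P Q : Prog} {s s' : State} {t : ℕ} (hb : ¬ b.Holds s)
      (hQ : Runs Q s t s') : Runs (.cond b P Q) s (b.cost + t + 1) s'
  | loopDone {b : Test} {P : Prog} {s : State} (hb : ¬ b.Holds s) :
      Runs (.loop b P) s (b.cost + 1) s
  | loopStep {b : Test} {P : Prog} {s s' s'' : State} {t t' : ℕ} (hb : b.Holds s)
      (hP : Runs P s t s') (hL : Runs (.loop b P) s' t' s'') :
      Runs (.loop b P) s (b.cost + t + t' + 1) s''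

/-- The initial configuration for the speed `v` and the points `p 0, …, p (n - 1)`: `n` in index
register `0`, `v` in real register `0`, the first coordinates in the real array `0`, the second
coordinates in the real array `1`, and `0` everywhere else. -/
noncomputable def input (v : ℝ) {n : ℕ} (p : Fin n → Plane) : State where
  natReg := fun x => if x = 0 then n else 0
  realReg := fun x => if x = 0 then v else 0
  natArr := fun _ _ => 0
  realArr := fun a i =>
    if hi : i < n then (if a = 0 then p ⟨i, hi⟩ 0 else if a = 1 then p ⟨i, hi⟩ 1 else 0) else 0

/-- The first output point, read off from the real registers `0` and `1`. -/
noncomputable def State.out₁ (s : State) : Plane := !₂[s.realReg 0, s.realReg 1]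

/-- The second output point, read off from the real registers `2` and `3`. -/
noncomputable def State.out₂ (s : State) : Plane := !₂[s.realReg 2, s.realReg 3]

end RealRAM

/-! Put c = 1/v = cos α and s = sin α. For a unit vector e the norm `rhombusNorm c s e`, that is d ↦
c|d·e| + s|d·e⊥|, has as its balls the (tan α)-rhombi with main diagonal along e. It is at most the
Euclidean norm, and along e it is the Euclidean norm divided by v. Splitting a motion at its first
and last visit to a highway of direction e shows that travel times are at least the distance in this
norm (`rhombusNorm_le_of_canTravel`). So if D is the travel-time diameter for some highway, S has
width at most D in both directions normal to the rhombus sides. Hence S fits into a rhombus with `2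
* (size * s) = D`, and the smallest rhombus R satisfies `2 * (R.size * s) ≤ D`.

Conversely, two points of R are at travel time at most `2 * R.size` ≤ D/s for the main diagonal of
R. One either enters and leaves the highway at the optimal angle or, when the feet would cross,
walks straight (`travelTime_le_of_rhombusNorm_le`). Here 1/s = √(v²/(v²-1)). The factor v is
trivial, because nobody moves faster than v and walking has speed 1. The two factors coincide at v²
= 2, whence the bound √2.

For the algorithm, let u be the unit normal of one strip of a rhombus; the normal of the other is u
turned by 2α. A smallest rhombus therefore minimizes, over unit u, the larger of the widths of S in
the directions u and `rot u`. This larger width is the support function, at u, of the convex hull E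
of S - S together with S - S turned back by 2α (`DifferenceSet`). On the cone between two
consecutive edge normals of E the support function is linear while the Euclidean norm is convex, so
the minimum over unit vectors is attained at an edge normal (`mul_norm_le_dot`,
`UpperChain.exists_mul_norm_le`). As E is centrally symmetric, its upper hull and the horizontal
direction suffice (`DifferenceSet.le_of_widthsLE`).

The upper hull of S - S is the Minkowski sum of the upper hulls of S and -S, found by merging edges
by slope (`SumInv`). It has at most 2n vertices, so at most 8n points generate E. Three hull
computations by merge sort and scan thus dominate the cost. Programs are verified with `Reach`,
which carries a budget of remaining steps along with the state; loop invariants relate this budget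
to the progress made, so correctness and running time are proved together. -/

/-! ### Coordinates in the plane -/

/-- The Euclidean inner product, in coordinates. -/
noncomputable def dot (p u : Plane) : ℝ := p 0 * u 0 + p 1 * u 1

theorem dot_add_left (p q u : Plane) : dot (p + q) u = dot p u + dot q u := by
  simp [dot]; ring

theorem dot_sub_left (p q u : Plane) : dot (p - q) u = dot p u - dot q u := by
  simp [dot]; ring

theorem dot_smul_left (a : ℝ) (p u : Plane) : dot (a • p) u = a * dot p u := by
  simp [dot]; ring

theorem dot_neg_left (p u : Plane) : dot (-p) u = -dot p u := by
  simp [dot]; ring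

theorem dot_add_right (p u w : Plane) : dot p (u + w) = dot p u + dot p w := by
  simp [dot]; ring

theorem dot_sub_right (p u w : Plane) : dot p (u - w) = dot p u - dot p w := by
  simp [dot]; ring

theorem dot_smul_right (a : ℝ) (p u : Plane) : dot p (a • u) = a * dot p u := by
  simp [dot]; ring

theorem dot_neg_right (p u : Plane) : dot p (-u) = -dot p u := by
  simp [dot]; ring

theorem norm_sq_plane (p : Plane) : ‖p‖ ^ 2 = p 0 ^ 2 + p 1 ^ 2 := by
  rw [EuclideanSpace.norm_sq_eq]; simp [Fin.sum_univ_two]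

theorem dot_self (p : Plane) : dot p p = ‖p‖ ^ 2 := by
  rw [norm_sq_plane, dot]; ring

theorem dot_perp_self (e : Plane) : dot e (perp e) = 0 := by
  simp [dot, perp]; ring

theorem dot_perp_perp (e : Plane) : dot (perp e) (perp e) = ‖e‖ ^ 2 := by
  rw [norm_sq_plane]; simp [dot, perp]; ring

theorem dot_perp_left (e : Plane) : dot (perp e) e = 0 := by
  simp [dot, perp]; ring

theorem norm_sq_eq_dot {e : Plane} (he : ‖e‖ = 1) (d : Plane) :
    ‖d‖ ^ 2 = dot d e ^ 2 + dot d (perp e) ^ 2 := by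
  have h := norm_sq_plane e
  rw [he] at h
  rw [norm_sq_plane]
  simp only [dot, perp, Matrix.cons_val_zero, Matrix.cons_val_one, PiLp.toLp_apply]
  linear_combination (d 0 ^ 2 + d 1 ^ 2) * h

theorem eq_dot_smul {e : Plane} (he : ‖e‖ = 1) (d : Plane) :
    d = dot d e • e + dot d (perp e) • perp e := by
  have h := norm_sq_plane e
  rw [he] at h
  ext i
  fin_cases i
  · simp [dot, perp]; linear_combination (d 0) * h
  · simp [dot, perp]; linear_combination (d 1) * h

theorem norm_eq_sqrt (p : Plane) : ‖p‖ = Real.sqrt (p 0 ^ 2 + p 1 ^ 2) := by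
  rw [← norm_sq_plane, Real.sqrt_sq (norm_nonneg p)]

/-! ### Travel times -/

/-- One can travel from `p` to `q` in time `T`. -/
def CanTravel (v : ℝ) (h : AffineSubspace ℝ Plane) (T : ℝ) (p q : Plane) : Prop :=
  0 ≤ T ∧ ∃ γ : ℝ → Plane, IsTravel v h T γ ∧ γ 0 = p ∧ γ T = q

theorem exists_uniform_motion {k T : ℝ} (hk : 0 ≤ k) (hT : 0 ≤ T) {p q : Plane} (hpq : dist p q ≤ k * T) :
    ∃ γ : ℝ → Plane, γ 0 = p ∧ γ T = q ∧ (∀ t, ∃ a : ℝ, γ t = AffineMap.lineMap p q a) ∧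
      ∀ s t, s ≤ t → dist (γ s) (γ t) ≤ k * (t - s) := by
  refine ⟨fun t => AffineMap.lineMap p q (t / T), by simp, ?_, fun t => ⟨_, rfl⟩, ?_⟩
  -- For `T = 0` the hypothesis forces `p = q`, and the convention `t / 0 = 0` keeps the traveller
  -- at `p`.
  · rcases hT.eq_or_lt with rfl | h
    · have : p = q := by simpa using hpq
      simp [this]
    · simp [div_self h.ne']
  · intro s t hst
    rw [dist_lineMap_lineMap, Real.dist_eq]
    rcases hT.eq_or_lt with rfl | h
    · have : p = q := by simpa using hpq
      subst this
      simp only [div_zero, sub_self, abs_zero, zero_mul]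
      exact mul_nonneg hk (sub_nonneg.2 hst)
    · rw [← sub_div, abs_div, abs_of_pos h, abs_sub_comm, abs_of_nonneg (sub_nonneg.2 hst)]
      rw [div_mul_eq_mul_div, div_le_iff₀ h]
      nlinarith [mul_le_mul_of_nonneg_left hpq (sub_nonneg.2 hst)]

theorem CanTravel.of_dist_le {v T : ℝ} (hv : 1 < v) (h : AffineSubspace ℝ Plane) (hT : 0 ≤ T)
    {p q : Plane} (hpq : dist p q ≤ T) : CanTravel v h T p q := by
  obtain ⟨γ, h0, h1, -, hd⟩ := exists_uniform_motion zero_le_one hT (by simpa using hpq)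
  refine ⟨hT, γ, ⟨fun s t _ hst _ => (hd s t hst).trans ?_, fun s t _ hst _ _ => ?_⟩, h0, h1⟩
  · exact mul_le_mul_of_nonneg_right hv.le (sub_nonneg.2 hst)
  · simpa using hd s t hst

theorem CanTravel.of_mem {v T : ℝ} (hv : 1 < v) {h : AffineSubspace ℝ Plane} (hT : 0 ≤ T)
    {p q : Plane} (hp : p ∈ h) (hq : q ∈ h) (hpq : dist p q ≤ v * T) : CanTravel v h T p q := by
  obtain ⟨γ, h0, h1, hm, hd⟩ := exists_uniform_motion (zero_le_one.trans hv.le) hT hpq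
  refine ⟨hT, γ, ⟨fun s t _ hst _ => hd s t hst, fun s t _ hst _ hr => ?_⟩, h0, h1⟩
  rcases hst.eq_or_lt with rfl | hst
  · simp
  · obtain ⟨r, hr'⟩ := exists_between hst
    obtain ⟨a, ha⟩ := hm r
    exact absurd (ha ▸ AffineMap.lineMap_mem a hp hq) (hr r hr')

/-- The motions are concatenated at time `T`. A period that straddles `T` is split there, and the
triangle inequality through `q` adds the two bounds. -/
theorem CanTravel.trans {v T T' : ℝ} {h : AffineSubspace ℝ Plane} {p q r : Plane}
    (h₁ : CanTravel v h T p q) (h₂ : CanTravel v h T' q r) : CanTravel v h (T + T') p r := by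
  obtain ⟨hT, γ, ⟨hγ, hγ'⟩, h0, h1⟩ := h₁
  obtain ⟨hT', δ, ⟨hδ, hδ'⟩, k0, k1⟩ := h₂
  refine ⟨add_nonneg hT hT', fun t => if t ≤ T then γ t else δ (t - T), ⟨?_, ?_⟩, by simp [hT, h0], ?_⟩
  · intro s t hs hst ht
    by_cases ht' : t ≤ T
    · simpa [ht', hst.trans ht'] using hγ s t hs hst ht'
    · push Not at ht'
      by_cases hs' : s ≤ T
      · simp only [hs', if_true, ht'.not_ge, if_false]
        have a := hγ s T hs hs' le_rfl
        have b := hδ 0 (t - T) le_rfl (by linarith) (by linarith)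
        rw [h1] at a
        rw [k0] at b
        linarith [dist_triangle (γ s) q (δ (t - T))]
      · push Not at hs'
        simp only [hs'.not_ge, ht'.not_ge, if_false]
        have b := hδ (s - T) (t - T) (by linarith) (by linarith) (by linarith)
        linarith
  · intro s t hs hst ht hoff
    by_cases ht' : t ≤ T
    · have : ∀ r ∈ Set.Ioo s t, γ r ∉ h := fun r hr => by
        simpa [hr.2.le.trans ht'] using hoff r hr
      simpa [ht', hst.trans ht'] using hγ' s t hs hst ht' this
    · push Not at ht'
      by_cases hs' : s ≤ T
      · simp only [hs', if_true, ht'.not_ge, if_false]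
        have a := hγ' s T hs hs' le_rfl fun r hr => by
          simpa [hr.2.le] using hoff r ⟨hr.1, hr.2.trans ht'⟩
        have b := hδ' 0 (t - T) le_rfl (by linarith) (by linarith) fun r hr => by
          have := hoff (r + T) ⟨by linarith [hr.1], by linarith [hr.2]⟩
          have h' : ¬ r + T ≤ T := by linarith [hr.1]
          simpa only [if_neg h', add_sub_cancel_right] using this
        rw [h1] at a
        rw [k0] at b
        linarith [dist_triangle (γ s) q (δ (t - T))]
      · push Not at hs'
        simp only [hs'.not_ge, ht'.not_ge, if_false]
        have b := hδ' (s - T) (t - T) (by linarith) (by linarith) (by linarith) fun r hr => by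
          have := hoff (r + T) ⟨by linarith [hr.1], by linarith [hr.2]⟩
          have h' : T < r + T := by linarith [hr.1]
          simpa [h'.not_ge] using this
        linarith
  · rcases hT'.eq_or_lt with h0 | h0
    · subst h0
      simp [h1, ← k1, k0]
    · simp [h0, k1]

theorem travelTime_le {v T : ℝ} {h : AffineSubspace ℝ Plane} {p q : Plane}
    (H : CanTravel v h T p q) : travelTime v h p q ≤ T :=
  csInf_le ⟨0, fun _ hx => hx.1⟩ H

theorem le_travelTime {v a : ℝ} (hv : 1 < v) {h : AffineSubspace ℝ Plane} {p q : Plane}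
    (H : ∀ T, CanTravel v h T p q → a ≤ T) : a ≤ travelTime v h p q :=
  le_csInf ⟨dist p q, CanTravel.of_dist_le hv h dist_nonneg le_rfl⟩ H

/-- Speed never exceeds `v`, on or off the highway. This gives the trivial factor `v` of the
approximation. -/
theorem dist_le_mul_travelTime {v : ℝ} (hv : 1 < v) (h : AffineSubspace ℝ Plane) (p q : Plane) :
    dist p q ≤ v * travelTime v h p q := by
  rw [← div_le_iff₀' (by linarith)]
  refine le_travelTime hv fun T ⟨hT, γ, hγ, h0, h1⟩ => ?_
  rw [div_le_iff₀' (by linarith), ← h0, ← h1]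
  simpa using hγ.1 0 T le_rfl hT le_rfl

theorem IsHighway.exists_axis {h : AffineSubspace ℝ Plane} (hh : IsHighway h) :
    ∃ o e : Plane, ‖e‖ = 1 ∧ ∀ x, x ∈ h ↔ dot (x - o) (perp e) = 0 := by
  -- The empty affine subspace is excluded because its direction has rank 0.
  have hne : (h : Set Plane).Nonempty := by
    rw [Set.nonempty_iff_ne_empty]
    intro h0
    have : h = ⊥ := by simpa using h0
    subst this
    rw [IsHighway, AffineSubspace.direction_bot, finrank_bot] at hh
    exact zero_ne_one hh
  obtain ⟨o, ho⟩ := hne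
  obtain ⟨w, hw0, hw⟩ := finrank_eq_one_iff'.1 hh
  have hw0' : (w : Plane) ≠ 0 := by simpa using hw0
  have hn : ‖(w : Plane)‖ ≠ 0 := norm_ne_zero_iff.2 hw0'
  have he : ‖(‖(w : Plane)‖⁻¹ • (w : Plane))‖ = 1 := by
    rw [norm_smul, norm_inv, norm_norm, inv_mul_cancel₀ hn]
  refine ⟨o, ‖(w : Plane)‖⁻¹ • (w : Plane), he, fun x => ⟨fun hx => ?_, fun hx => ?_⟩⟩
  · obtain ⟨c, hc⟩ := hw ⟨x -ᵥ o, AffineSubspace.vsub_mem_direction hx ho⟩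
    have hc' : c • (w : Plane) = x - o := by simpa using congrArg Subtype.val hc
    rw [← hc']
    simp [dot, perp]; ring
  · have := eq_dot_smul he (x - o)
    rw [hx, zero_smul, add_zero, smul_smul] at this
    have hm := h.direction.smul_mem (dot (x - o) (‖(w : Plane)‖⁻¹ • (w : Plane)) * ‖(w : Plane)‖⁻¹) w.2
    rw [← this] at hm
    have := AffineSubspace.vadd_mem_of_mem_direction hm ho
    simpa using this

/-- The norm whose unit ball is a rhombus with main diagonal in direction `e`. -/
noncomputable def rhombusNorm (c s : ℝ) (e d : Plane) : ℝ :=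
  |dot d e| * c + |dot d (perp e)| * s

theorem rhombusNorm_triangle {c s : ℝ} (hc : 0 ≤ c) (hs : 0 ≤ s) (e p q r : Plane) :
    rhombusNorm c s e (p - r) ≤ rhombusNorm c s e (p - q) + rhombusNorm c s e (q - r) := by
  have a := abs_sub_le (dot p e) (dot q e) (dot r e)
  have b := abs_sub_le (dot p (perp e)) (dot q (perp e)) (dot r (perp e))
  simp only [rhombusNorm, dot_sub_left]
  nlinarith [mul_le_mul_of_nonneg_right a hc, mul_le_mul_of_nonneg_right b hs]

/-- Cauchy–Schwarz: the unit disc is inscribed in the unit rhombus because the side normals are unit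
vectors. -/
theorem rhombusNorm_le_norm {c s : ℝ} (hcs : c ^ 2 + s ^ 2 = 1) {e : Plane} (he : ‖e‖ = 1)
    (d : Plane) : rhombusNorm c s e d ≤ ‖d‖ := by
  refine abs_le_of_sq_le_sq' ?_ (norm_nonneg d) |>.2
  rw [norm_sq_eq_dot he, rhombusNorm, ← sq_abs (dot d e), ← sq_abs (dot d (perp e))]
  nlinarith [sq_nonneg (|dot d e| * s - |dot d (perp e)| * c)]

/-- The motion is cut at the first and the last time on the highway. The outer parts have speed at
most 1 and the rhombus norm is below the Euclidean one. The middle part joins two points of the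
highway, where the rhombus norm is 1/v times the Euclidean norm; what happens in between is
irrelevant, since only the speed bound `v` is used. -/
theorem rhombusNorm_le_of_canTravel {v c s : ℝ} (hv : 1 < v) (hcv : c * v = 1) (hs : 0 ≤ s)
    (hcs : c ^ 2 + s ^ 2 = 1) {h : AffineSubspace ℝ Plane} {o e : Plane} (he : ‖e‖ = 1)
    (hh : ∀ x, x ∈ h ↔ dot (x - o) (perp e) = 0) {T : ℝ} {p q : Plane}
    (H : CanTravel v h T p q) : rhombusNorm c s e (p - q) ≤ T := by
  obtain ⟨hT, γ, ⟨hγ, hγ'⟩, h0, h1⟩ := H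
  have hc : 0 < c := by
    by_contra hcon
    nlinarith
  have step : ∀ s' t, 0 ≤ s' → s' ≤ t → t ≤ T → (∀ r ∈ Set.Ioo s' t, γ r ∉ h) →
      rhombusNorm c s e (γ s' - γ t) ≤ t - s' := fun s' t a b d f =>
    (rhombusNorm_le_norm hcs he _).trans (by simpa [dist_eq_norm] using hγ' s' t a b d f)
  by_cases hex : ∃ r ∈ Set.Icc 0 T, γ r ∈ h
  -- The speed bound makes the motion Lipschitz, so the times spent on the closed set `h` are
  -- compact and a first and a last one exist.
  · have hcont : ContinuousOn γ (Set.Icc 0 T) := by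
      have : LipschitzOnWith (Real.toNNReal v) γ (Set.Icc 0 T) := by
        refine LipschitzOnWith.of_dist_le_mul fun x hx y hy => ?_
        rw [Real.coe_toNNReal _ (by linarith)]
        rcases le_total x y with hxy | hxy
        · rw [dist_comm x y, Real.dist_eq, abs_of_nonneg (sub_nonneg.2 hxy)]
          exact hγ x y hx.1 hxy hy.2
        · rw [dist_comm, Real.dist_eq, abs_of_nonneg (sub_nonneg.2 hxy)]
          exact hγ y x hy.1 hxy hx.2
      exact this.continuousOn
    have hcl : IsCompact (Set.Icc 0 T ∩ γ ⁻¹' (h : Set Plane)) := by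
      refine isCompact_Icc.of_isClosed_subset
        (hcont.preimage_isClosed_of_isClosed isClosed_Icc ?_) Set.inter_subset_left
      exact AffineSubspace.closed_of_finiteDimensional h
    have hne : (Set.Icc 0 T ∩ γ ⁻¹' (h : Set Plane)).Nonempty := by
      obtain ⟨r, hr, hr'⟩ := hex
      exact ⟨r, hr, hr'⟩
    obtain ⟨a, ⟨ha, hah⟩, hamin⟩ := hcl.exists_isLeast hne
    obtain ⟨b, ⟨hb, hbh⟩, hbmax⟩ := hcl.exists_isGreatest hne
    have hab : a ≤ b := hamin ⟨hb, hbh⟩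
    have e1 := step 0 a le_rfl ha.1 ha.2 fun r hr hrh =>
      (hamin ⟨⟨hr.1.le, hr.2.le.trans ha.2⟩, hrh⟩).not_gt hr.2
    have e2 := step b T hb.1 hb.2 le_rfl fun r hr hrh =>
      (hbmax ⟨⟨hb.1.trans hr.1.le, hr.2.le⟩, hrh⟩).not_gt hr.1
    have e3 : rhombusNorm c s e (γ a - γ b) ≤ b - a := by
      have ea := (hh _).1 hah
      have eb := (hh _).1 hbh
      rw [dot_sub_left] at ea eb
      have hz : dot (γ a - γ b) (perp e) = 0 := by rw [dot_sub_left]; linarith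
      have hn := norm_sq_eq_dot he (γ a - γ b)
      rw [hz] at hn
      have hn' : |dot (γ a - γ b) e| = ‖γ a - γ b‖ := by
        rw [← abs_of_nonneg (norm_nonneg (γ a - γ b))]
        exact (sq_eq_sq_iff_abs_eq_abs _ _).1 (by linarith)
      rw [rhombusNorm, hz, hn', abs_zero, zero_mul, add_zero, ← dist_eq_norm]
      calc dist (γ a) (γ b) * c ≤ v * (b - a) * c :=
            mul_le_mul_of_nonneg_right (hγ a b ha.1 hab hb.2) hc.le
        _ = b - a := by linear_combination (b - a) * hcv
    have t1 := rhombusNorm_triangle hc.le hs e p (γ a) q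
    have t2 := rhombusNorm_triangle hc.le hs e (γ a) (γ b) q
    rw [h0] at e1
    rw [h1] at e2
    linarith
  · push Not at hex
    rw [← h0, ← h1]
    simpa using step 0 T le_rfl hT le_rfl fun r hr => hex r ⟨hr.1.le, hr.2.le⟩

/-- The optimal route meets the highway at the angle with cosine `c`: a point at height `y` walks
the length `|y| / s` and advances by `|y| * c / s` along the highway. The hypothesis `hx` says that
the entry point does not lie beyond the exit point. -/
theorem travelTime_le_of_highway {v c s : ℝ} (hv : 1 < v) (hcv : c * v = 1) (hs : 0 < s)
    (hcs : c ^ 2 + s ^ 2 = 1) {h : AffineSubspace ℝ Plane} {o e : Plane} (he : ‖e‖ = 1)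
    (hh : ∀ x, x ∈ h ↔ dot (x - o) (perp e) = 0) {p q : Plane}
    (hx : (|dot (p - o) (perp e)| + |dot (q - o) (perp e)|) * c ≤ (dot q e - dot p e) * s) :
    travelTime v h p q ≤ (dot q e - dot p e) * c +
      (|dot (p - o) (perp e)| + |dot (q - o) (perp e)|) * s := by
  have hc : 0 < c := by
    by_contra hcon
    nlinarith
  set yp := dot (p - o) (perp e) with hyp
  set yq := dot (q - o) (perp e) with hyq
  have hee : dot e e = 1 := by rw [dot_self, he]; norm_num
  have hpp : dot (perp e) (perp e) = 1 := by rw [dot_perp_perp, he]; norm_num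
  set a : Plane := p + (|yp| * c / s) • e - yp • perp e with ha
  set b : Plane := q - (|yq| * c / s) • e - yq • perp e with hb
  have hah : a ∈ h := by
    rw [hh, ha]
    have : p + (|yp| * c / s) • e - yp • perp e - o = (p - o) + (|yp| * c / s) • e - yp • perp e := by
      abel
    rw [this, dot_sub_left, dot_add_left, dot_smul_left, dot_smul_left, dot_perp_self, hpp, ← hyp]
    ring
  have hbh : b ∈ h := by
    rw [hh, hb]
    have : q - (|yq| * c / s) • e - yq • perp e - o = (q - o) - (|yq| * c / s) • e - yq • perp e := by
      abel
    rw [this, dot_sub_left, dot_sub_left, dot_smul_left, dot_smul_left, dot_perp_self, hpp, ← hyq]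
    ring
  have leg : ∀ y k : ℝ, (k = |y| * c / s) → ‖k • e - y • perp e‖ ≤ |y| / s ∧
      ‖k • e + y • perp e‖ ≤ |y| / s := by
    intro y k hk
    have hq : k ^ 2 + y ^ 2 = (|y| / s) ^ 2 := by
      rw [hk, ← sq_abs y]
      field_simp
      linear_combination |y| ^ 2 * hcs
    constructor <;>
    · refine abs_le_of_sq_le_sq' ?_ (by positivity) |>.2
      rw [norm_sq_eq_dot he, ← hq]
      simp only [dot_sub_left, dot_add_left, dot_smul_left, hee, hpp, dot_perp_self, dot_perp_left]
      apply le_of_eq; ring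
  have t1 : CanTravel v h (|yp| / s) p a := by
    refine CanTravel.of_dist_le hv h (by positivity) ?_
    rw [dist_comm, dist_eq_norm]
    have : a - p = (|yp| * c / s) • e - yp • perp e := by rw [ha]; abel
    rw [this]
    exact (leg yp _ rfl).1
  have t3 : CanTravel v h (|yq| / s) b q := by
    refine CanTravel.of_dist_le hv h (by positivity) ?_
    rw [dist_comm, dist_eq_norm]
    have : q - b = (|yq| * c / s) • e + yq • perp e := by rw [hb]; abel
    rw [this]
    exact (leg yq _ rfl).2
  -- This is the distance left to be driven between the two feet.
  have hd : 0 ≤ dot q e - dot p e - (|yp| + |yq|) * c / s := by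
    rw [sub_nonneg, div_le_iff₀ hs]; exact hx
  have t2 : CanTravel v h ((dot q e - dot p e - (|yp| + |yq|) * c / s) * c) a b := by
    refine CanTravel.of_mem hv (by positivity) hah hbh ?_
    have hz : dot (b - a) (perp e) = 0 := by
      have e1 := (hh _).1 hah
      have e2 := (hh _).1 hbh
      rw [dot_sub_left] at e1 e2 ⊢
      linarith
    have hz' : dot (b - a) e = dot q e - dot p e - (|yp| + |yq|) * c / s := by
      simp only [ha, hb, dot_sub_left, dot_add_left, dot_smul_left, hee, dot_perp_left]
      ring
    have hn := norm_sq_eq_dot he (b - a)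
    rw [hz, hz'] at hn
    rw [dist_comm, dist_eq_norm]
    have : v * ((dot q e - dot p e - (|yp| + |yq|) * c / s) * c) =
        dot q e - dot p e - (|yp| + |yq|) * c / s := by
      linear_combination (dot q e - dot p e - (|yp| + |yq|) * c / s) * hcv
    rw [this]
    exact abs_le_of_sq_le_sq' (by linarith) hd |>.2
  refine (travelTime_le ((t1.trans t2).trans t3)).trans (le_of_eq ?_)
  field_simp
  linear_combination (-(|yp| + |yq|)) * hcs

theorem travelTime_comm_le {v : ℝ} (hv : 1 < v) (h : AffineSubspace ℝ Plane) (p q : Plane) :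
    travelTime v h p q ≤ travelTime v h q p := by
  refine le_travelTime hv fun T ⟨hT, γ, ⟨hγ, hγ'⟩, h0, h1⟩ => ?_
  refine travelTime_le ⟨hT, fun t => γ (T - t), ⟨fun s t hs hst ht => ?_, fun s t hs hst ht hr => ?_⟩,
    by simpa using h1, by simpa using h0⟩
  · have := hγ (T - t) (T - s) (by linarith) (by linarith) (by linarith)
    rw [dist_comm]
    simpa using this
  · have := hγ' (T - t) (T - s) (by linarith) (by linarith) (by linarith) fun r hr' => by
      simpa using hr (T - r) ⟨by linarith [hr'.2], by linarith [hr'.1]⟩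
    rw [dist_comm]
    simpa using this

/-- Let X be the extent along the highway and Y the sum of the two heights. If `Y * c ≤ X * s`, the
route over the highway even takes time at most `2 * m`. Otherwise walking suffices: `X * s < Y * c`
gives X²s² ≤ XYcs, so s²(X² + Y²) ≤ (Xc + Ys)². Only this case loses the factor 1/s. -/
theorem travelTime_le_of_rhombusNorm_le {v c s : ℝ} (hv : 1 < v) (hcv : c * v = 1) (hs : 0 < s)
    (hcs : c ^ 2 + s ^ 2 = 1) {h : AffineSubspace ℝ Plane} {o e : Plane} (he : ‖e‖ = 1)
    (hh : ∀ x, x ∈ h ↔ dot (x - o) (perp e) = 0) {p q : Plane} {m : ℝ}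
    (hp : rhombusNorm c s e (p - o) ≤ m) (hq : rhombusNorm c s e (q - o) ≤ m) :
    travelTime v h p q * s ≤ 2 * m := by
  wlog hpq : dot p e ≤ dot q e generalizing p q
  · exact (mul_le_mul_of_nonneg_right (travelTime_comm_le hv h p q) hs.le).trans
      (this hq hp (le_of_not_ge hpq))
  have hc : 0 < c := by
    by_contra hcon
    nlinarith
  have hs1 : s ≤ 1 := by nlinarith
  set yp := dot (p - o) (perp e) with hyp
  set yq := dot (q - o) (perp e) with hyq
  have hsum : (dot q e - dot p e) * c + (|yp| + |yq|) * s ≤ 2 * m := by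
    simp only [rhombusNorm, ← hyp, ← hyq] at hp hq
    have : dot q e - dot p e ≤ |dot (p - o) e| + |dot (q - o) e| := by
      have a := neg_abs_le (dot (p - o) e)
      have b := le_abs_self (dot (q - o) e)
      rw [dot_sub_left] at a b
      rw [dot_sub_left, dot_sub_left]
      linarith
    nlinarith [mul_le_mul_of_nonneg_right this hc.le]
  by_cases hx : (|yp| + |yq|) * c ≤ (dot q e - dot p e) * s
  · have a := travelTime_le_of_highway hv hcv hs hcs he hh hx
    have hm : 0 ≤ 2 * m := by
      refine le_trans ?_ hsum
      have := sub_nonneg.2 hpq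
      positivity
    calc travelTime v h p q * s ≤ 2 * m * s := mul_le_mul_of_nonneg_right (a.trans hsum) hs.le
      _ ≤ 2 * m := mul_le_of_le_one_right hm hs1
  · push Not at hx
    have a := travelTime_le (CanTravel.of_dist_le hv h dist_nonneg (le_refl (dist p q)))
    refine (mul_le_mul_of_nonneg_right a hs.le).trans (le_trans ?_ hsum)
    have hX := sub_nonneg.2 hpq
    have hY : 0 ≤ |yp| + |yq| := by positivity
    refine abs_le_of_sq_le_sq' ?_ (by positivity) |>.2
    rw [dist_comm, dist_eq_norm, mul_pow, norm_sq_eq_dot he, dot_sub_left]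
    have hy : (dot (q - p) (perp e)) ^ 2 ≤ (|yp| + |yq|) ^ 2 := by
      apply sq_le_sq'
      · have h1 := le_abs_self yp
        have h2 := neg_abs_le yq
        simp only [hyp, hyq, dot_sub_left] at h1 h2 ⊢
        linarith
      · have h1 := neg_abs_le yp
        have h2 := le_abs_self yq
        simp only [hyp, hyq, dot_sub_left] at h1 h2 ⊢
        linarith
    generalize dot q e - dot p e = X at *
    generalize |yp| + |yq| = Y at *
    -- The only place where the failure of the highway condition enters.
    have h1 : X * (X * s) * s ≤ X * (Y * c) * s := by gcongr
    nlinarith [mul_le_mul_of_nonneg_right hy (sq_nonneg s), mul_nonneg (mul_nonneg hX hY) (mul_nonneg hc.le hs.le),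
      mul_nonneg hX hX, sq_nonneg (X * c)]

/-! ### Rhombi as intersections of strips -/

/-- The normals of the two strips whose intersection is a rhombus with axis `e`. -/
noncomputable def normal₁ (c s : ℝ) (e : Plane) : Plane := c • e - s • perp e

/-- The second of the two normals. -/
noncomputable def normal₂ (c s : ℝ) (e : Plane) : Plane := c • e + s • perp e

/-- The larger of |xc - ys| and |xc + ys| is |x|c + |y|s. This turns enclosing rhombi into pairs of
width conditions. -/
theorem rhombusNorm_le_iff {c s : ℝ} (hc : 0 ≤ c) (hs : 0 ≤ s) (e d : Plane) (m : ℝ) :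
    rhombusNorm c s e d ≤ m ↔ |dot d (normal₁ c s e)| ≤ m ∧ |dot d (normal₂ c s e)| ≤ m := by
  simp only [rhombusNorm, normal₁, normal₂, dot_sub_right, dot_add_right, dot_smul_right, abs_le]
  rcases abs_cases (dot d e) with ⟨h, -⟩ | ⟨h, -⟩ <;>
  rcases abs_cases (dot d (perp e)) with ⟨k, -⟩ | ⟨k, -⟩ <;> rw [h, k]
  all_goals
    constructor
    · intro H
      have a1 := mul_nonneg (abs_nonneg (dot d e)) hc
      have a2 := mul_nonneg (abs_nonneg (dot d (perp e))) hs
      rw [h] at a1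
      rw [k] at a2
      refine ⟨⟨?_, ?_⟩, ?_, ?_⟩ <;> linarith
    · rintro ⟨⟨h1, h2⟩, h3, h4⟩
      linarith

theorem dot_self_of_norm {e : Plane} (he : ‖e‖ = 1) : dot e e = 1 := by
  rw [dot_self, he]; norm_num

theorem dot_perp_of_norm {e : Plane} (he : ‖e‖ = 1) : dot (perp e) (perp e) = 1 := by
  rw [dot_perp_perp, he]; norm_num

/-- The corners have norm exactly `R.size * s` and balls are convex. Conversely, a point of the ball
is written as an explicit convex combination of the corners. -/
theorem Rhombus.mem_carrier_iff {c s : ℝ} (hc : 0 < c) (hs : 0 < s) (R : Rhombus (s / c))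
    (p : Plane) :
    p ∈ R.carrier ↔ rhombusNorm c s R.axis (p - R.center) ≤ R.size * s := by
  obtain ⟨o, e, z, he, hz⟩ := R
  simp only [Rhombus.carrier]
  have hee := dot_self_of_norm he
  have hpp := dot_perp_of_norm he
  have hzc := mul_pos (div_pos hs hc) hz
  constructor
  · intro hp
    have hconv : Convex ℝ {x : Plane | rhombusNorm c s e (x - o) ≤ z * s} := by
      simp only [rhombusNorm_le_iff hc.le hs.le, abs_le]
      have key : ∀ u : Plane, ∀ x y : Plane, ∀ a b : ℝ, a + b = 1 →
          dot (a • x + b • y - o) u = a * dot (x - o) u + b * dot (y - o) u := by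
        intro u x y a b hab
        simp only [dot_sub_left, dot_add_left, dot_smul_left]
        linear_combination (dot o u) * hab
      rintro x ⟨⟨h1, h2⟩, h3, h4⟩ y ⟨⟨k1, k2⟩, k3, k4⟩ a b ha hb hab
      simp only [Set.mem_ofPred_eq, key _ _ _ _ _ hab]
      have hb' : b = 1 - a := by linarith
      subst hb'
      refine ⟨⟨?_, ?_⟩, ?_, ?_⟩ <;> nlinarith
    refine convexHull_min ?_ hconv hp
    have e1 : ∀ w : Plane, o + w - o = w := fun w => by abel
    have e2 : ∀ w : Plane, o - w - o = -w := fun w => by abel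
    have e3 : z * s = s / c * z * c := by field_simp
    rintro x (rfl | rfl | rfl | rfl) <;>
    · simp only [Set.mem_ofPred_eq, e1, e2, rhombusNorm, dot_neg_left, dot_smul_left, hee, hpp,
        dot_perp_self, dot_perp_left, abs_neg, mul_zero, abs_zero, zero_mul, add_zero, zero_add,
        mul_one, abs_of_pos hz, abs_of_pos hzc]
      first | exact le_rfl | exact e3.ge
  · intro hp
    have hdec := eq_dot_smul he (p - o)
    rw [rhombusNorm] at hp
    set X := dot (p - o) e
    set Y := dot (p - o) (perp e)
    set k := s / c * z with hk
    have hr : |X| / k + |Y| / z ≤ 1 := by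
      rw [hk]
      have : |X| / (s / c * z) + |Y| / z = (|X| * c + |Y| * s) / (z * s) := by field_simp
      rw [this, div_le_one (by positivity)]
      exact hp
    set r := 1 - (|X| / k + |Y| / z) with hrdef
    have hr0 : 0 ≤ r := by linarith
    set V : Set Plane := {o + k • e, o - k • e, o + z • perp e, o - z • perp e} with hV
    have hcv := convex_convexHull ℝ V
    have hm : ∀ i : Fin 4, (![o + k • e, o - k • e, o + z • perp e, o - z • perp e] i) ∈
        convexHull ℝ V := by
      intro i
      apply subset_convexHull
      fin_cases i <;> simp [hV]
    have hXp : 0 ≤ |X| + X := by linarith [neg_abs_le X]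
    have hXm : 0 ≤ |X| - X := by linarith [le_abs_self X]
    have hYp : 0 ≤ |Y| + Y := by linarith [neg_abs_le Y]
    have hYm : 0 ≤ |Y| - Y := by linarith [le_abs_self Y]
    -- On each diagonal one corner takes the weight given by the positive or negative part of the
    -- coordinate; the slack `r` is shared equally by all four corners, which leaves the centre
    -- unchanged.
    have := hcv.sum_mem (t := Finset.univ)
      (w := ![(|X| + X) / (2 * k) + r / 4, (|X| - X) / (2 * k) + r / 4,
        (|Y| + Y) / (2 * z) + r / 4, (|Y| - Y) / (2 * z) + r / 4])
      (z := ![o + k • e, o - k • e, o + z • perp e, o - z • perp e])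
      (fun i _ => by fin_cases i <;> simp <;> positivity)
      (by
        simp only [Fin.sum_univ_four, Matrix.cons_val]
        rw [hrdef]; field_simp; ring) (fun i _ => hm i)
    convert this using 1
    simp only [Fin.sum_univ_four, Matrix.cons_val]
    have hp' : p = o + (X • e + Y • perp e) := by rw [← hdec]; abel
    rw [hp']
    have hrsum : (|X| / k + |Y| / z) + r = 1 := by rw [hrdef]; ring
    ext i
    simp only [PiLp.add_apply, PiLp.sub_apply, PiLp.smul_apply, smul_eq_mul]
    have hX : ((|X| + X) / (2 * k) - (|X| - X) / (2 * k)) * k = X := by field_simp; ring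
    have hY : ((|Y| + Y) / (2 * z) - (|Y| - Y) / (2 * z)) * z = Y := by field_simp; ring
    have hX' : (|X| + X) / (2 * k) + (|X| - X) / (2 * k) = |X| / k := by field_simp; ring
    have hY' : (|Y| + Y) / (2 * z) + (|Y| - Y) / (2 * z) = |Y| / z := by field_simp; ring
    linear_combination (-o.ofLp i) * hrsum - (e.ofLp i) * hX - ((perp e).ofLp i) * hY
      - (o.ofLp i) * hX' - (o.ofLp i) * hY'

theorem Rhombus.mem_mainDiagonal_iff {ρ : ℝ} (hρ : 0 < ρ) (R : Rhombus ρ) (x : Plane) :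
    x ∈ R.mainDiagonal ↔ dot (x - R.center) (perp R.axis) = 0 := by
  have hk := mul_pos hρ R.size_pos
  set k := ρ * R.size
  rw [Rhombus.mainDiagonal, mem_affineSpan_pair_iff_exists_lineMap_eq]
  constructor
  · rintro ⟨t, rfl⟩
    have : (AffineMap.lineMap (R.center - k • R.axis) (R.center + k • R.axis) t : Plane) - R.center
        = ((2 * t - 1) * k) • R.axis := by
      rw [AffineMap.lineMap_apply_module]
      ext i; simp; ring
    rw [this, dot_smul_left, dot_perp_self, mul_zero]
  · intro h
    have hd := eq_dot_smul R.norm_axis (x - R.center)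
    rw [h, zero_smul, add_zero] at hd
    refine ⟨(dot (x - R.center) R.axis / k + 1) / 2, ?_⟩
    have hx : x = R.center + dot (x - R.center) R.axis • R.axis := by rw [← hd]; abel
    conv_rhs => rw [hx]
    rw [AffineMap.lineMap_apply_module]
    ext i
    simp
    field_simp
    ring

/-- The program outputs the centre and the centre shifted by the axis rather than the corners. -/
theorem Rhombus.mainDiagonal_eq {ρ : ℝ} (hρ : 0 < ρ) (R : Rhombus ρ) :
    line[ℝ, R.center, R.center + R.axis] = R.mainDiagonal := by
  ext x
  rw [R.mem_mainDiagonal_iff hρ, mem_affineSpan_pair_iff_exists_lineMap_eq]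
  constructor
  · rintro ⟨t, rfl⟩
    have : (AffineMap.lineMap R.center (R.center + R.axis) t : Plane) - R.center = t • R.axis := by
      rw [AffineMap.lineMap_apply_module]
      ext i; simp; ring
    rw [this, dot_smul_left, dot_perp_self, mul_zero]
  · intro h
    have hd := eq_dot_smul R.norm_axis (x - R.center)
    rw [h, zero_smul, add_zero] at hd
    refine ⟨dot (x - R.center) R.axis, ?_⟩
    have hx : x = R.center + dot (x - R.center) R.axis • R.axis := by rw [← hd]; abel
    conv_rhs => rw [hx]
    rw [AffineMap.lineMap_apply_module]
    ext i
    simp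
    ring

theorem Rhombus.isHighway_mainDiagonal {ρ : ℝ} (hρ : 0 < ρ) (R : Rhombus ρ) :
    IsHighway R.mainDiagonal := by
  rw [IsHighway, ← R.mainDiagonal_eq hρ, direction_affineSpan, vectorSpan_pair]
  apply finrank_span_singleton
  simp only [vsub_eq_sub, sub_add_cancel_left, ne_eq, neg_eq_zero]
  intro h
  have := R.norm_axis
  rw [h, norm_zero] at this
  exact zero_ne_one this

/-- A point with prescribed products with the two normals of a rhombus with axis `e`. -/
noncomputable def centerOf (c s : ℝ) (e : Plane) (m₁ m₂ : ℝ) : Plane :=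
  ((m₁ + m₂) / (2 * c)) • e + ((m₂ - m₁) / (2 * s)) • perp e

theorem dot_centerOf {c s : ℝ} (hc : c ≠ 0) (hs : s ≠ 0) {e : Plane} (he : ‖e‖ = 1) (m₁ m₂ : ℝ) :
    dot (centerOf c s e m₁ m₂) (normal₁ c s e) = m₁ ∧
      dot (centerOf c s e m₁ m₂) (normal₂ c s e) = m₂ := by
  have hee := dot_self_of_norm he
  have hpp := dot_perp_of_norm he
  simp only [centerOf, normal₁, normal₂, dot_add_left, dot_add_right, dot_sub_right, dot_smul_left,
    dot_smul_right, hee, hpp, dot_perp_self, dot_perp_left]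
  constructor <;> field_simp <;> ring

/-- Any two strips of equal half-width with these normals intersect in a rhombus with axis `e`,
whatever their offsets; its centre solves a 2×2 linear system. -/
theorem Rhombus.subset_carrier_of_strips {c s : ℝ} (hc : 0 < c) (hs : 0 < s) {e : Plane}
    (he : ‖e‖ = 1) {m₁ m₂ m : ℝ} (hm : 0 < m) {S : Set Plane}
    (h₁ : ∀ p ∈ S, |dot p (normal₁ c s e) - m₁| ≤ m)
    (h₂ : ∀ p ∈ S, |dot p (normal₂ c s e) - m₂| ≤ m) :
    S ⊆ (Rhombus.mk (ρ := s / c) (centerOf c s e m₁ m₂) e (m / s) he (div_pos hm hs)).carrier := by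
  intro p hp
  rw [Rhombus.mem_carrier_iff hc hs, div_mul_cancel₀ _ hs.ne', rhombusNorm_le_iff hc.le hs.le]
  obtain ⟨a, b⟩ := dot_centerOf hc.ne' hs.ne' he m₁ m₂
  simp only [dot_sub_left, a, b]
  exact ⟨h₁ p hp, h₂ p hp⟩

theorem exists_strip {S : Set Plane} (hfin : S.Finite) (hne : S.Nonempty) {u : Plane} {m : ℝ}
    (h : ∀ p ∈ S, ∀ q ∈ S, dot (p - q) u ≤ 2 * m) : ∃ m₁, ∀ p ∈ S, |dot p u - m₁| ≤ m := by
  obtain ⟨a, ha, ha'⟩ := Set.exists_max_image S (fun p => dot p u) hfin hne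
  obtain ⟨b, hb, hb'⟩ := Set.exists_min_image S (fun p => dot p u) hfin hne
  -- The centre line lies midway between the two extreme points.
  refine ⟨(dot a u + dot b u) / 2, fun p hp => ?_⟩
  have h1 := ha' p hp
  have h2 := hb' p hp
  have h3 := h a ha b hb
  rw [dot_sub_left] at h3
  rw [abs_le]
  constructor <;> linarith

theorem Rhombus.dot_sub_le {c s : ℝ} (hc : 0 < c) (hs : 0 < s) (R : Rhombus (s / c))
    {p q : Plane} (hp : p ∈ R.carrier) (hq : q ∈ R.carrier) :
    dot (p - q) (normal₁ c s R.axis) ≤ 2 * (R.size * s) ∧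
      dot (p - q) (normal₂ c s R.axis) ≤ 2 * (R.size * s) := by
  rw [R.mem_carrier_iff hc hs, rhombusNorm_le_iff hc.le hs.le] at hp hq
  simp only [abs_le, dot_sub_left] at *
  constructor <;> linarith [hp.1.1, hp.1.2, hp.2.1, hp.2.2, hq.1.1, hq.1.2, hq.2.1, hq.2.2]

/-! ### The approximation guarantee -/

theorem approxFactor_le_sqrt_two {v : ℝ} : approxFactor v ≤ Real.sqrt 2 := by
  rw [approxFactor]
  rcases le_total (v ^ 2) 2 with h | h
  · exact (min_le_left _ _).trans (Real.le_sqrt_of_sq_le h)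
  · refine (min_le_right _ _).trans (Real.sqrt_le_sqrt ?_)
    rw [div_le_iff₀ (by nlinarith)]
    linarith

theorem travelTime_le_travelDiam {v : ℝ} (h : AffineSubspace ℝ Plane) {S : Set Plane}
    (hfin : S.Finite) {p q : Plane} (hp : p ∈ S) (hq : q ∈ S) :
    travelTime v h p q ≤ travelDiam v h S := by
  refine le_csSup ?_ ⟨p, hp, q, hq, rfl⟩
  refine Set.Finite.bddAbove (((hfin.prod hfin).image fun x => travelTime v h x.1 x.2).subset ?_)
  rintro _ ⟨p, hp, q, hq, rfl⟩
  exact ⟨(p, q), ⟨hp, hq⟩, rfl⟩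

/-- The quantity `2 * (R.size * s)` links both sides: it is at most the diameter for any highway, by
minimality of `R`, and at least `s` times each travel time for the main diagonal. -/
theorem Rhombus.travelDiam_le {v c s : ℝ} (hv : 1 < v) (hcv : c * v = 1) (hs : 0 < s)
    (hcs : c ^ 2 + s ^ 2 = 1) {S : Set Plane} (hfin : S.Finite) (hS : S.Nontrivial)
    {R : Rhombus (s / c)} (hR : R.IsSmallestEnclosing S) {h : AffineSubspace ℝ Plane}
    (hh : IsHighway h) :
    travelDiam v R.mainDiagonal S ≤ approxFactor v * travelDiam v h S := by
  have hc : 0 < c := by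
    by_contra hcon
    nlinarith
  obtain ⟨a, ha, b, hb, hab⟩ := hS
  -- Needed because a rhombus of size 0 is not admitted as a competitor of `R`.
  have hDpos : 0 < travelDiam v h S := by
    have h1 := dist_le_mul_travelTime hv h a b
    have h2 := dist_pos.2 hab
    have h3 := travelTime_le_travelDiam (v := v) h hfin ha hb
    by_contra hcon
    nlinarith
  -- The competitor is the rhombus whose axis is the direction of `h` and whose strips have half the
  -- diameter as half-width.
  have hsize : 2 * (R.size * s) ≤ travelDiam v h S := by
    obtain ⟨o, e, he, hmem⟩ := hh.exists_axis
    have key : ∀ p ∈ S, ∀ q ∈ S, rhombusNorm c s e (p - q) ≤ travelDiam v h S := fun p hp q hq =>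
      (le_travelTime hv fun T hT => rhombusNorm_le_of_canTravel hv hcv hs.le hcs he hmem hT).trans
        (travelTime_le_travelDiam h hfin hp hq)
    simp only [rhombusNorm_le_iff hc.le hs.le] at key
    obtain ⟨m₁, h₁⟩ := exists_strip hfin ⟨a, ha⟩ (u := normal₁ c s e) (m := travelDiam v h S / 2)
      fun p hp q hq => by linarith [(abs_le.1 (key p hp q hq).1).2]
    obtain ⟨m₂, h₂⟩ := exists_strip hfin ⟨a, ha⟩ (u := normal₂ c s e) (m := travelDiam v h S / 2)
      fun p hp q hq => by linarith [(abs_le.1 (key p hp q hq).2).2]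
    have := hR.2 _ (Rhombus.subset_carrier_of_strips hc hs he (half_pos hDpos) h₁ h₂)
    simp only [le_div_iff₀ hs] at this
    linarith
  have hs' : Real.sqrt (v ^ 2 / (v ^ 2 - 1)) = 1 / s := by
    have hv' : v = 1 / c := by field_simp; linarith
    have : v ^ 2 / (v ^ 2 - 1) = (1 / s) ^ 2 := by
      rw [hv']
      have : s ^ 2 = 1 - c ^ 2 := by linarith
      rw [one_div_pow, one_div_pow, this]
      have h1 : 1 - c ^ 2 ≠ 0 := by rw [← this]; positivity
      have h2 : 1 / c ^ 2 - 1 ≠ 0 := by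
        rw [div_sub_one (by positivity)]; exact div_ne_zero h1 (by positivity)
      field_simp
    rw [this, Real.sqrt_sq (by positivity)]
  rw [approxFactor, hs', min_mul_of_nonneg _ _ hDpos.le]
  refine csSup_le ⟨_, a, ha, a, ha, rfl⟩ ?_
  rintro _ ⟨p, hp, q, hq, rfl⟩
  refine le_min ?_ ?_
  · calc travelTime v R.mainDiagonal p q ≤ dist p q :=
          travelTime_le (CanTravel.of_dist_le hv _ dist_nonneg le_rfl)
      _ ≤ v * travelTime v h p q := dist_le_mul_travelTime hv h p q
      _ ≤ v * travelDiam v h S :=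
          mul_le_mul_of_nonneg_left (travelTime_le_travelDiam h hfin hp hq) (by linarith)
  · have h1 := (R.mem_carrier_iff hc hs p).1 (hR.1 hp)
    have h2 := (R.mem_carrier_iff hc hs q).1 (hR.1 hq)
    have := travelTime_le_of_rhombusNorm_le hv hcv hs hcs R.norm_axis
      (R.mem_mainDiagonal_iff (div_pos hs hc)) h1 h2
    rw [one_div_mul_eq_div, le_div_iff₀ hs]
    exact this.trans hsize

theorem tan_arccos_one_div {v : ℝ} :
    Real.tan (Real.arccos (1 / v)) = Real.sqrt (1 - (1 / v) ^ 2) / (1 / v) :=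
  Real.tan_arccos _

theorem sin_data {v : ℝ} (hv : 1 < v) : 1 / v * v = 1 ∧ 0 < 1 / v ∧ 0 < Real.sqrt (1 - (1 / v) ^ 2) ∧
    (1 / v) ^ 2 + Real.sqrt (1 - (1 / v) ^ 2) ^ 2 = 1 := by
  have h0 : 0 < v := by linarith
  have h1 : 0 < 1 - (1 / v) ^ 2 := by
    have : 1 / v < 1 := by rw [div_lt_one h0]; exact hv
    have : 0 < 1 / v := by positivity
    nlinarith
  refine ⟨by field_simp, by positivity, Real.sqrt_pos.2 h1, ?_⟩
  rw [Real.sq_sqrt h1.le]; ring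

theorem travelDiam_mainDiagonal_le {v : ℝ} (hv : 1 < v) {S : Set Plane} (hfin : S.Finite)
    (hS : S.Nontrivial) {R : Rhombus (Real.tan (Real.arccos (1 / v)))}
    (hR : R.IsSmallestEnclosing S) {h : AffineSubspace ℝ Plane} (hh : IsHighway h) :
    travelDiam v R.mainDiagonal S ≤ approxFactor v * travelDiam v h S := by
  obtain ⟨h1, -, h3, h4⟩ := sin_data hv
  revert R
  rw [tan_arccos_one_div]
  intro R hR
  exact Rhombus.travelDiam_le hv h1 h3 h4 hfin hS hR hh

/-! ### Reasoning about real RAM programs -/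

namespace RealRAM

@[simp] theorem State.setNat_natReg (s : State) (x k y : ℕ) :
    (s.setNat x k).natReg y = if y = x then k else s.natReg y := by
  simp [State.setNat, Function.update_apply]

@[simp] theorem State.setNat_realReg (s : State) (x k y : ℕ) :
    (s.setNat x k).realReg y = s.realReg y := rfl

@[simp] theorem State.setNat_realArr (s : State) (x k a i : ℕ) :
    (s.setNat x k).realArr a i = s.realArr a i := rfl

@[simp] theorem State.setReal_natReg (s : State) (x y : ℕ) (r : ℝ) :
    (s.setReal x r).natReg y = s.natReg y := rfl

@[simp] theorem State.setReal_realReg (s : State) (x y : ℕ) (r : ℝ) :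
    (s.setReal x r).realReg y = if y = x then r else s.realReg y := by
  simp [State.setReal, Function.update_apply]

@[simp] theorem State.setReal_realArr (s : State) (x a i : ℕ) (r : ℝ) :
    (s.setReal x r).realArr a i = s.realArr a i := rfl

@[simp] theorem State.storeReal_natReg (s : State) (a i y : ℕ) (r : ℝ) :
    (s.storeReal a i r).natReg y = s.natReg y := rfl

@[simp] theorem State.storeReal_realReg (s : State) (a i y : ℕ) (r : ℝ) :
    (s.storeReal a i r).realReg y = s.realReg y := rfl

@[simp] theorem State.storeReal_realArr (s : State) (a i b j : ℕ) (r : ℝ) :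
    (s.storeReal a i r).realArr b j =
      if b = a then (if j = i then r else s.realArr b j) else s.realArr b j := by
  simp only [State.storeReal, Function.update_apply]
  split_ifs with h
  · subst h; simp [*]
  · subst h; simp [*]
  · rfl

/-- The effect of a program without loops. -/
noncomputable def Prog.exec : Prog → State → State
  | .skip, s => s
  | .setNat x e, s => s.setNat x (e.eval s)
  | .setReal x e, s => s.setReal x (e.eval s)
  | .storeNat a i e, s => s.storeNat a (i.eval s) (e.eval s)
  | .storeReal a i e, s => s.storeReal a (i.eval s) (e.eval s)
  | .seq P Q, s => Q.exec (P.exec s)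
  | .cond b P Q, s => open Classical in if b.Holds s then P.exec s else Q.exec s
  | .loop _ _, s => s

/-- An upper bound for the running time of a program without loops. -/
def Prog.bound : Prog → ℕ
  | .skip => 1
  | .setNat _ e => e.cost + 1
  | .setReal _ e => e.cost + 1
  | .storeNat _ i e => i.cost + e.cost + 1
  | .storeReal _ i e => i.cost + e.cost + 1
  | .seq P Q => P.bound + Q.bound
  | .cond b P Q => b.cost + (P.bound + Q.bound) + 1
  | .loop _ _ => 0

/-- The program contains no loop. -/
def Prog.loopFree : Prog → Bool
  | .seq P Q => P.loopFree && Q.loopFree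
  | .cond _ P Q => P.loopFree && Q.loopFree
  | .loop _ _ => false
  | _ => true

theorem Prog.runs_exec (P : Prog) (h : P.loopFree = true) (s : State) :
    ∃ t ≤ P.bound, Runs P s t (P.exec s) := by
  induction P generalizing s with
  | skip => exact ⟨_, le_rfl, .skip s⟩
  | setNat x e => exact ⟨_, le_rfl, .setNat s x e⟩
  | setReal x e => exact ⟨_, le_rfl, .setReal s x e⟩
  | storeNat a i e => exact ⟨_, le_rfl, .storeNat s a i e⟩
  | storeReal a i e => exact ⟨_, le_rfl, .storeReal s a i e⟩
  | seq P Q ihP ihQ =>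
    simp only [Prog.loopFree, Bool.and_eq_true] at h
    obtain ⟨t, ht, hP⟩ := ihP h.1 s
    obtain ⟨t', ht', hQ⟩ := ihQ h.2 (P.exec s)
    exact ⟨_, add_le_add ht ht', .seq hP hQ⟩
  | cond b P Q ihP ihQ =>
    simp only [Prog.loopFree, Bool.and_eq_true] at h
    by_cases hb : b.Holds s
    · obtain ⟨t, ht, hP⟩ := ihP h.1 s
      refine ⟨_, ?_, by simpa [Prog.exec, hb] using Runs.condTrue (Q := Q) hb hP⟩
      simp only [Prog.bound]; omega
    · obtain ⟨t, ht, hQ⟩ := ihQ h.2 s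
      refine ⟨_, ?_, by simpa [Prog.exec, hb] using Runs.condFalse (P := P) hb hQ⟩
      simp only [Prog.bound]; omega
  | loop b P => simp [Prog.loopFree] at h

/-- The program never writes index register `x`. -/
def Prog.keepsNatReg (x : ℕ) : Prog → Bool
  | .setNat y _ => x != y
  | .seq P Q => P.keepsNatReg x && Q.keepsNatReg x
  | .cond _ P Q => P.keepsNatReg x && Q.keepsNatReg x
  | .loop _ P => P.keepsNatReg x
  | _ => true

/-- The program never writes real register `x`. -/
def Prog.keepsRealReg (x : ℕ) : Prog → Bool
  | .setReal y _ => x != y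
  | .seq P Q => P.keepsRealReg x && Q.keepsRealReg x
  | .cond _ P Q => P.keepsRealReg x && Q.keepsRealReg x
  | .loop _ P => P.keepsRealReg x
  | _ => true

/-- The program never writes real array `a`. -/
def Prog.keepsRealArr (a : ℕ) : Prog → Bool
  | .storeReal b _ _ => a != b
  | .seq P Q => P.keepsRealArr a && Q.keepsRealArr a
  | .cond _ P Q => P.keepsRealArr a && Q.keepsRealArr a
  | .loop _ P => P.keepsRealArr a
  | _ => true

/-- The two configurations agree wherever `P` does not write. -/
structure Frame (P : Prog) (s s' : State) : Prop where
  natReg : ∀ x, P.keepsNatReg x = true → s'.natReg x = s.natReg x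
  realReg : ∀ x, P.keepsRealReg x = true → s'.realReg x = s.realReg x
  realArr : ∀ a, P.keepsRealArr a = true → s'.realArr a = s.realArr a

theorem Frame.refl (P : Prog) (s : State) : Frame P s s :=
  ⟨fun _ _ => rfl, fun _ _ => rfl, fun _ _ => rfl⟩

theorem Frame.trans {P : Prog} {s s' s'' : State} (h : Frame P s s') (h' : Frame P s' s'') :
    Frame P s s'' :=
  ⟨fun x hx => (h'.natReg x hx).trans (h.natReg x hx),
    fun x hx => (h'.realReg x hx).trans (h.realReg x hx),
    fun x hx => (h'.realArr x hx).trans (h.realArr x hx)⟩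

/-- Framing is syntactic, hence decided by evaluation. For concrete programs `rfl` proves that a
register or array is untouched, so invariants need to mention only what changes. -/
theorem Runs.frame {P : Prog} {s s' : State} {t : ℕ} (h : Runs P s t s') : Frame P s s' := by
  induction h with
  | skip s => exact Frame.refl _ _
  | setNat s x e =>
    refine ⟨fun y hy => ?_, fun _ _ => rfl, fun _ _ => rfl⟩
    have : y ≠ x := by simpa [Prog.keepsNatReg] using hy
    simp [this]
  | setReal s x e =>
    refine ⟨fun _ _ => rfl, fun y hy => ?_, fun _ _ => rfl⟩
    have : y ≠ x := by simpa [Prog.keepsRealReg] using hy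
    simp [this]
  | storeNat s a i e => exact ⟨fun _ _ => rfl, fun _ _ => rfl, fun _ _ => rfl⟩
  | storeReal s a i e =>
    refine ⟨fun _ _ => rfl, fun _ _ => rfl, fun y hy => ?_⟩
    have : y ≠ a := by simpa [Prog.keepsRealArr] using hy
    simp [State.storeReal, this]
  | seq hP hQ ihP ihQ =>
    refine ⟨fun x hx => ?_, fun x hx => ?_, fun x hx => ?_⟩
    · simp only [Prog.keepsNatReg, Bool.and_eq_true] at hx
      exact (ihQ.natReg x hx.2).trans (ihP.natReg x hx.1)
    · simp only [Prog.keepsRealReg, Bool.and_eq_true] at hx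
      exact (ihQ.realReg x hx.2).trans (ihP.realReg x hx.1)
    · simp only [Prog.keepsRealArr, Bool.and_eq_true] at hx
      exact (ihQ.realArr x hx.2).trans (ihP.realArr x hx.1)
  | condTrue hb hP ih =>
    refine ⟨fun x hx => ?_, fun x hx => ?_, fun x hx => ?_⟩
    · simp only [Prog.keepsNatReg, Bool.and_eq_true] at hx
      exact ih.natReg x hx.1
    · simp only [Prog.keepsRealReg, Bool.and_eq_true] at hx
      exact ih.realReg x hx.1
    · simp only [Prog.keepsRealArr, Bool.and_eq_true] at hx
      exact ih.realArr x hx.1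
  | condFalse hb hP ih =>
    refine ⟨fun x hx => ?_, fun x hx => ?_, fun x hx => ?_⟩
    · simp only [Prog.keepsNatReg, Bool.and_eq_true] at hx
      exact ih.natReg x hx.2
    · simp only [Prog.keepsRealReg, Bool.and_eq_true] at hx
      exact ih.realReg x hx.2
    · simp only [Prog.keepsRealArr, Bool.and_eq_true] at hx
      exact ih.realArr x hx.2
  | loopDone hb => exact Frame.refl _ _
  | loopStep hb hP hL ihP ihL =>
    exact Frame.trans ⟨ihP.natReg, ihP.realReg, ihP.realArr⟩ ihL

/-- Started in `s` with a budget of `m` steps, `P` halts, and the final configuration and the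
remaining budget satisfy `Q`. -/
def Reach (P : Prog) (s : State) (m : ℕ) (Q : State → ℕ → Prop) : Prop :=
  ∃ t s' m', Runs P s t s' ∧ t + m' ≤ m ∧ Q s' m'

theorem Reach.mono {P : Prog} {s : State} {m : ℕ} {Q R : State → ℕ → Prop} (h : Reach P s m Q)
    (hQR : ∀ s' m', Frame P s s' → Q s' m' → R s' m') : Reach P s m R := by
  obtain ⟨t, s', m', hr, ht, hQ⟩ := h
  exact ⟨t, s', m', hr, ht, hQR _ _ hr.frame hQ⟩

theorem Reach.seq {P Q : Prog} {s : State} {m : ℕ} {R : State → ℕ → Prop}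
    (h : Reach P s m fun s' m' => Reach Q s' m' R) : Reach (.seq P Q) s m R := by
  obtain ⟨t, s', m', hr, ht, t', s'', m'', hr', ht', hR⟩ := h
  exact ⟨t + t', s'', m'', .seq hr hr', by omega, hR⟩

/-- Straight-line code is evaluated symbolically by `Prog.exec` and charged a rounded-up flat fee
`k`. -/
theorem Reach.exec {P : Prog} {s : State} {m : ℕ} {R : State → ℕ → Prop} (k : ℕ)
    (hf : P.loopFree = true) (hk : P.bound ≤ k) (hm : k ≤ m) (hR : R (P.exec s) (m - k)) :
    Reach P s m R := by
  obtain ⟨t, ht, hr⟩ := P.runs_exec hf s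
  exact ⟨t, _, _, hr, by omega, hR⟩

theorem Reach.cond {P Q : Prog} {b : Test} {s : State} {m : ℕ} {R : State → ℕ → Prop}
    (hm : b.cost + 1 ≤ m) (hP : b.Holds s → Reach P s (m - (b.cost + 1)) R)
    (hQ : ¬ b.Holds s → Reach Q s (m - (b.cost + 1)) R) : Reach (.cond b P Q) s m R := by
  by_cases hb : b.Holds s
  · obtain ⟨t, s', m', hr, ht, hR⟩ := hP hb
    exact ⟨_, s', m', .condTrue hb hr, by omega, hR⟩
  · obtain ⟨t, s', m', hr, ht, hR⟩ := hQ hb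
    exact ⟨_, s', m', .condFalse hb hr, by omega, hR⟩

/-- The loop rule: the invariant may depend on the remaining budget, which pays for each test. -/
theorem Reach.loop {P : Prog} {b : Test} {s : State} {m : ℕ} {R : State → ℕ → Prop}
    (I : State → ℕ → Prop) (hI : I s m) (hcost : ∀ s' m', I s' m' → b.cost + 1 ≤ m')
    (hbody : ∀ s' m', Frame P s s' → I s' m' → b.Holds s' → Reach P s' (m' - (b.cost + 1)) I)
    (hexit : ∀ s' m', Frame P s s' → I s' m' → ¬ b.Holds s' → R s' (m' - (b.cost + 1))) :
    Reach (.loop b P) s m R := by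
  suffices H : ∀ m' s', Frame P s s' → I s' m' → Reach (.loop b P) s' m' R from
    H m s (Frame.refl _ _) hI
  -- Every iteration pays for its test, which costs at least one step, so the remaining budget is a
  -- termination measure.
  intro m'
  induction m' using Nat.strong_induction_on with
  | _ m' ih =>
    intro s' hf hI'
    have hc := hcost _ _ hI'
    by_cases hb : b.Holds s'
    · obtain ⟨t, s'', m'', hr, ht, hI''⟩ := hbody s' m' hf hI' hb
      obtain ⟨t', s₃, m₃, hr', ht', hR⟩ :=
        ih m'' (by omega) s'' (hf.trans hr.frame) hI''
      exact ⟨_, s₃, m₃, .loopStep hb hr hr', by omega, hR⟩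
    · exact ⟨_, s', _, .loopDone hb, by omega, hexit s' m' hf hI' hb⟩

/-- The `i`-th point stored in the pair of arrays `a`, `b`. -/
noncomputable def State.pt (s : State) (a b i : ℕ) : Plane := !₂[s.realArr a i, s.realArr b i]

@[simp] theorem State.pt_zero (s : State) (a b i : ℕ) : s.pt a b i 0 = s.realArr a i := rfl

@[simp] theorem State.pt_one (s : State) (a b i : ℕ) : s.pt a b i 1 = s.realArr b i := rfl

end RealRAM

/-! ### Merge sort -/

/-- The lexicographic order, ascending in the first and descending in the second coordinate. -/
def lexLe (p q : Plane) : Prop := p 0 < q 0 ∨ (p 0 = q 0 ∧ q 1 ≤ p 1)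

theorem lexLe_refl (p : Plane) : lexLe p p := Or.inr ⟨rfl, le_rfl⟩

theorem lexLe_trans {p q r : Plane} (h : lexLe p q) (h' : lexLe q r) : lexLe p r := by
  rcases h with h | ⟨h, k⟩ <;> rcases h' with h' | ⟨h', k'⟩
  · exact Or.inl (h.trans h')
  · exact Or.inl (h' ▸ h)
  · exact Or.inl (h ▸ h')
  · exact Or.inr ⟨h.trans h', k'.trans k⟩

theorem lexLe_of_not {p q : Plane} (h : ¬ lexLe p q) : lexLe q p := by
  simp only [lexLe, not_or, not_lt, not_and, not_le] at h ⊢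
  rcases h.1.lt_or_eq with h1 | h1
  · exact Or.inl h1
  · exact Or.inr ⟨h1, (h.2 h1.symm).le⟩

/-- The state of a merge of the blocks `[lo, mid)` and `[mid, hi)` of `f` into `g` when the elements
of `[lo, i)` and `[mid, j)` have been transferred. -/
structure MergeInv (f g : ℕ → Plane) (lo mid hi i j k : ℕ) : Prop where
  lo_le : lo ≤ i
  le_mid : i ≤ mid
  mid_le : mid ≤ j
  le_hi : j ≤ hi
  pos : k + mid = i + j
  sorted : ∀ a b, lo ≤ a → a ≤ b → b < k → lexLe (g a) (g b)
  le_left : ∀ a b, lo ≤ a → a < k → i ≤ b → b < mid → lexLe (g a) (f b)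
  le_right : ∀ a b, lo ≤ a → a < k → j ≤ b → b < hi → lexLe (g a) (f b)
  mem : ∀ a, lo ≤ a → a < k → ∃ b, lo ≤ b ∧ b < hi ∧ g a = f b
  surj : ∀ b, lo ≤ b ∧ b < i ∨ mid ≤ b ∧ b < j → ∃ a, lo ≤ a ∧ a < k ∧ g a = f b

/-- The invariant looks at the source only below `hi` and at the target only below `k`, so writing
the target cell `k` does not disturb it. -/
theorem MergeInv.congr {f f' g g' : ℕ → Plane} {lo mid hi i j k : ℕ}
    (h : MergeInv f g lo mid hi i j k) (hf : ∀ b < hi, f' b = f b) (hg : ∀ a < k, g' a = g a) :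
    MergeInv f' g' lo mid hi i j k where
  lo_le := h.lo_le
  le_mid := h.le_mid
  mid_le := h.mid_le
  le_hi := h.le_hi
  pos := h.pos
  sorted a b h1 h2 h3 := by
    rw [hg a (by omega), hg b h3]; exact h.sorted a b h1 h2 h3
  le_left a b h1 h2 h3 h4 := by
    have := h.mid_le; have := h.le_hi
    rw [hg a h2, hf b (by omega)]; exact h.le_left a b h1 h2 h3 h4
  le_right a b h1 h2 h3 h4 := by
    rw [hg a h2, hf b h4]; exact h.le_right a b h1 h2 h3 h4
  mem a h1 h2 := by
    obtain ⟨b, k1, k2, k3⟩ := h.mem a h1 h2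
    exact ⟨b, k1, k2, by rw [hg a h2, hf b k2, k3]⟩
  surj b hb := by
    obtain ⟨a, k1, k2, k3⟩ := h.surj b hb
    have := h.le_mid; have := h.mid_le; have := h.le_hi
    exact ⟨a, k1, k2, by rw [hg a k2, hf b (by omega), k3]⟩

theorem MergeInv.init (f g : ℕ → Plane) {lo mid hi : ℕ} (h : lo ≤ mid) (h' : mid ≤ hi) :
    MergeInv f g lo mid hi lo mid lo where
  lo_le := le_rfl
  le_mid := h
  mid_le := le_rfl
  le_hi := h'
  pos := rfl
  sorted a b _ _ _ := by omega
  le_left a b _ _ _ _ := by omega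
  le_right a b _ _ _ _ := by omega
  mem a _ _ := by omega
  surj b hb := by omega

/-- The transferred point precedes the rest of its own block because this block is sorted, and the
rest of the other block because it precedes the head of that block. -/
theorem MergeInv.step_left {f g : ℕ → Plane} {lo mid hi i j k : ℕ}
    (h : MergeInv f g lo mid hi i j k) (hs : ∀ a b, lo ≤ a → a ≤ b → b < mid → lexLe (f a) (f b))
    (hs' : ∀ a b, mid ≤ a → a ≤ b → b < hi → lexLe (f a) (f b)) (hi' : i < mid)
    (hle : j < hi → lexLe (f i) (f j)) (hk : g k = f i) :
    MergeInv f g lo mid hi (i + 1) j (k + 1) where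
  lo_le := by have := h.lo_le; omega
  le_mid := hi'
  mid_le := h.mid_le
  le_hi := h.le_hi
  pos := by have := h.pos; omega
  sorted a b h1 h2 h3 := by
    rcases Nat.lt_succ_iff_lt_or_eq.1 h3 with h4 | rfl
    · exact h.sorted a b h1 h2 h4
    · rcases h2.eq_or_lt with rfl | h2
      · exact lexLe_refl _
      · rw [hk]; exact h.le_left a i h1 h2 le_rfl hi'
  le_left a b h1 h2 h3 h4 := by
    rcases Nat.lt_succ_iff_lt_or_eq.1 h2 with h5 | rfl
    · exact h.le_left a b h1 h5 (by omega) h4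
    · rw [hk]; exact hs i b h.lo_le (by omega) h4
  le_right a b h1 h2 h3 h4 := by
    rcases Nat.lt_succ_iff_lt_or_eq.1 h2 with h5 | rfl
    · exact h.le_right a b h1 h5 h3 h4
    · rw [hk]; exact lexLe_trans (hle (by omega)) (hs' j b h.mid_le h3 h4)
  mem a h1 h2 := by
    rcases Nat.lt_succ_iff_lt_or_eq.1 h2 with h5 | rfl
    · exact h.mem a h1 h5
    · exact ⟨i, h.lo_le, by have := h.mid_le; have := h.le_hi; omega, hk⟩
  surj b hb := by
    by_cases hbi : b = i
    · subst hbi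
      exact ⟨k, by have := h.pos; have := h.lo_le; have := h.mid_le; omega, by omega, hk⟩
    · obtain ⟨a, k1, k2, k3⟩ := h.surj b (by omega)
      exact ⟨a, k1, by omega, k3⟩

theorem MergeInv.step_right {f g : ℕ → Plane} {lo mid hi i j k : ℕ}
    (h : MergeInv f g lo mid hi i j k) (hs : ∀ a b, lo ≤ a → a ≤ b → b < mid → lexLe (f a) (f b))
    (hs' : ∀ a b, mid ≤ a → a ≤ b → b < hi → lexLe (f a) (f b)) (hj : j < hi)
    (hle : i < mid → lexLe (f j) (f i)) (hk : g k = f j) :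
    MergeInv f g lo mid hi i (j + 1) (k + 1) where
  lo_le := h.lo_le
  le_mid := h.le_mid
  mid_le := by have := h.mid_le; omega
  le_hi := hj
  pos := by have := h.pos; omega
  sorted a b h1 h2 h3 := by
    rcases Nat.lt_succ_iff_lt_or_eq.1 h3 with h4 | rfl
    · exact h.sorted a b h1 h2 h4
    · rcases h2.eq_or_lt with rfl | h2
      · exact lexLe_refl _
      · rw [hk]; exact h.le_right a j h1 h2 le_rfl hj
  le_left a b h1 h2 h3 h4 := by
    rcases Nat.lt_succ_iff_lt_or_eq.1 h2 with h5 | rfl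
    · exact h.le_left a b h1 h5 h3 h4
    · rw [hk]; exact lexLe_trans (hle (by omega)) (hs i b h.lo_le h3 h4)
  le_right a b h1 h2 h3 h4 := by
    rcases Nat.lt_succ_iff_lt_or_eq.1 h2 with h5 | rfl
    · exact h.le_right a b h1 h5 (by omega) h4
    · rw [hk]; exact hs' j b h.mid_le (by omega) h4
  mem a h1 h2 := by
    rcases Nat.lt_succ_iff_lt_or_eq.1 h2 with h5 | rfl
    · exact h.mem a h1 h5
    · exact ⟨j, by have := h.mid_le; have := h.lo_le; have := h.le_mid; omega, hj, hk⟩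
  surj b hb := by
    by_cases hbi : b = j
    · subst hbi
      exact ⟨k, by have := h.pos; have := h.lo_le; have := h.mid_le; omega, by omega, hk⟩
    · obtain ⟨a, k1, k2, k3⟩ := h.surj b (by omega)
      exact ⟨a, k1, by omega, k3⟩

/-- The aligned blocks of length `w` of `f` are sorted as far as they lie below `N`. -/
def SortedBlocks (f : ℕ → Plane) (w N : ℕ) : Prop :=
  ∀ m a b, m * w ≤ a → a ≤ b → b < (m + 1) * w → b < N → lexLe (f a) (f b)

/-- The state of a pass that merges pairs of blocks of length `w`, up to index `lo`. -/
structure PassInv (f g : ℕ → Plane) (w N lo : ℕ) : Prop where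
  aligned : ∃ m, lo = min (m * (2 * w)) N
  sorted : SortedBlocks g (2 * w) lo
  mem : ∀ a < lo, ∃ b < N, g a = f b
  surj : ∀ b < lo, ∃ a < lo, g a = f b

theorem PassInv.init (f g : ℕ → Plane) (w N : ℕ) : PassInv f g w N 0 where
  aligned := ⟨0, by simp⟩
  sorted m a b _ _ _ h := by omega
  mem a h := by omega
  surj a h := by omega

theorem PassInv.step {f f' g g' : ℕ → Plane} {w N lo mid hi i j : ℕ} (h : PassInv f g w N lo)
    (hlo : lo < N) (hhi : hi = min (min (lo + w) N + w) N)
    (hmid : mid = min (lo + w) N)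
    (hm : MergeInv f' g' lo mid hi i j hi) (hff : ∀ b < N, f' b = f b)
    (hgg : ∀ a < lo, g' a = g a) :
    PassInv f g' w N hi := by
  obtain ⟨m, hlom⟩ := h.aligned
  have hlom : lo = m * (2 * w) := by omega
  have hsucc : (m + 1) * (2 * w) = m * (2 * w) + 2 * w := by ring
  -- With `k = hi`, the field `pos` reads `hi + mid = i + j`, and both summands are at their upper
  -- bounds.
  have hij : i = mid ∧ j = hi := by
    have := hm.pos; have := hm.le_mid; have := hm.le_hi; omega
  have hN : hi ≤ N := by omega
  refine ⟨⟨m + 1, by omega⟩, fun m' a b h1 h2 h3 h4 => ?_, fun a ha => ?_, fun b hb => ?_⟩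
  · by_cases hb : b < lo
    · rw [hgg a (by omega), hgg b hb]
      exact h.sorted m' a b h1 h2 h3 hb
    -- A block that reaches beyond `lo` and starts before `hi` can only be the block just merged.
    · have e1 : m < m' + 1 := by
        refine lt_of_mul_lt_mul_right (a := 2 * w) ?_ (Nat.zero_le _)
        omega
      have e2 : m' < m + 1 := by
        refine lt_of_mul_lt_mul_right (a := 2 * w) ?_ (Nat.zero_le _)
        omega
      have e3 : m' = m := by omega
      subst e3
      exact hm.sorted a b (by omega) h2 h4
  · by_cases hal : a < lo
    · rw [hgg a hal]; exact h.mem a hal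
    · obtain ⟨b, -, hb, e⟩ := hm.mem a (by omega) ha
      exact ⟨b, by omega, by rw [e, hff b (by omega)]⟩
  · by_cases hbl : b < lo
    · obtain ⟨a, ha, e⟩ := h.surj b hbl
      exact ⟨a, by omega, by rw [hgg a ha, e]⟩
    · obtain ⟨a, -, ha, e⟩ := hm.surj b (by omega)
      exact ⟨a, by omega, by rw [e, hff b (by omega)]⟩

/-! ### Merge sort as a program. -/

namespace RealRAM

/-- Compares two points of the arrays `2`, `3` lexicographically. -/
def lexTest (i j : NExpr) : Test :=
  .neg (.both (.realLe (.load 2 j) (.load 2 i))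
    (.neg (.both (.realLe (.load 2 i) (.load 2 j)) (.realLe (.load 3 j) (.load 3 i)))))

theorem lexTest_holds (s : State) (i j : NExpr) :
    (lexTest i j).Holds s ↔ lexLe (s.pt 2 3 (i.eval s)) (s.pt 2 3 (j.eval s)) := by
  simp only [lexTest, Test.Holds, RExpr.eval, lexLe, State.pt_zero, State.pt_one]
  constructor
  · intro h
    by_cases h1 : s.realArr 2 (i.eval s) < s.realArr 2 (j.eval s)
    · exact Or.inl h1
    · have h2 := not_lt.1 h1
      by_contra h3
      simp only [not_or, not_and, not_le] at h3
      exact h ⟨h2, fun h4 => absurd (h3.2 (le_antisymm h4.1 h2)) (not_lt.2 h4.2)⟩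
  · rintro (h | ⟨h, h'⟩) ⟨h1, h2⟩
    · exact absurd h (not_lt.2 h1)
    · exact h2 ⟨h.le, h'⟩

/-- Copies a point within the arrays `2`, `3`. -/
def copyPoint (dst src : NExpr) : Prog :=
  .seq (.storeReal 2 dst (.load 2 src)) (.storeReal 3 dst (.load 3 src))

/-- One step of a merge. Index register `1` holds the number of points, `3` the start of the source,
`6` and `7` the ends of the two blocks, `8` and `9` the current positions in the blocks, `13` the
current position in the target. -/
def mergeStep : Prog :=
  .seq
    (.cond
      (.both (.natLe (.add (.reg 8) (.const 1)) (.reg 6))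
        (.neg (.both (.natLe (.add (.reg 9) (.const 1)) (.reg 7))
          (.neg (lexTest (.add (.reg 3) (.reg 8)) (.add (.reg 3) (.reg 9)))))))
      (.seq (copyPoint (.add (.add (.reg 3) (.reg 1)) (.reg 13)) (.add (.reg 3) (.reg 8)))
        (.setNat 8 (.add (.reg 8) (.const 1))))
      (.seq (copyPoint (.add (.add (.reg 3) (.reg 1)) (.reg 13)) (.add (.reg 3) (.reg 9)))
        (.setNat 9 (.add (.reg 9) (.const 1)))))
    (.setNat 13 (.add (.reg 13) (.const 1)))

/-- Merges two blocks. -/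
def mergeLoop : Prog := .loop (.natLe (.add (.reg 13) (.const 1)) (.reg 7)) mergeStep

/-- The minimum of two index expressions. -/
def minExpr (e f : NExpr) : NExpr := .sub e (.sub e f)

theorem minExpr_eval (e f : NExpr) (s : State) : (minExpr e f).eval s = min (e.eval s) (f.eval s) := by
  simp only [minExpr, NExpr.eval]; omega

/-- Index register `4` holds the block length, `5` the start of the next pair of blocks. -/
def passStep : Prog :=
  .seq (.setNat 6 (minExpr (.add (.reg 5) (.reg 4)) (.reg 1)))
  (.seq (.setNat 7 (minExpr (.add (.reg 6) (.reg 4)) (.reg 1)))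
  (.seq (.setNat 8 (.reg 5)) (.seq (.setNat 9 (.reg 6)) (.setNat 13 (.reg 5)))))

/-- Merges all pairs of adjacent blocks. -/
def passLoop : Prog :=
  .loop (.natLe (.add (.reg 5) (.const 1)) (.reg 1))
    (.seq passStep (.seq mergeLoop (.setNat 5 (.reg 7))))

/-- Sorts the points in the arrays `2`, `3`; index register `3` points to the sorted sequence. -/
def sortProg : Prog :=
  .seq (.seq (.setNat 3 (.const 0)) (.setNat 4 (.const 1)))
    (.loop (.natLe (.add (.reg 4) (.const 1)) (.reg 1))
      (.seq (.setNat 5 (.const 0)) (.seq passLoop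
        (.seq (.setNat 3 (.add (.reg 3) (.reg 1))) (.setNat 4 (.add (.reg 4) (.reg 4)))))))

/-- Each iteration moves one point and is charged 200 steps. The target segment starts at `base +
N`, beyond all source cells, so the sorted blocks remain intact while they are read. -/
theorem mergeLoop_reach {s : State} {m N base lo mid hi : ℕ} (h1 : s.natReg 1 = N)
    (h3 : s.natReg 3 = base) (h6 : s.natReg 6 = mid) (h7 : s.natReg 7 = hi) (h8 : s.natReg 8 = lo)
    (h9 : s.natReg 9 = mid) (h13 : s.natReg 13 = lo) (hlm : lo ≤ mid) (hmh : mid ≤ hi) (hN : hi ≤ N)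
    (hs : ∀ a b, lo ≤ a → a ≤ b → b < mid → lexLe (s.pt 2 3 (base + a)) (s.pt 2 3 (base + b)))
    (hs' : ∀ a b, mid ≤ a → a ≤ b → b < hi → lexLe (s.pt 2 3 (base + a)) (s.pt 2 3 (base + b)))
    (hm : 200 * (hi - lo) + 20 ≤ m) :
    Reach mergeLoop s m fun s' m' => m ≤ m' + 200 * (hi - lo) + 20 ∧
      (∀ b < base + N + lo, s'.pt 2 3 b = s.pt 2 3 b) ∧
      ∃ i j, MergeInv (fun b => s'.pt 2 3 (base + b)) (fun a => s'.pt 2 3 (base + N + a))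
        lo mid hi i j hi := by
  refine Reach.loop (fun s' m' => ∃ i j k, s'.natReg 8 = i ∧ s'.natReg 9 = j ∧ s'.natReg 13 = k ∧
    m ≤ m' + 200 * (k - lo) ∧ (∀ b < base + N + lo, s'.pt 2 3 b = s.pt 2 3 b) ∧
    MergeInv (fun b => s'.pt 2 3 (base + b)) (fun a => s'.pt 2 3 (base + N + a)) lo mid hi i j k)
    ?_ ?_ ?_ ?_
  · exact ⟨lo, mid, lo, h8, h9, h13, by omega, fun _ _ => rfl, MergeInv.init _ _ hlm hmh⟩
  · rintro s' m' ⟨i, j, k, -, -, -, k4, -, k6⟩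
    have := k6.pos; have := k6.le_mid; have := k6.le_hi
    simp only [Test.cost, NExpr.cost]; omega
  · rintro s' m' hf ⟨i, j, k, k1, k2, k3, k4, k5, k6⟩ hb
    have e1 : s'.natReg 1 = N := (hf.natReg 1 rfl).trans h1
    have e3 : s'.natReg 3 = base := (hf.natReg 3 rfl).trans h3
    have e6 : s'.natReg 6 = mid := (hf.natReg 6 rfl).trans h6
    have e7 : s'.natReg 7 = hi := (hf.natReg 7 rfl).trans h7
    simp only [Test.Holds, NExpr.eval, k3, e7] at hb
    have p1 := k6.pos; have p2 := k6.le_mid; have p3 := k6.le_hi; have p4 := k6.lo_le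
    have p5 := k6.mid_le
    simp only [Test.cost, NExpr.cost]
    refine Reach.exec 150 rfl (by decide) (by omega) ?_
    have same : ∀ b < hi, s'.pt 2 3 (base + b) = s.pt 2 3 (base + b) :=
      fun b hb' => k5 _ (by omega)
    have ts : ∀ a b, lo ≤ a → a ≤ b → b < mid →
        lexLe (s'.pt 2 3 (base + a)) (s'.pt 2 3 (base + b)) := fun a b q1 q2 q3 => by
      rw [same a (by omega), same b (by omega)]; exact hs a b q1 q2 q3
    have ts' : ∀ a b, mid ≤ a → a ≤ b → b < hi →
        lexLe (s'.pt 2 3 (base + a)) (s'.pt 2 3 (base + b)) := fun a b q1 q2 q3 => by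
      rw [same a (by omega), same b (by omega)]; exact hs' a b q1 q2 q3
    -- Common to both branches: the only modified cell of the arrays `2` and `3` is the current
    -- target cell.
    have hpt : ∀ (x : State) (src : ℕ), (∀ a b, x.realArr a b =
        if a = 3 then (if b = base + N + k then s'.realArr 3 src else s'.realArr 3 b) else
        if a = 2 then (if b = base + N + k then s'.realArr 2 src else s'.realArr 2 b) else
          s'.realArr a b) →
        (∀ b < base + N + k, x.pt 2 3 b = s'.pt 2 3 b) ∧
          x.pt 2 3 (base + N + k) = s'.pt 2 3 src := by
      intro x src hx
      constructor
      · intro b hb'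
        have : b ≠ base + N + k := by omega
        simp [State.pt, hx, this]
      · simp [State.pt, hx]
    by_cases ht : (Test.both (.natLe (.add (.reg 8) (.const 1)) (.reg 6))
        (.neg (.both (.natLe (.add (.reg 9) (.const 1)) (.reg 7))
          (.neg (lexTest (.add (.reg 3) (.reg 8)) (.add (.reg 3) (.reg 9))))))).Holds s'
    · set x := mergeStep.exec s' with hx
      have hx' : x = (((s'.storeReal 2 (base + N + k) (s'.realArr 2 (base + i))).storeReal 3
          (base + N + k) (s'.realArr 3 (base + i))).setNat 8 (i + 1)).setNat 13 (k + 1) := by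
        rw [hx, mergeStep]
        simp only [Prog.exec, if_pos ht, copyPoint, NExpr.eval, RExpr.eval, e1, e3, k1, k3,
          State.storeReal_natReg, State.storeReal_realArr, State.setNat_natReg]
        simp
      obtain ⟨q1, q2⟩ := hpt x (base + i) fun a b => by
        rw [hx']
        by_cases ha3 : a = 3
        · subst ha3; simp
        · by_cases ha2 : a = 2
          · subst ha2; simp
          · simp [ha3, ha2]
      simp only [Test.Holds, lexTest_holds, NExpr.eval, k1, k2, e3, e6, e7, not_and, not_not] at ht
      refine ⟨i + 1, j, k + 1, by simp [hx'], by simp [hx', k2], by simp [hx'], by omega,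
        fun b hb' => (q1 b (by omega)).trans (k5 b hb'), ?_⟩
      refine MergeInv.step_left (k6.congr (fun b hb' => q1 _ (by omega)) fun a ha =>
        q1 _ (by omega)) ?_ ?_ ht.1 ?_ ?_
      · intro a b r1 r2 r3
        rw [q1 _ (by omega), q1 _ (by omega)]; exact ts a b r1 r2 r3
      · intro a b r1 r2 r3
        rw [q1 _ (by omega), q1 _ (by omega)]; exact ts' a b r1 r2 r3
      · intro hj
        rw [q1 _ (by omega), q1 _ (by omega)]; exact ht.2 hj
      · rw [q2, q1 _ (by omega)]
    · set x := mergeStep.exec s' with hx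
      have hx' : x = (((s'.storeReal 2 (base + N + k) (s'.realArr 2 (base + j))).storeReal 3
          (base + N + k) (s'.realArr 3 (base + j))).setNat 9 (j + 1)).setNat 13 (k + 1) := by
        rw [hx, mergeStep]
        simp only [Prog.exec, if_neg ht, copyPoint, NExpr.eval, RExpr.eval, e1, e3, k2, k3,
          State.storeReal_natReg, State.storeReal_realArr, State.setNat_natReg]
        simp
      obtain ⟨q1, q2⟩ := hpt x (base + j) fun a b => by
        rw [hx']
        by_cases ha3 : a = 3
        · subst ha3; simp
        · by_cases ha2 : a = 2
          · subst ha2; simp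
          · simp [ha3, ha2]
      simp only [Test.Holds, lexTest_holds, NExpr.eval, k1, k2, e3, e6, e7, not_and, not_not] at ht
      have hjh : j < hi := by
        by_contra hcon
        exact ht (by omega) fun h => absurd h hcon
      refine ⟨i, j + 1, k + 1, by simp [hx', k1], by simp [hx'], by simp [hx'], by omega,
        fun b hb' => (q1 b (by omega)).trans (k5 b hb'), ?_⟩
      refine MergeInv.step_right (k6.congr (fun b hb' => q1 _ (by omega)) fun a ha =>
        q1 _ (by omega)) ?_ ?_ hjh ?_ ?_
      · intro a b r1 r2 r3
        rw [q1 _ (by omega), q1 _ (by omega)]; exact ts a b r1 r2 r3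
      · intro a b r1 r2 r3
        rw [q1 _ (by omega), q1 _ (by omega)]; exact ts' a b r1 r2 r3
      · intro hi'
        rw [q1 _ (by omega), q1 _ (by omega)]
        exact lexLe_of_not fun h => ht hi' fun _ => h
      · rw [q2, q1 _ (by omega)]
  · rintro s' m' hf ⟨i, j, k, k1, k2, k3, k4, k5, k6⟩ hb
    have e7 : s'.natReg 7 = hi := (hf.natReg 7 rfl).trans h7
    simp only [Test.Holds, NExpr.eval, k3, e7] at hb
    have p1 := k6.pos; have p2 := k6.le_mid; have p3 := k6.le_hi
    have hk : k = hi := by omega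
    subst hk
    simp only [Test.cost, NExpr.cost]
    exact ⟨by omega, k5, i, j, k6⟩

end RealRAM

namespace RealRAM

theorem Prog.frame_exec (P : Prog) (h : P.loopFree = true) (s : State) : Frame P s (P.exec s) := by
  obtain ⟨t, -, hr⟩ := P.runs_exec h s
  exact hr.frame

/-- A merged pair is charged 500 steps per point; as it contains at least one point, this also pays
for the fixed overhead of the iteration. -/
theorem passLoop_reach {s : State} {m N base w : ℕ} (h1 : s.natReg 1 = N)
    (h3 : s.natReg 3 = base) (h4 : s.natReg 4 = w) (h5 : s.natReg 5 = 0) (hw : 1 ≤ w)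
    (hs : SortedBlocks (fun b => s.pt 2 3 (base + b)) w N) (hm : 500 * N + 50 ≤ m) :
    Reach passLoop s m fun s' m' => m ≤ m' + 500 * N + 50 ∧
      PassInv (fun b => s.pt 2 3 (base + b)) (fun a => s'.pt 2 3 (base + N + a)) w N N := by
  refine Reach.loop (fun s' m' => ∃ lo, s'.natReg 5 = lo ∧ m ≤ m' + 500 * lo ∧ lo ≤ N ∧
    (∀ b < base + N, s'.pt 2 3 b = s.pt 2 3 b) ∧
    PassInv (fun b => s.pt 2 3 (base + b)) (fun a => s'.pt 2 3 (base + N + a)) w N lo)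
    ?_ ?_ ?_ ?_
  · exact ⟨0, h5, by omega, by omega, fun _ _ => rfl, PassInv.init _ _ _ _⟩
  · rintro s' m' ⟨lo, -, k1, k2, -, -⟩
    simp only [Test.cost, NExpr.cost]; omega
  · rintro s' m' hf ⟨lo, k1, k2, k3, k4, k5⟩ hb
    have e1 : s'.natReg 1 = N := (hf.natReg 1 rfl).trans h1
    have e3 : s'.natReg 3 = base := (hf.natReg 3 rfl).trans h3
    have e4 : s'.natReg 4 = w := (hf.natReg 4 rfl).trans h4
    simp only [Test.Holds, NExpr.eval, k1, e1] at hb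
    simp only [Test.cost, NExpr.cost]
    refine Reach.seq (Reach.exec 70 rfl (by decide) (by omega) ?_)
    have hfx := passStep.frame_exec rfl s'
    have x6 : (passStep.exec s').natReg 6 = min (lo + w) N := by
      simp [passStep, Prog.exec, NExpr.eval, minExpr_eval, e1, e4, k1]
    have x7 : (passStep.exec s').natReg 7 = min (min (lo + w) N + w) N := by
      simp [passStep, Prog.exec, NExpr.eval, minExpr_eval, e1, e4, k1]
    have x8 : (passStep.exec s').natReg 8 = lo := by
      simp [passStep, Prog.exec, NExpr.eval, minExpr_eval, e1, e4, k1]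
    have x9 : (passStep.exec s').natReg 9 = min (lo + w) N := by
      simp [passStep, Prog.exec, NExpr.eval, minExpr_eval, e1, e4, k1]
    have x13 : (passStep.exec s').natReg 13 = lo := by
      simp [passStep, Prog.exec, NExpr.eval, minExpr_eval, e1, e4, k1]
    have x1 := (hfx.natReg 1 rfl).trans e1
    have x3 := (hfx.natReg 3 rfl).trans e3
    have x5 := (hfx.natReg 5 rfl).trans k1
    have xpt : ∀ b, (passStep.exec s').pt 2 3 b = s'.pt 2 3 b := fun b => by
      simp only [State.pt, hfx.realArr 2 rfl, hfx.realArr 3 rfl]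
    generalize passStep.exec s' = x at *
    have xs : ∀ b < N, x.pt 2 3 (base + b) = s.pt 2 3 (base + b) := fun b hb' =>
      (xpt _).trans (k4 _ (by omega))
    -- The two blocks to be merged are the blocks number `2 * q` and `2 * q + 1` of length `w`.
    obtain ⟨q, hq⟩ := k5.aligned
    have hq : lo = q * (2 * w) := by omega
    have hq1 : (2 * q) * w = q * (2 * w) := by ring
    have hq2 : (2 * q + 1) * w = q * (2 * w) + w := by ring
    have hq3 : (2 * q + 1 + 1) * w = q * (2 * w) + w + w := by ring
    refine Reach.seq ((mergeLoop_reach x1 x3 x6 x7 x8 x9 x13 (by omega) (by omega) (by omega)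
      ?_ ?_ (by omega)).mono ?_)
    · intro a b r1 r2 r3
      rw [xs a (by omega), xs b (by omega)]
      exact hs (2 * q) a b (by omega) r2 (by omega) (by omega)
    · intro a b r1 r2 r3
      rw [xs a (by omega), xs b (by omega)]
      exact hs (2 * q + 1) a b (by omega) r2 (by omega) (by omega)
    · rintro y my hfy ⟨y1, y2, i, j, y3⟩
      refine Reach.exec 10 rfl (by decide) (by omega) ?_
      have z7 : y.natReg 7 = min (min (lo + w) N + w) N := (hfy.natReg 7 rfl).trans x7
      refine ⟨min (min (lo + w) N + w) N, by simp [Prog.exec, NExpr.eval, z7], by omega, by omega,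
        fun b hb' => ?_, ?_⟩
      · simp only [State.pt, Prog.exec, State.setNat_realArr]
        exact (y2 b (by omega)).trans ((xpt b).trans (k4 b hb'))
      · refine PassInv.step k5 (by omega) rfl rfl (y3.congr (fun b hb' => ?_) fun a ha => ?_)
          (fun b _ => rfl) fun a ha => ?_
        · exact ((y2 _ (by omega)).trans (xs b (by omega))).symm
        · rfl
        · exact (y2 (base + N + a) (by omega)).trans (xpt _)
  · rintro s' m' hf ⟨lo, k1, k2, k3, k4, k5⟩ hb
    have e1 : s'.natReg 1 = N := (hf.natReg 1 rfl).trans h1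
    simp only [Test.Holds, NExpr.eval, k1, e1] at hb
    have : lo = N := by omega
    subst this
    simp only [Test.cost, NExpr.cost]
    exact ⟨by omega, k5⟩

/-- After `p` passes the blocks have length `2 ^ p`, and the loop runs while `2 ^ p < N`, that is,
while `p < Nat.clog 2 N`. Each pass writes into the next `N` cells, so nothing is copied back; only
the start of the current segment advances. Multiplicities are not tracked: convex hulls need only
the same set of points. -/
theorem sortProg_reach {s : State} {m N : ℕ} (h1 : s.natReg 1 = N) (hN : 1 ≤ N)
    (hm : (500 * N + 100) * Nat.clog 2 N + 50 ≤ m) :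
    Reach sortProg s m fun s' m' => m ≤ m' + (500 * N + 100) * Nat.clog 2 N + 50 ∧
      ∃ base, s'.natReg 3 = base ∧
      (∀ a b, a ≤ b → b < N → lexLe (s'.pt 2 3 (base + a)) (s'.pt 2 3 (base + b))) ∧
      (∀ a < N, ∃ b < N, s'.pt 2 3 (base + a) = s.pt 2 3 b) ∧
      (∀ b < N, ∃ a < N, s'.pt 2 3 (base + a) = s.pt 2 3 b) := by
  refine Reach.seq (Reach.exec 10 rfl (by decide) (by omega) ?_)
  refine Reach.loop (fun s' m' => ∃ base p, s'.natReg 3 = base ∧ s'.natReg 4 = 2 ^ p ∧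
    p ≤ Nat.clog 2 N ∧ m ≤ m' + 10 + (500 * N + 100) * p ∧
    SortedBlocks (fun a => s'.pt 2 3 (base + a)) (2 ^ p) N ∧
    (∀ a < N, ∃ b < N, s'.pt 2 3 (base + a) = s.pt 2 3 b) ∧
    (∀ b < N, ∃ a < N, s'.pt 2 3 (base + a) = s.pt 2 3 b)) ?_ ?_ ?_ ?_
  · refine ⟨0, 0, by simp [Prog.exec, NExpr.eval], by simp [Prog.exec, NExpr.eval], by omega,
      by omega, ?_, fun a ha => ⟨a, ha, ?_⟩, fun a ha => ⟨a, ha, ?_⟩⟩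
    · intro q a b r1 r2 r3 _
      have : a = b := by omega
      subst this
      exact lexLe_refl _
    · simp [State.pt, Prog.exec]
    · simp [State.pt, Prog.exec]
  · rintro s' m' ⟨base, p, -, -, k2, k3, -, -⟩
    have := Nat.mul_le_mul_left (500 * N + 100) k2
    simp only [Test.cost, NExpr.cost]
    omega
  · rintro s' m' hf ⟨base, p, k1, k2, k3, k4, k5, k6, k7⟩ hb
    have e1 : s'.natReg 1 = N := by
      rw [hf.natReg 1 rfl]; simpa [Prog.exec] using h1
    simp only [Test.Holds, NExpr.eval, k2, e1] at hb
    have hp : p + 1 ≤ Nat.clog 2 N := (Nat.lt_clog_iff_pow_lt one_lt_two).2 hb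
    have hc := Nat.mul_le_mul_left (500 * N + 100) hp
    have hc2 : (500 * N + 100) * (p + 1) = (500 * N + 100) * p + (500 * N + 100) := by ring
    simp only [Test.cost, NExpr.cost]
    refine Reach.seq (Reach.exec 10 rfl (by decide) (by omega) ?_)
    refine Reach.seq ((passLoop_reach (N := N) (base := base) (w := 2 ^ p) (by simpa [Prog.exec] using e1)
      (by simpa [Prog.exec] using k1) (by simpa [Prog.exec] using k2)
      (by simp [Prog.exec, NExpr.eval]) Nat.one_le_two_pow ?_ (by omega)).mono ?_)
    · simpa only [State.pt, Prog.exec, State.setNat_realArr] using k5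
    · rintro y my hfy ⟨y1, y2⟩
      refine Reach.exec 20 rfl (by decide) (by omega) ?_
      have z1 : y.natReg 1 = N := by
        rw [hfy.natReg 1 rfl]; simpa [Prog.exec] using e1
      have z3 : y.natReg 3 = base := by
        rw [hfy.natReg 3 rfl]; simpa [Prog.exec] using k1
      have z4 : y.natReg 4 = 2 ^ p := by
        rw [hfy.natReg 4 rfl]; simpa [Prog.exec] using k2
      refine ⟨base + N, p + 1, by simp [Prog.exec, NExpr.eval, z1, z3], ?_, hp, by omega, ?_,
        fun a ha => ?_, fun b hb' => ?_⟩
      · simp [Prog.exec, NExpr.eval, z4]; ring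
      · have := y2.sorted
        rw [pow_succ, mul_comm]
        simpa only [State.pt, Prog.exec, State.setNat_realArr] using this
      · obtain ⟨c, hc, hc'⟩ := y2.mem a ha
        obtain ⟨b, hb, hb'⟩ := k6 c hc
        exact ⟨b, hb, hc'.trans hb'⟩
      · obtain ⟨c, hc, hc'⟩ := k7 b hb'
        obtain ⟨a, ha, ha'⟩ := y2.surj c hc
        exact ⟨a, ha, ha'.trans hc'⟩
  · rintro s' m' hf ⟨base, p, k1, k2, k3, k4, k5, k6, k7⟩ hb
    have e1 : s'.natReg 1 = N := by
      rw [hf.natReg 1 rfl]; simpa [Prog.exec] using h1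
    simp only [Test.Holds, NExpr.eval, k2, e1] at hb
    have hc := Nat.mul_le_mul_left (500 * N + 100) k3
    simp only [Test.cost, NExpr.cost]
    exact ⟨by omega, base, k1, fun a b r1 r2 => k5 0 a b (by omega) r1 (by omega) r2, k6, k7⟩

end RealRAM

/-! ### Upper hulls -/

/-- `c 0, …, c (K - 1)` runs to the right and turns strictly to the right at each vertex. -/
structure UpperChain (c : ℕ → Plane) (K : ℕ) : Prop where
  lt : ∀ i, i + 1 < K → c i 0 < c (i + 1) 0
  turn : ∀ i, i + 2 < K → (c (i + 1) 0 - c i 0) * (c (i + 2) 1 - c (i + 1) 1) <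
    (c (i + 1) 1 - c i 1) * (c (i + 2) 0 - c (i + 1) 0)

theorem UpperChain.of_le {c : ℕ → Plane} {K K' : ℕ} (h : UpperChain c K) (hK : K' ≤ K) :
    UpperChain c K' :=
  ⟨fun i hi => h.lt i (by omega), fun i hi => h.turn i (by omega)⟩

/-- The chain `c` is the upper hull of the first `i` points of `f`. -/
structure ScanInv (c f : ℕ → Plane) (K i : ℕ) : Prop where
  pos : 1 ≤ K
  le : K ≤ i
  chain : UpperChain c K
  mem : ∀ l < K, ∃ a < i, c l = f a
  dom : ∀ a < i, ∀ u : Plane, 0 ≤ u 1 → ∃ l < K, dot (f a) u ≤ dot (c l) u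

/-- The situation while vertices are removed before `p` is appended. -/
structure PopInv (c f : ℕ → Plane) (K i : ℕ) (p : Plane) : Prop where
  pos : 1 ≤ K
  le : K ≤ i
  chain : UpperChain c K
  mem : ∀ l < K, ∃ a < i, c l = f a
  dom : ∀ a < i, ∀ u : Plane, 0 ≤ u 1 →
    (∃ l < K, dot (f a) u ≤ dot (c l) u) ∨ dot (f a) u ≤ dot p u
  lt : c (K - 1) 0 < p 0

/-- The last vertex lies on or below the segment from its predecessor to `p`. -/
def Removable (c : ℕ → Plane) (K : ℕ) (p : Plane) : Prop :=
  2 ≤ K ∧ (c (K - 1) 1 - c (K - 2) 1) * (p 0 - c (K - 2) 0) ≤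
    (c (K - 1) 0 - c (K - 2) 0) * (p 1 - c (K - 2) 1)

theorem ScanInv.congr {c f f' : ℕ → Plane} {K i : ℕ} (h : ScanInv c f K i)
    (hf : ∀ a < i, f a = f' a) : ScanInv c f' K i where
  pos := h.pos
  le := h.le
  chain := h.chain
  mem l hl := by
    obtain ⟨a, ha, e⟩ := h.mem l hl
    exact ⟨a, ha, by rw [e, hf a ha]⟩
  dom a ha u hu := by
    rw [← hf a ha]
    exact h.dom a ha u hu

theorem ScanInv.init {c f : ℕ → Plane} (h : c 0 = f 0) : ScanInv c f 1 1 where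
  pos := le_rfl
  le := le_rfl
  chain := ⟨fun i hi => by omega, fun i hi => by omega⟩
  mem l hl := ⟨0, one_pos, by rw [← h]; congr; omega⟩
  dom a ha u _ := ⟨0, one_pos, by rw [h]; apply le_of_eq; congr; omega⟩

/-- The last vertex is an earlier point, so it has the same abscissa and, since ties are sorted
downwards, at least the same ordinate. It therefore dominates the new point in all upward
directions. -/
theorem ScanInv.skip {c f : ℕ → Plane} {K i : ℕ} (h : ScanInv c f K i)
    (hs : ∀ a < i, lexLe (f a) (f i)) (hlt : ¬ c (K - 1) 0 < f i 0) : ScanInv c f K (i + 1) where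
  pos := h.pos
  le := by have := h.le; omega
  chain := h.chain
  mem l hl := by
    obtain ⟨a, ha, e⟩ := h.mem l hl
    exact ⟨a, by omega, e⟩
  dom a ha u hu := by
    rcases Nat.lt_succ_iff_lt_or_eq.1 ha with ha | rfl
    · exact h.dom a ha u hu
    · have hK := h.pos
      obtain ⟨b, hb, e⟩ := h.mem (K - 1) (by omega)
      refine ⟨K - 1, by omega, ?_⟩
      have := hs b hb
      rw [← e, lexLe] at this
      rcases this with h1 | ⟨h1, h2⟩
      · exact absurd h1 hlt
      · rw [dot, dot, h1]
        nlinarith [mul_le_mul_of_nonneg_right h2 hu]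

theorem ScanInv.popInv {c f : ℕ → Plane} {K i : ℕ} {p : Plane} (h : ScanInv c f K i)
    (hlt : c (K - 1) 0 < p 0) : PopInv c f K i p :=
  ⟨h.pos, h.le, h.chain, h.mem, fun a ha u hu => Or.inl (h.dom a ha u hu), hlt⟩

/-- A vertex on or below the segment from its predecessor to `p` is dominated, in each upward
direction, by one of the two ends of this segment. -/
theorem PopInv.pop {c f : ℕ → Plane} {K i : ℕ} {p : Plane} (h : PopInv c f K i p)
    (hr : Removable c K p) : PopInv c f (K - 1) i p := by
  obtain ⟨hK, hcond⟩ := hr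
  obtain ⟨k, rfl⟩ : ∃ k, K = k + 2 := ⟨K - 2, by omega⟩
  have hlt := h.lt
  have hmono := h.chain.lt k (by omega)
  simp only [Nat.add_sub_cancel, show k + 2 - 1 = k + 1 from rfl] at *
  refine ⟨by omega, by have := h.le; omega, h.chain.of_le (by omega), fun l hl => h.mem l (by omega), ?_, ?_⟩
  · intro a ha u hu
    rcases h.dom a ha u hu with ⟨l, hl, e⟩ | e
    · by_cases hlk : l < k + 1
      · exact Or.inl ⟨l, hlk, e⟩
      · have hlk : l = k + 1 := by omega
        subst hlk
        -- The weights are those expressing the abscissa of the removed vertex as a convex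
        -- combination of the two ends, cleared of denominators.
        have key : (p 0 - c k 0) * dot (c (k + 1)) u ≤
            (p 0 - c (k + 1) 0) * dot (c k) u + (c (k + 1) 0 - c k 0) * dot p u := by
          simp only [dot]
          nlinarith [mul_le_mul_of_nonneg_right hcond hu]
        by_contra hcon
        simp only [not_or, not_exists, not_and, not_le] at hcon
        have h1 := lt_of_lt_of_le (hcon.1 k (by omega)) e
        have h2 := lt_of_lt_of_le hcon.2 e
        nlinarith [mul_lt_mul_of_pos_left h1 (sub_pos.2 hlt),
          mul_lt_mul_of_pos_left h2 (sub_pos.2 hmono)]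
    · exact Or.inr e
  · simp only [Nat.add_sub_cancel]
    exact hmono.trans hlt

/-- That the last vertex is not removable is exactly the strict right turn there; collinear vertices
have been removed as well. -/
theorem PopInv.push {c c' f : ℕ → Plane} {K i : ℕ} (h : PopInv c f K i (f i))
    (hr : ¬ Removable c K (f i)) (hc : ∀ l < K, c' l = c l) (hK : c' K = f i) :
    ScanInv c' f (K + 1) (i + 1) where
  pos := by omega
  le := by have := h.le; omega
  chain := by
    have hp := h.pos
    refine ⟨fun l hl => ?_, fun l hl => ?_⟩
    · rcases Nat.lt_succ_iff_lt_or_eq.1 hl with hl | hl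
      · rw [hc l (by omega), hc _ hl]; exact h.chain.lt l hl
      · rw [hc l (by omega), hl, hK]
        have : l = K - 1 := by omega
        rw [this]; exact h.lt
    · rcases Nat.lt_succ_iff_lt_or_eq.1 hl with hl | hl
      · rw [hc l (by omega), hc (l + 1) (by omega), hc _ hl]; exact h.chain.turn l hl
      · rw [hc l (by omega), hc (l + 1) (by omega), hl, hK]
        simp only [Removable, not_and, not_le] at hr
        have h1 : K - 1 = l + 1 := by omega
        have h2 : K - 2 = l := by omega
        have := hr (by omega)
        rw [h1, h2] at this
        linarith
  mem l hl := by
    rcases Nat.lt_succ_iff_lt_or_eq.1 hl with hl | rfl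
    · obtain ⟨a, ha, e⟩ := h.mem l hl
      exact ⟨a, by omega, by rw [hc l hl, e]⟩
    · exact ⟨i, by omega, hK⟩
  dom a ha u hu := by
    rcases Nat.lt_succ_iff_lt_or_eq.1 ha with ha | rfl
    · rcases h.dom a ha u hu with ⟨l, hl, e⟩ | e
      · exact ⟨l, by omega, by rw [hc l hl]; exact e⟩
      · exact ⟨K, by omega, by rw [hK]; exact e⟩
    · exact ⟨K, by omega, by rw [hK]⟩

/-! ### The hull scan as a program. -/

namespace RealRAM

/-- Removes vertices; index register `10` holds the number of vertices, the real registers `10` and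
`11` the point that is to be appended. -/
def popLoop (cx cy : ℕ) : Prog :=
  .loop (.both (.natLe (.const 2) (.reg 10))
    (.realLe
      (.mul (.sub (.load cy (.sub (.reg 10) (.const 1))) (.load cy (.sub (.reg 10) (.const 2))))
        (.sub (.reg 10) (.load cx (.sub (.reg 10) (.const 2)))))
      (.mul (.sub (.load cx (.sub (.reg 10) (.const 1))) (.load cx (.sub (.reg 10) (.const 2))))
        (.sub (.reg 11) (.load cy (.sub (.reg 10) (.const 2)))))))
    (.setNat 10 (.sub (.reg 10) (.const 1)))

/-- Appends a vertex. -/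
def pushProg (cx cy : ℕ) : Prog :=
  .seq (.storeReal cx (.reg 10) (.reg 10)) (.seq (.storeReal cy (.reg 10) (.reg 11))
    (.setNat 10 (.add (.reg 10) (.const 1))))

/-- Computes the upper hull of the sorted points. -/
def scanProg (cx cy : ℕ) : Prog :=
  .seq
    (.seq (.setReal 10 (.load 2 (.reg 3))) (.seq (.setReal 11 (.load 3 (.reg 3)))
      (.seq (.setNat 10 (.const 0)) (.seq (.setNat 5 (.const 1)) (pushProg cx cy)))))
    (.loop (.natLe (.add (.reg 5) (.const 1)) (.reg 1))
      (.seq (.seq (.setReal 10 (.load 2 (.add (.reg 3) (.reg 5))))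
          (.setReal 11 (.load 3 (.add (.reg 3) (.reg 5)))))
        (.seq (.cond (.neg (.realLe (.reg 10) (.load cx (.sub (.reg 10) (.const 1)))))
            (.seq (popLoop cx cy) (pushProg cx cy)) .skip)
          (.setNat 5 (.add (.reg 5) (.const 1))))))

theorem popLoop_reach {cx cy : ℕ} {s : State} {m K i : ℕ} {f : ℕ → Plane} {p : Plane}
    (h10 : s.natReg 10 = K) (hp0 : s.realReg 10 = p 0) (hp1 : s.realReg 11 = p 1)
    (hI : PopInv (s.pt cx cy) f K i p) (hm : 100 * K + 50 ≤ m) :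
    Reach (popLoop cx cy) s m fun s' m' => ∃ K', s'.natReg 10 = K' ∧
      m + 100 * K' ≤ m' + 100 * K + 50 ∧ PopInv (s.pt cx cy) f K' i p ∧
      ¬ Removable (s.pt cx cy) K' p := by
  have harr : ∀ {s' : State}, Frame (.setNat 10 (.sub (.reg 10) (.const 1))) s s' →
      (∀ a, s'.realArr a = s.realArr a) ∧ s'.realReg 10 = p 0 ∧ s'.realReg 11 = p 1 := fun hf =>
    ⟨fun a => hf.realArr a rfl, (hf.realReg 10 rfl).trans hp0, (hf.realReg 11 rfl).trans hp1⟩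
  refine Reach.loop (fun s' m' => ∃ K', s'.natReg 10 = K' ∧
      m + 100 * K' ≤ m' + 100 * K ∧ PopInv (s.pt cx cy) f K' i p) ?_ ?_ ?_ ?_
  · exact ⟨K, h10, le_rfl, hI⟩
  · rintro s' m' ⟨K', -, k1, k2⟩
    simp only [Test.cost, NExpr.cost, RExpr.cost]; omega
  · rintro s' m' hf ⟨K', k0, k1, k2⟩ hb
    obtain ⟨ha, r0, r1⟩ := harr hf
    have hrem : Removable (s.pt cx cy) K' p := by
      simpa [Test.Holds, NExpr.eval, RExpr.eval, k0, r0, r1, ha, Removable] using hb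
    have := hrem.1
    simp only [Test.cost, NExpr.cost, RExpr.cost]
    refine Reach.exec 10 rfl (by decide) (by omega) ?_
    exact ⟨K' - 1, by simp [Prog.exec, NExpr.eval, k0], by omega, k2.pop hrem⟩
  · rintro s' m' hf ⟨K', k0, k1, k2⟩ hb
    obtain ⟨ha, r0, r1⟩ := harr hf
    have hrem : ¬ Removable (s.pt cx cy) K' p := by
      simpa [Test.Holds, NExpr.eval, RExpr.eval, k0, r0, r1, ha, Removable] using hb
    simp only [Test.cost, NExpr.cost, RExpr.cost]
    exact ⟨K', k0, by omega, k2, hrem⟩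

/-- Amortized analysis: each stored vertex carries a credit of 100 steps that pays for its removal,
and each point adds at most one vertex. The conditions on `cx` and `cy` keep the stack apart from
the sorted points. -/
theorem scanProg_reach {cx cy : ℕ} (hcx : 3 < cx) (hcy : cx < cy) {s : State} {m N base : ℕ}
    (h1 : s.natReg 1 = N) (h3 : s.natReg 3 = base) (hN : 1 ≤ N)
    (hs : ∀ a b, a ≤ b → b < N → lexLe (s.pt 2 3 (base + a)) (s.pt 2 3 (base + b)))
    (hm : 500 * N + 50 ≤ m) :
    Reach (scanProg cx cy) s m fun s' m' => m ≤ m' + 500 * N + 50 ∧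
      ∃ K, s'.natReg 10 = K ∧ ScanInv (s'.pt cx cy) (fun a => s.pt 2 3 (base + a)) K N := by
  have n1 : 2 ≠ cx := by omega
  have n2 : 3 ≠ cx := by omega
  have n3 : 2 ≠ cy := by omega
  have n4 : 3 ≠ cy := by omega
  have n5 : cx ≠ cy := by omega
  have n5' : cy ≠ cx := by omega
  refine Reach.seq (Reach.exec 40 rfl
    (by simp [Prog.bound, NExpr.cost, RExpr.cost, pushProg]) (by omega) ?_)
  -- The term `100 * K` is the potential of the current chain.
  refine Reach.loop (fun s' m' => ∃ K i, s'.natReg 10 = K ∧ s'.natReg 5 = i ∧ i ≤ N ∧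
    m + 100 * K ≤ m' + 500 * i ∧
    ScanInv (s'.pt cx cy) (fun a => s.pt 2 3 (base + a)) K i) ?_ ?_ ?_ ?_
  · refine ⟨1, 1, by simp [Prog.exec, NExpr.eval, pushProg], by simp [Prog.exec, NExpr.eval, pushProg],
      hN, by omega, ScanInv.init ?_⟩
    simp [State.pt, Prog.exec, NExpr.eval, RExpr.eval, pushProg, h3, n5]
  · rintro s' m' ⟨K, i, -, -, k2, k3, k4⟩
    have := k4.pos
    simp only [Test.cost, NExpr.cost]; omega
  · rintro s' m' hf ⟨K, i, k0, k1, k2, k3, k4⟩ hb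
    have e1 : s'.natReg 1 = N := by
      rw [hf.natReg 1 rfl]; simpa [Prog.exec, pushProg] using h1
    have e3 : s'.natReg 3 = base := by
      rw [hf.natReg 3 rfl]; simpa [Prog.exec, pushProg] using h3
    have ept : ∀ a, s'.pt 2 3 a = s.pt 2 3 a := by
      have a2 := hf.realArr 2 (by simp [Prog.keepsRealArr, popLoop, pushProg, n1, n3])
      have a3 := hf.realArr 3 (by simp [Prog.keepsRealArr, popLoop, pushProg, n2, n4])
      intro a
      simp [State.pt, a2, a3, Prog.exec, pushProg, n1, n2, n3, n4]
    simp only [Test.Holds, NExpr.eval, k1, e1] at hb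
    simp only [Test.cost, NExpr.cost]
    have hpos := k4.pos
    refine Reach.seq (Reach.exec 20 rfl (by decide) (by omega) ?_)
    have hx := Prog.frame_exec (.seq (.setReal 10 (.load 2 (.add (.reg 3) (.reg 5))))
          (.setReal 11 (.load 3 (.add (.reg 3) (.reg 5))))) rfl s'
    have r0 : (Prog.exec (.seq (.setReal 10 (.load 2 (.add (.reg 3) (.reg 5))))
          (.setReal 11 (.load 3 (.add (.reg 3) (.reg 5))))) s').realReg 10 =
          (s.pt 2 3 (base + i)) 0 := by
      rw [← ept]; simp [Prog.exec, NExpr.eval, RExpr.eval, e3, k1]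
    have r1 : (Prog.exec (.seq (.setReal 10 (.load 2 (.add (.reg 3) (.reg 5))))
          (.setReal 11 (.load 3 (.add (.reg 3) (.reg 5))))) s').realReg 11 =
          (s.pt 2 3 (base + i)) 1 := by
      rw [← ept]; simp [Prog.exec, NExpr.eval, RExpr.eval, e3, k1]
    generalize Prog.exec _ s' = x at *
    have x10 := (hx.natReg 10 rfl).trans k0
    have x5 := (hx.natReg 5 rfl).trans k1
    have xpt : x.pt cx cy = s'.pt cx cy := by
      funext a
      simp only [State.pt, hx.realArr cx rfl, hx.realArr cy rfl]
    rw [← xpt] at k4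
    refine Reach.seq (Reach.cond ?_ ?_ ?_)
    · simp only [Test.cost, NExpr.cost, RExpr.cost]; omega
    · intro hc
      simp only [Test.cost, NExpr.cost, RExpr.cost]
      simp only [Test.Holds, NExpr.eval, RExpr.eval, x10, r0, not_le] at hc
      refine Reach.seq ((popLoop_reach x10 r0 r1 (k4.popInv hc) (by omega)).mono ?_)
      rintro y my hfy ⟨K', y1, y2, y3, y4⟩
      have y10 : y.realReg 10 = (s.pt 2 3 (base + i)) 0 := (hfy.realReg 10 rfl).trans r0
      have y11 : y.realReg 11 = (s.pt 2 3 (base + i)) 1 := (hfy.realReg 11 rfl).trans r1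
      have y5 := (hfy.natReg 5 rfl).trans x5
      have ypt : ∀ l, y.pt cx cy l = x.pt cx cy l := fun l => by
        simp only [State.pt, hfy.realArr cx rfl, hfy.realArr cy rfl]
      have := y3.pos
      refine Reach.exec 20 rfl (by simp [Prog.bound, NExpr.cost, RExpr.cost, pushProg]) (by omega) ?_
      refine Reach.exec 10 rfl (by decide) (by omega) ?_
      refine ⟨K' + 1, i + 1, ?_, ?_, by omega, by omega, y3.push y4 (fun l hl => ?_) ?_⟩
      · simp [Prog.exec, NExpr.eval, RExpr.eval, pushProg, y1]
      · simp [Prog.exec, NExpr.eval, RExpr.eval, pushProg, y5]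
      · have : l ≠ K' := by omega
        rw [← ypt]
        simp [State.pt, Prog.exec, NExpr.eval, RExpr.eval, pushProg, y1, this]
      · simp only [State.pt, Prog.exec, NExpr.eval, RExpr.eval, pushProg, y1, y10]
        simp [State.pt, y1, y11, n5]
    · intro hc
      simp only [Test.cost, NExpr.cost, RExpr.cost]
      simp only [Test.Holds, NExpr.eval, RExpr.eval, x10, r0, not_le] at hc
      refine Reach.exec 5 rfl (by decide) (by omega) ?_
      refine Reach.exec 10 rfl (by decide) (by omega) ?_
      refine ⟨K, i + 1, by simpa [Prog.exec] using x10, by simp [Prog.exec, NExpr.eval, x5], by omega,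
        by omega, ?_⟩
      exact k4.skip (fun a ha => hs a i ha.le hb) hc
  · rintro s' m' hf ⟨K, i, k0, k1, k2, k3, k4⟩ hb
    have e1 : s'.natReg 1 = N := by
      rw [hf.natReg 1 rfl]; simpa [Prog.exec, pushProg] using h1
    simp only [Test.Holds, NExpr.eval, k1, e1] at hb
    have : i = N := by omega
    subst this
    simp only [Test.cost, NExpr.cost]
    exact ⟨by omega, K, k0, k4⟩

/-- The upper hull of the points in the arrays `2`, `3` is written into the arrays `cx`, `cy`. -/
def hullProg (cx cy : ℕ) : Prog := .seq sortProg (scanProg cx cy)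

theorem hullProg_reach {cx cy : ℕ} (hcx : 3 < cx) (hcy : cx < cy) {s : State} {m N : ℕ}
    (h1 : s.natReg 1 = N) (hN : 1 ≤ N)
    (hm : (500 * N + 100) * Nat.clog 2 N + 500 * N + 100 ≤ m) :
    Reach (hullProg cx cy) s m fun s' m' =>
      m ≤ m' + ((500 * N + 100) * Nat.clog 2 N + 500 * N + 100) ∧
      ∃ K, s'.natReg 10 = K ∧ ScanInv (s'.pt cx cy) (s.pt 2 3) K N := by
  refine Reach.seq ((sortProg_reach h1 hN (by omega)).mono ?_)
  rintro x mx hfx ⟨x1, base, x3, x4, x5, x6⟩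
  refine (scanProg_reach hcx hcy ((hfx.natReg 1 rfl).trans h1) x3 hN x4 (by omega)).mono ?_
  rintro y my hfy ⟨y1, K, y2, y3⟩
  refine ⟨by omega, K, y2, y3.pos, y3.le, y3.chain, fun l hl => ?_, fun a ha u hu => ?_⟩
  · obtain ⟨a, ha, e⟩ := y3.mem l hl
    obtain ⟨b, hb, e'⟩ := x5 a ha
    exact ⟨b, hb, e.trans e'⟩
  · obtain ⟨b, hb, e'⟩ := x6 a ha
    rw [← e']
    exact y3.dom b hb u hu

end RealRAM

/-! ### Sums of upper hulls -/

/-- If `b` is not steeper than `a` and `a` already descends with respect to the upward direction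
`u`, then so does `b`. -/
theorem edge_dot_nonpos {a b u : Plane} (ha : 0 < a 0) (hb : 0 ≤ b 0) (hu : 0 ≤ u 1)
    (hab : b 1 * a 0 ≤ a 1 * b 0) (h : dot a u ≤ 0) : dot b u ≤ 0 := by
  have key : a 0 * dot b u ≤ b 0 * dot a u := by
    simp only [dot]
    nlinarith [mul_le_mul_of_nonneg_right hab hu]
  have := mul_nonpos_of_nonneg_of_nonpos hb h
  by_contra hcon
  nlinarith [mul_pos ha (not_le.1 hcon)]

theorem UpperChain.edge_nonpos {c : ℕ → Plane} {K i : ℕ} (h : UpperChain c K) {u : Plane}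
    (hu : 0 ≤ u 1) (hi : dot (c (i + 1) - c i) u ≤ 0) (k : ℕ) (hik : i ≤ k) (hk : k + 1 < K) :
    dot (c (k + 1) - c k) u ≤ 0 := by
  induction k, hik using Nat.le_induction with
  | base => exact hi
  | succ k hik ih =>
    refine edge_dot_nonpos ?_ ?_ hu ?_ (ih (by omega))
    · simpa using h.lt k (by omega)
    · simpa using (h.lt (k + 1) hk).le
    · have := h.turn k hk
      simp only [PiLp.sub_apply]
      linarith

/-- Concavity: once an edge descends, all later edges do. A local test at vertex `i` therefore
bounds everything to its right. -/
theorem UpperChain.dot_le {c : ℕ → Plane} {K i : ℕ} (h : UpperChain c K) {u : Plane}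
    (hu : 0 ≤ u 1) (hi : i + 1 < K → dot (c (i + 1) - c i) u ≤ 0) (k : ℕ) (hik : i ≤ k)
    (hk : k < K) : dot (c k) u ≤ dot (c i) u := by
  induction k, hik using Nat.le_induction with
  | base => exact le_rfl
  | succ k hik ih =>
    have := h.edge_nonpos hu (hi (by omega)) k hik hk
    rw [dot_sub_left] at this
    linarith [ih (by omega)]

/-- The state of the computation of the sum `d` of the chains `A` and `B` when the vertices before
`A i` and before `B j` have been passed. -/
structure SumInv (A B d : ℕ → Plane) (KA KB i j : ℕ) : Prop where
  le : i ≤ KA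
  lt : j < KB
  mem : ∀ l < i + j, ∃ a < KA, ∃ b < KB, d l = A a + B b
  dom : ∀ u : Plane, 0 ≤ u 1 →
    (∃ l < i + j, ∀ a < KA, ∀ b < KB, dot (A a) u + dot (B b) u ≤ dot (d l) u) ∨
    (i < KA ∧ (∀ a < KA, ∃ a', i ≤ a' ∧ a' < KA ∧ dot (A a) u ≤ dot (A a') u) ∧
      ∀ b < KB, ∃ b', j ≤ b' ∧ b' < KB ∧ dot (B b) u ≤ dot (B b') u)

theorem SumInv.init {A B d : ℕ → Plane} {KA KB : ℕ} (hA : 1 ≤ KA) (hB : 1 ≤ KB) :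
    SumInv A B d KA KB 0 0 where
  le := by omega
  lt := hB
  mem l hl := by omega
  dom u hu := Or.inr ⟨hA, fun a ha => ⟨a, by omega, ha, le_rfl⟩,
    fun b hb => ⟨b, by omega, hb, le_rfl⟩⟩

/-- The next vertex of `B` is to be passed before the next vertex of `A`. -/
def RightFirst (A B : ℕ → Plane) (KA KB i j : ℕ) : Prop :=
  j + 1 < KB ∧ ¬ (i + 1 < KA ∧
    (B (j + 1) 1 - B j 1) * (A (i + 1) 0 - A i 0) ≤ (A (i + 1) 1 - A i 1) * (B (j + 1) 0 - B j 0))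

/-- For a direction whose maximum is still ahead there are two cases. If the next edge of `B`
ascends, some maximum over `B` lies beyond `B j` and nothing is lost by passing it. If it descends,
the next edge of `A`, being less steep, descends too; then `A i` and `B j` are both maximal, and
their sum has just been recorded. -/
theorem SumInv.step_right {A B d d' : ℕ → Plane} {KA KB i j : ℕ} (h : SumInv A B d KA KB i j)
    (hA : UpperChain A KA) (hB : UpperChain B KB) (hi : i < KA) (hr : RightFirst A B KA KB i j)
    (hd : ∀ l < i + j, d' l = d l) (hd' : d' (i + j) = A i + B j) :
    SumInv A B d' KA KB i (j + 1) where
  le := h.le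
  lt := hr.1
  mem l hl := by
    rcases Nat.lt_succ_iff_lt_or_eq.1 hl with hl | rfl
    · rw [hd l hl]; exact h.mem l hl
    · exact ⟨i, hi, j, h.lt, hd'⟩
  dom u hu := by
    obtain ⟨hj, hr⟩ := hr
    rcases h.dom u hu with ⟨l, hl, e⟩ | ⟨-, eA, eB⟩
    · exact Or.inl ⟨l, by omega, by rw [hd l hl]; exact e⟩
    by_cases hpos : 0 < dot (B (j + 1) - B j) u
    · refine Or.inr ⟨hi, eA, fun b hb => ?_⟩
      obtain ⟨b', h1, h2, h3⟩ := eB b hb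
      rcases h1.eq_or_lt with rfl | h1
      · refine ⟨j + 1, le_rfl, hj, ?_⟩
        rw [dot_sub_left] at hpos
        linarith
      · exact ⟨b', h1, h2, h3⟩
    · refine Or.inl ⟨i + j, by omega, fun a ha b hb => ?_⟩
      obtain ⟨a', a1, a2, a3⟩ := eA a ha
      obtain ⟨b', b1, b2, b3⟩ := eB b hb
      have qB := hB.dot_le hu (fun _ => not_lt.1 hpos) b' b1 b2
      have qA := hA.dot_le (i := i) hu (fun hi' => by
        simp only [not_and, not_le] at hr
        refine edge_dot_nonpos ?_ ?_ hu ?_ (not_lt.1 hpos)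
        · simpa using hB.lt j hj
        · simpa using (hA.lt i hi').le
        · simp only [PiLp.sub_apply]; exact (hr hi').le) a' a1 a2
      rw [hd', dot_add_left]
      linarith

theorem SumInv.step_left {A B d d' : ℕ → Plane} {KA KB i j : ℕ} (h : SumInv A B d KA KB i j)
    (hA : UpperChain A KA) (hB : UpperChain B KB) (hi : i < KA) (hr : ¬ RightFirst A B KA KB i j)
    (hd : ∀ l < i + j, d' l = d l) (hd' : d' (i + j) = A i + B j) :
    SumInv A B d' KA KB (i + 1) j where
  le := hi
  lt := h.lt
  mem l hl := by
    rcases Nat.lt_succ_iff_lt_or_eq.1 (show l < i + j + 1 by omega) with hl | rfl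
    · rw [hd l hl]; exact h.mem l hl
    · exact ⟨i, hi, j, h.lt, hd'⟩
  dom u hu := by
    have hr := fun hj => by_contra fun hi' => hr ⟨hj, hi'⟩
    rcases h.dom u hu with ⟨l, hl, e⟩ | ⟨-, eA, eB⟩
    · exact Or.inl ⟨l, by omega, by rw [hd l hl]; exact e⟩
    by_cases hpos : i + 1 < KA ∧ 0 < dot (A (i + 1) - A i) u
    · refine Or.inr ⟨hpos.1, fun a ha => ?_, eB⟩
      obtain ⟨a', h1, h2, h3⟩ := eA a ha
      rcases h1.eq_or_lt with rfl | h1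
      · refine ⟨i + 1, le_rfl, hpos.1, ?_⟩
        have := hpos.2
        rw [dot_sub_left] at this
        linarith
      · exact ⟨a', h1, h2, h3⟩
    · simp only [not_and, not_lt] at hpos
      refine Or.inl ⟨i + j, by omega, fun a ha b hb => ?_⟩
      obtain ⟨a', a1, a2, a3⟩ := eA a ha
      obtain ⟨b', b1, b2, b3⟩ := eB b hb
      have qA := hA.dot_le hu hpos a' a1 a2
      have qB := hB.dot_le (i := j) hu (fun hj' => by
        obtain ⟨hi', hslope⟩ := hr hj'
        refine edge_dot_nonpos ?_ ?_ hu ?_ (hpos hi')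
        · simpa using hA.lt i hi'
        · simpa using (hB.lt j hj').le
        · simp only [PiLp.sub_apply]; exact hslope) b' b1 b2
      rw [hd', dot_add_left]
      linarith

/-- Rotation by the angle with cosine `C` and sine `-S`. -/
noncomputable def rotBack (C S : ℝ) (d : Plane) : Plane := !₂[C * d 0 + S * d 1, C * d 1 - S * d 0]

/-- The points `e` are the points `±d l` and their rotations. -/
def Layout (C S : ℝ) (d e : ℕ → Plane) (L : ℕ) : Prop :=
  ∀ l < L, e (4 * l) = d l ∧ e (4 * l + 1) = -d l ∧ e (4 * l + 2) = rotBack C S (d l) ∧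
    e (4 * l + 3) = -rotBack C S (d l)

/-! ### The Minkowski sum of two chains as a program. -/

namespace RealRAM

/-- Writes a sum of two vertices, its rotation, and their negatives into the arrays `2`, `3`. -/
def emitProg : Prog :=
  .seq (.setReal 8 (.add (.load 4 (.reg 8)) (.load 6 (.reg 9))))
  (.seq (.setReal 9 (.add (.load 5 (.reg 8)) (.load 7 (.reg 9))))
  (.seq (.setReal 10 (.add (.mul (.reg 6) (.reg 8)) (.mul (.reg 7) (.reg 9))))
  (.seq (.setReal 11 (.sub (.mul (.reg 6) (.reg 9)) (.mul (.reg 7) (.reg 8))))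
  (.seq (.storeReal 2 (.reg 1) (.reg 8))
  (.seq (.storeReal 3 (.reg 1) (.reg 9))
  (.seq (.storeReal 2 (.add (.reg 1) (.const 1)) (.sub (.const 0) (.reg 8)))
  (.seq (.storeReal 3 (.add (.reg 1) (.const 1)) (.sub (.const 0) (.reg 9)))
  (.seq (.storeReal 2 (.add (.reg 1) (.const 2)) (.reg 10))
  (.seq (.storeReal 3 (.add (.reg 1) (.const 2)) (.reg 11))
  (.seq (.storeReal 2 (.add (.reg 1) (.const 3)) (.sub (.const 0) (.reg 10)))
  (.seq (.storeReal 3 (.add (.reg 1) (.const 3)) (.sub (.const 0) (.reg 11)))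
    (.setNat 1 (.add (.reg 1) (.const 4))))))))))))))

/-- Passes to the next vertex of one of the two chains. -/
def advanceProg : Prog :=
  .cond (.both (.natLe (.add (.reg 9) (.const 2)) (.reg 10))
      (.neg (.both (.natLe (.add (.reg 8) (.const 2)) (.reg 11))
        (.realLe
          (.mul (.sub (.load 7 (.add (.reg 9) (.const 1))) (.load 7 (.reg 9)))
            (.sub (.load 4 (.add (.reg 8) (.const 1))) (.load 4 (.reg 8))))
          (.mul (.sub (.load 5 (.add (.reg 8) (.const 1))) (.load 5 (.reg 8)))
            (.sub (.load 6 (.add (.reg 9) (.const 1))) (.load 6 (.reg 9))))))))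
    (.setNat 9 (.add (.reg 9) (.const 1)))
    (.setNat 8 (.add (.reg 8) (.const 1)))

/-- Adds the chains in the arrays `4`, `5` and `6`, `7`, whose lengths are in the index registers
`11` and `10`. -/
def sumProg : Prog :=
  .seq (.seq (.setNat 1 (.const 0)) (.seq (.setNat 8 (.const 0)) (.setNat 9 (.const 0))))
    (.loop (.natLe (.add (.reg 8) (.const 1)) (.reg 11)) (.seq emitProg advanceProg))

theorem emitProg_exec {s : State} {N i j : ℕ} (h1 : s.natReg 1 = N) (h8 : s.natReg 8 = i)
    (h9 : s.natReg 9 = j) :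
    (emitProg.exec s).natReg 1 = N + 4 ∧
    (∀ b < N, (emitProg.exec s).pt 2 3 b = s.pt 2 3 b) ∧
    (emitProg.exec s).pt 2 3 N = s.pt 4 5 i + s.pt 6 7 j ∧
    (emitProg.exec s).pt 2 3 (N + 1) = -(s.pt 4 5 i + s.pt 6 7 j) ∧
    (emitProg.exec s).pt 2 3 (N + 2) =
      rotBack (s.realReg 6) (s.realReg 7) (s.pt 4 5 i + s.pt 6 7 j) ∧
    (emitProg.exec s).pt 2 3 (N + 3) =
      -rotBack (s.realReg 6) (s.realReg 7) (s.pt 4 5 i + s.pt 6 7 j) := by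
  refine ⟨?_, fun b hb => ?_, ?_, ?_, ?_, ?_⟩
  · simp [emitProg, Prog.exec, NExpr.eval, h1]
  · have b0 : b ≠ N := by omega
    have b1 : b ≠ N + 1 := by omega
    have b2 : b ≠ N + 2 := by omega
    have b3 : b ≠ N + 3 := by omega
    simp [emitProg, Prog.exec, NExpr.eval, h1, State.pt, b0, b1, b2, b3]
  all_goals
    ext x
    fin_cases x <;>
    simp [emitProg, Prog.exec, NExpr.eval, RExpr.eval, h1, h8, h9, State.pt, rotBack]

/-- Each iteration increases `i + j` by one. The loop ends with `i = KA`, which rules out the second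
alternative in `SumInv.dom`; hence every upward direction has its maximum among the recorded sums.
-/
theorem sumProg_reach {s : State} {m KA KB : ℕ} (h11 : s.natReg 11 = KA) (h10 : s.natReg 10 = KB)
    (hKA : 1 ≤ KA) (hKB : 1 ≤ KB) (hA : UpperChain (s.pt 4 5) KA) (hB : UpperChain (s.pt 6 7) KB)
    (hm : 400 * (KA + KB) + 50 ≤ m) :
    Reach sumProg s m fun s' m' => m ≤ m' + 400 * (KA + KB) + 50 ∧
      ∃ L d, s'.natReg 1 = 4 * L ∧ 1 ≤ L ∧ L ≤ KA + KB ∧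
        Layout (s.realReg 6) (s.realReg 7) d (s'.pt 2 3) L ∧
        (∀ l < L, ∃ a < KA, ∃ b < KB, d l = s.pt 4 5 a + s.pt 6 7 b) ∧
        ∀ u : Plane, 0 ≤ u 1 → ∃ l < L, ∀ a < KA, ∀ b < KB,
          dot (s.pt 4 5 a) u + dot (s.pt 6 7 b) u ≤ dot (d l) u := by
  refine Reach.seq (Reach.exec 20 rfl (by decide) (by omega) ?_)
  refine Reach.loop (fun s' m' => ∃ i j d, s'.natReg 8 = i ∧ s'.natReg 9 = j ∧
    s'.natReg 1 = 4 * (i + j) ∧ m ≤ m' + 20 + 400 * (i + j) ∧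
    Layout (s.realReg 6) (s.realReg 7) d (s'.pt 2 3) (i + j) ∧
    SumInv (s.pt 4 5) (s.pt 6 7) d KA KB i j) ?_ ?_ ?_ ?_
  · refine ⟨0, 0, s.pt 2 3, by simp [Prog.exec, NExpr.eval], by simp [Prog.exec, NExpr.eval],
      by simp [Prog.exec, NExpr.eval], by omega, fun l hl => by omega, SumInv.init hKA hKB⟩
  · rintro s' m' ⟨i, j, d, -, -, -, k3, -, k4⟩
    have := k4.le; have := k4.lt
    simp only [Test.cost, NExpr.cost]; omega
  · rintro s' m' hf ⟨i, j, d, k8, k9, k1, k2, k3, k4⟩ hb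
    have e10 : s'.natReg 10 = KB := by
      rw [hf.natReg 10 rfl]; simpa [Prog.exec] using h10
    have e11 : s'.natReg 11 = KA := by
      rw [hf.natReg 11 rfl]; simpa [Prog.exec] using h11
    have e6 : s'.realReg 6 = s.realReg 6 := hf.realReg 6 rfl
    have e7 : s'.realReg 7 = s.realReg 7 := hf.realReg 7 rfl
    have eA : s'.pt 4 5 = s.pt 4 5 := by
      funext a; simp only [State.pt, hf.realArr 4 rfl, hf.realArr 5 rfl]; rfl
    have eB : s'.pt 6 7 = s.pt 6 7 := by
      funext a; simp only [State.pt, hf.realArr 6 rfl, hf.realArr 7 rfl]; rfl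
    simp only [Test.Holds, NExpr.eval, k8, e11] at hb
    have p1 := k4.lt
    simp only [Test.cost, NExpr.cost]
    obtain ⟨x1, x2, x3, x4, x5, x6⟩ := emitProg_exec k1 k8 k9
    have hx := Prog.frame_exec emitProg rfl s'
    refine Reach.seq (Reach.exec 150 rfl (by decide) (by omega) ?_)
    generalize emitProg.exec s' = x at *
    have x8 := (hx.natReg 8 rfl).trans k8
    have x9 := (hx.natReg 9 rfl).trans k9
    have x10 := (hx.natReg 10 rfl).trans e10
    have x11 := (hx.natReg 11 rfl).trans e11
    have xA : ∀ a, x.pt 4 5 a = s.pt 4 5 a := fun a => by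
      rw [← eA]; simp only [State.pt, hx.realArr 4 rfl, hx.realArr 5 rfl]
    have xB : ∀ a, x.pt 6 7 a = s.pt 6 7 a := fun a => by
      rw [← eB]; simp only [State.pt, hx.realArr 6 rfl, hx.realArr 7 rfl]
    rw [eA, eB, e6, e7] at *
    have yA : ∀ a, x.realArr 4 a = s.realArr 4 a ∧ x.realArr 5 a = s.realArr 5 a := fun a =>
      ⟨congrArg (· 0) (xA a), congrArg (· 1) (xA a)⟩
    have yB : ∀ a, x.realArr 6 a = s.realArr 6 a ∧ x.realArr 7 a = s.realArr 7 a := fun a =>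
      ⟨congrArg (· 0) (xB a), congrArg (· 1) (xB a)⟩
    -- The sums themselves occupy every fourth cell.
    set d' : ℕ → Plane := fun l => x.pt 2 3 (4 * l) with hd'
    have hdd : ∀ l < i + j, d' l = d l := fun l hl =>
      (x2 _ (by omega)).trans (k3 l hl).1
    have hlast : d' (i + j) = s.pt 4 5 i + s.pt 6 7 j := x3
    have hlay : Layout (s.realReg 6) (s.realReg 7) d' (x.pt 2 3) (i + j + 1) := by
      intro l hl
      rcases Nat.lt_succ_iff_lt_or_eq.1 hl with hl | rfl
      · rw [hdd l hl, x2 _ (by omega), x2 _ (by omega), x2 _ (by omega), x2 _ (by omega)]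
        exact k3 l hl
      · rw [hlast]; exact ⟨x3, x4, x5, x6⟩
    refine Reach.cond ?_ ?_ ?_
    · simp only [Test.cost, NExpr.cost, RExpr.cost]; omega
    · intro hc
      simp only [Test.cost, NExpr.cost, RExpr.cost]
      have hr : RightFirst (s.pt 4 5) (s.pt 6 7) KA KB i j := by
        simpa [RightFirst, Test.Holds, NExpr.eval, RExpr.eval, x8, x9, x10, x11, yA, yB, Nat.lt_iff_add_one_le, add_assoc] using hc
      refine Reach.exec 10 rfl (by decide) (by omega) ?_
      refine ⟨i, j + 1, d', by simpa [Prog.exec] using x8, by simp [Prog.exec, NExpr.eval, x9], ?_,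
        by omega, hlay, k4.step_right hA hB hb hr hdd hlast⟩
      simp [Prog.exec, x1]; ring
    · intro hc
      simp only [Test.cost, NExpr.cost, RExpr.cost]
      have hr : ¬ RightFirst (s.pt 4 5) (s.pt 6 7) KA KB i j := by
        simpa [RightFirst, Test.Holds, NExpr.eval, RExpr.eval, x8, x9, x10, x11, yA, yB, Nat.lt_iff_add_one_le, add_assoc] using hc
      refine Reach.exec 10 rfl (by decide) (by omega) ?_
      refine ⟨i + 1, j, d', by simp [Prog.exec, NExpr.eval, x8], by simpa [Prog.exec] using x9, ?_,
        by omega, ?_, k4.step_left hA hB hb hr hdd hlast⟩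
      · simp [Prog.exec, x1]; ring
      · rw [show i + 1 + j = i + j + 1 by ring]; exact hlay
  · rintro s' m' hf ⟨i, j, d, k8, k9, k1, k2, k3, k4⟩ hb
    have e11 : s'.natReg 11 = KA := by
      rw [hf.natReg 11 rfl]; simpa [Prog.exec] using h11
    simp only [Test.Holds, NExpr.eval, k8, e11] at hb
    have := k4.le; have := k4.lt
    simp only [Test.cost, NExpr.cost]
    refine ⟨by omega, i + j, d, k1, by omega, by omega, k3, k4.mem, fun u hu => ?_⟩
    rcases k4.dom u hu with h | ⟨h, -⟩
    · exact h
    · omega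

end RealRAM

/-! ### The narrowest direction of a polygon -/

/-- Why edge normals suffice: on the normal cone of a vertex `p` the support function is linear,
whereas the norm is subadditive. -/
theorem mul_norm_le_dot {m a b : ℝ} (hm : 0 ≤ m) (ha : 0 ≤ a) (hb : 0 ≤ b) {p x y : Plane}
    (hx : m * ‖x‖ ≤ dot p x) (hy : m * ‖y‖ ≤ dot p y) :
    m * ‖a • x + b • y‖ ≤ dot p (a • x + b • y) := by
  have h1 : ‖a • x + b • y‖ ≤ a * ‖x‖ + b * ‖y‖ := by
    refine (norm_add_le _ _).trans (le_of_eq ?_)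
    rw [norm_smul, norm_smul, Real.norm_of_nonneg ha, Real.norm_of_nonneg hb]
  rw [dot_add_right, dot_smul_right, dot_smul_right]
  nlinarith [mul_le_mul_of_nonneg_left h1 hm, mul_le_mul_of_nonneg_left hx ha,
    mul_le_mul_of_nonneg_left hy hb]

theorem edge_dot_nonneg {a b u : Plane} (ha : 0 ≤ a 0) (hb : 0 < b 0) (hu : 0 ≤ u 1)
    (hab : b 1 * a 0 ≤ a 1 * b 0) (h : 0 ≤ dot b u) : 0 ≤ dot a u := by
  have key : a 0 * dot b u ≤ b 0 * dot a u := by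
    simp only [dot]
    nlinarith [mul_le_mul_of_nonneg_right hab hu]
  have := mul_nonneg ha h
  by_contra hcon
  nlinarith [mul_pos hb (neg_pos.2 (not_le.1 hcon))]

theorem UpperChain.edge_nonneg {c : ℕ → Plane} {K i : ℕ} (h : UpperChain c K) {u : Plane}
    (hu : 0 ≤ u 1) (hi : i + 1 < K) (he : 0 ≤ dot (c (i + 1) - c i) u) (k : ℕ) (hk : k ≤ i) :
    0 ≤ dot (c (k + 1) - c k) u := by
  induction i with
  | zero => rwa [Nat.le_zero.1 hk]
  | succ i ih =>
    rcases hk.eq_or_lt with rfl | hk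
    · exact he
    · refine ih (by omega) (edge_dot_nonneg ?_ ?_ hu ?_ he) (by omega)
      · simpa using (h.lt i (by omega)).le
      · simpa using h.lt (i + 1) hi
      · have := h.turn i hi
        simp only [PiLp.sub_apply]
        linarith

theorem UpperChain.dot_le_left {c : ℕ → Plane} {K i : ℕ} (h : UpperChain c K) {u : Plane}
    (hu : 0 ≤ u 1) (hi : i + 1 < K) (he : 0 ≤ dot (c (i + 1) - c i) u) (k : ℕ) (hk : k ≤ i) :
    dot (c k) u ≤ dot (c i) u := by
  suffices H : ∀ j, k ≤ j → j ≤ i → dot (c k) u ≤ dot (c j) u from H i hk le_rfl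
  intro j hkj
  induction j, hkj using Nat.le_induction with
  | base => exact fun _ => le_rfl
  | succ j hkj ih =>
    intro hji
    have := h.edge_nonneg hu hi he j (by omega)
    rw [dot_sub_left] at this
    linarith [ih (by omega)]

/-- The upward normal of an edge of a chain. -/
noncomputable def edgeNormal (c : ℕ → Plane) (l : ℕ) : Plane :=
  !₂[c l 1 - c (l + 1) 1, c (l + 1) 0 - c l 0]

theorem dot_edgeNormal_succ (c : ℕ → Plane) (l : ℕ) :
    dot (c (l + 1)) (edgeNormal c l) = dot (c l) (edgeNormal c l) := by
  simp [dot, edgeNormal]; ring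

theorem norm_basis : ‖(!₂[1, 0] : Plane)‖ = 1 ∧ ‖(!₂[-1, 0] : Plane)‖ = 1 := by
  constructor <;> simp [norm_eq_sqrt]

/-- The vertex where the chain stops ascending in direction `u` has `u` in its normal cone. This
cone is spanned by the normals of the two adjacent edges, with a horizontal vector in place of the
missing edge at either end of the chain. The coefficients come from Cramer's rule and are
nonnegative by the choice of the vertex. -/
theorem UpperChain.exists_mul_norm_le {c : ℕ → Plane} {K : ℕ} (h : UpperChain c K) (hK : 2 ≤ K)
    {m : ℝ} (hm : 0 ≤ m) (hr : m ≤ c (K - 1) 0) (hl : m ≤ -c 0 0)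
    (hn : ∀ l, l + 1 < K → m * ‖edgeNormal c l‖ ≤ dot (c l) (edgeNormal c l)) {u : Plane}
    (hu : 0 ≤ u 1) : ∃ l < K, m * ‖u‖ ≤ dot (c l) u := by
  classical
  -- Past the last edge the condition is vacuous, so the first such index exists even if the whole
  -- chain ascends.
  have hex : ∃ l, l + 1 < K → dot (c (l + 1) - c l) u ≤ 0 := ⟨K, fun h => by omega⟩
  obtain ⟨l, hl1, hl2⟩ : ∃ l, (l + 1 < K → dot (c (l + 1) - c l) u ≤ 0) ∧
      ∀ k < l, k + 1 < K ∧ 0 < dot (c (k + 1) - c k) u :=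
    ⟨Nat.find hex, Nat.find_spec hex, fun k hk => by simpa using Nat.find_min hex hk⟩
  rcases Nat.eq_zero_or_pos l with rfl | hpos
  · refine ⟨0, by omega, ?_⟩
    have e1 := hl1 (by omega)
    have e2 := sub_pos.2 (h.lt 0 (by omega))
    have : u = (u 1 / (c (0 + 1) 0 - c 0 0)) • edgeNormal c 0 +
        (-dot (c (0 + 1) - c 0) u / (c (0 + 1) 0 - c 0 0)) • !₂[-1, 0] := by
      ext x
      fin_cases x
      · simp [edgeNormal, dot]; field_simp; ring
      · simp [edgeNormal]; field_simp
    rw [this]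
    refine mul_norm_le_dot hm (div_nonneg hu e2.le) (div_nonneg (by linarith) e2.le)
      (hn 0 (by omega)) ?_
    rw [norm_basis.2, mul_one]
    simpa [dot] using hl
  · obtain ⟨k, rfl⟩ : ∃ k, l = k + 1 := ⟨l - 1, by omega⟩
    obtain ⟨hk, e0⟩ := hl2 k (by omega)
    refine ⟨k + 1, hk, ?_⟩
    have e2 := sub_pos.2 (h.lt k hk)
    have hx := hn k hk
    rw [← dot_edgeNormal_succ] at hx
    by_cases hlast : k + 1 + 1 < K
    · have e1 := hl1 hlast
      have ht := h.turn k hlast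
      -- The determinant of the two adjacent edge normals, positive by the strict right turn.
      set D := (c (k + 1) 1 - c k 1) * (c (k + 2) 0 - c (k + 1) 0) -
        (c (k + 1) 0 - c k 0) * (c (k + 2) 1 - c (k + 1) 1) with hD
      have hDpos : 0 < D := by linarith
      have : u = (-dot (c (k + 1 + 1) - c (k + 1)) u / D) • edgeNormal c k +
          (dot (c (k + 1) - c k) u / D) • edgeNormal c (k + 1) := by
        ext x
        fin_cases x
        · simp [edgeNormal, dot]; field_simp; rw [hD]; ring
        · simp [edgeNormal, dot]; field_simp; rw [hD]; ring
      rw [this]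
      exact mul_norm_le_dot hm (div_nonneg (by linarith) hDpos.le) (div_nonneg e0.le hDpos.le)
        hx (hn (k + 1) hlast)
    · have : u = (u 1 / (c (k + 1) 0 - c k 0)) • edgeNormal c k +
          (dot (c (k + 1) - c k) u / (c (k + 1) 0 - c k 0)) • !₂[1, 0] := by
        ext x
        fin_cases x
        · simp [edgeNormal, dot]; field_simp; ring
        · simp [edgeNormal]; field_simp
      rw [this]
      refine mul_norm_le_dot hm (div_nonneg hu e2.le) (div_nonneg e0.le e2.le) hx ?_
      have hk' : K - 1 = k + 1 := by omega
      rw [hk'] at hr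
      rw [norm_basis.1, mul_one]
      simpa [dot] using hr

/-- The direction `b` is the best among the horizontal one and the normals of the first `i` edges;
`m` is the extent of the chain in this direction. -/
structure MinInv (c : ℕ → Plane) (K i : ℕ) (b : Plane) (m : ℝ) : Prop where
  norm : ‖b‖ = 1
  nonneg : 0 ≤ b 1
  dot_le : ∀ l < K, dot (c l) b ≤ m
  le_last : m ≤ c (K - 1) 0
  le_edge : ∀ l < i, m * ‖edgeNormal c l‖ ≤ dot (c l) (edgeNormal c l)

theorem UpperChain.le_last {c : ℕ → Plane} {K : ℕ} (h : UpperChain c K) (l : ℕ) (hl : l < K) :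
    c l 0 ≤ c (K - 1) 0 := by
  have := h.dot_le (i := l) (u := !₂[-1, 0]) (by simp) (fun hl' => by
    have := h.lt l hl'
    simp [dot]; linarith) (K - 1) (by omega) (by omega)
  simpa [dot] using this

theorem MinInv.init {c : ℕ → Plane} {K : ℕ} (h : UpperChain c K) :
    MinInv c K 0 !₂[1, 0] (c (K - 1) 0) where
  norm := norm_basis.1
  nonneg := by simp
  dot_le l hl := by simpa [dot] using h.le_last l hl
  le_last := le_rfl
  le_edge l hl := by omega

theorem edgeNormal_pos {c : ℕ → Plane} {K i : ℕ} (h : UpperChain c K) (hi : i + 1 < K) :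
    0 < edgeNormal c i 1 ∧ 0 < ‖edgeNormal c i‖ := by
  have h1 : 0 < edgeNormal c i 1 := by simpa [edgeNormal] using h.lt i hi
  refine ⟨h1, norm_pos_iff.2 fun h0 => ?_⟩
  rw [h0] at h1
  simp at h1

/-- Both ends of an edge have the same product with its normal, so by concavity the chain attains
its extent in this direction along the edge, and a single vertex gives the value. -/
theorem MinInv.replace {c : ℕ → Plane} {K i : ℕ} {b : Plane} {m : ℝ} (hI : MinInv c K i b m)
    (h : UpperChain c K) (hi : i + 1 < K)
    (hle : dot (c i) (edgeNormal c i) / ‖edgeNormal c i‖ ≤ m) :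
    MinInv c K (i + 1) (‖edgeNormal c i‖⁻¹ • edgeNormal c i)
      (dot (c i) (edgeNormal c i) / ‖edgeNormal c i‖) := by
  obtain ⟨h1, h2⟩ := edgeNormal_pos h hi
  refine ⟨?_, ?_, fun l hl => ?_, hle.trans hI.le_last, fun l hl => ?_⟩
  · rw [norm_smul, norm_inv, norm_norm, inv_mul_cancel₀ h2.ne']
  · simp only [PiLp.smul_apply, smul_eq_mul]; positivity
  · rw [dot_smul_right, inv_mul_eq_div]
    gcongr
    rcases le_total i l with hil | hil
    · exact h.dot_le h1.le (fun _ => by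
        rw [dot_sub_left, dot_edgeNormal_succ, sub_self]) l hil hl
    · exact h.dot_le_left h1.le hi (by rw [dot_sub_left, dot_edgeNormal_succ, sub_self]) l hil
  · rcases Nat.lt_succ_iff_lt_or_eq.1 hl with hl | rfl
    · exact (mul_le_mul_of_nonneg_right hle (norm_nonneg _)).trans (hI.le_edge l hl)
    · rw [div_mul_cancel₀ _ h2.ne']

theorem MinInv.keep {c : ℕ → Plane} {K i : ℕ} {b : Plane} {m : ℝ} (hI : MinInv c K i b m)
    (h : UpperChain c K) (hi : i + 1 < K)
    (hle : m ≤ dot (c i) (edgeNormal c i) / ‖edgeNormal c i‖) : MinInv c K (i + 1) b m := by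
  obtain ⟨h1, h2⟩ := edgeNormal_pos h hi
  refine ⟨hI.norm, hI.nonneg, hI.dot_le, hI.le_last, fun l hl => ?_⟩
  rcases Nat.lt_succ_iff_lt_or_eq.1 hl with hl | rfl
  · exact hI.le_edge l hl
  · rwa [le_div_iff₀ h2] at hle

/-! ### Programs for scaled copies, the best edge normal and extents. -/

namespace RealRAM

/-- Copies the input points, multiplied by `k`, into the arrays `2`, `3`. -/
def copyProg (k : ℤ) : Prog :=
  .seq (.seq (.setNat 5 (.const 0)) (.setNat 1 (.reg 0)))
    (.loop (.natLe (.add (.reg 5) (.const 1)) (.reg 0))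
      (.seq (.storeReal 2 (.reg 5) (.mul (.const k) (.load 0 (.reg 5))))
        (.seq (.storeReal 3 (.reg 5) (.mul (.const k) (.load 1 (.reg 5))))
          (.setNat 5 (.add (.reg 5) (.const 1))))))

/-- Computes the normal of an edge, its length, and the extent of the chain in its direction. -/
def edgeProg : Prog :=
  .seq (.setReal 8 (.sub (.load 9 (.reg 8)) (.load 9 (.add (.reg 8) (.const 1)))))
  (.seq (.setReal 9 (.sub (.load 8 (.add (.reg 8) (.const 1))) (.load 8 (.reg 8))))
  (.seq (.setReal 10 (.sqrt (.add (.mul (.reg 8) (.reg 8)) (.mul (.reg 9) (.reg 9)))))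
    (.setReal 11 (.div (.add (.mul (.load 8 (.reg 8)) (.reg 8)) (.mul (.load 9 (.reg 8)) (.reg 9)))
      (.reg 10)))))

/-- Finds the best edge normal of the chain in the arrays `8`, `9`. -/
def minProg : Prog :=
  .seq (.seq (.setReal 12 (.const 1)) (.seq (.setReal 13 (.const 0))
      (.seq (.setReal 14 (.load 8 (.sub (.reg 10) (.const 1)))) (.setNat 8 (.const 0)))))
    (.loop (.natLe (.add (.reg 8) (.const 2)) (.reg 10))
      (.seq edgeProg (.cond (.realLe (.reg 11) (.reg 14))
        (.seq (.setReal 12 (.div (.reg 8) (.reg 10))) (.seq (.setReal 13 (.div (.reg 9) (.reg 10)))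
          (.seq (.setReal 14 (.reg 11)) (.setNat 8 (.add (.reg 8) (.const 1))))))
        (.setNat 8 (.add (.reg 8) (.const 1))))))

/-- Replaces the real register `x` by its maximum (`k = 1`) or minimum (`k = -1`) with the product
of the `i`-th input point and the vector in the real registers `y`, `z`. -/
def extendProg (k : ℤ) (x y z : ℕ) : Prog :=
  .seq (.setReal 8 (.add (.mul (.load 0 (.reg 8)) (.reg y)) (.mul (.load 1 (.reg 8)) (.reg z))))
    (.cond (.realLe (.mul (.const k) (.reg x)) (.mul (.const k) (.reg 8))) (.setReal x (.reg 8)) .skip)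

/-- Computes in the real register `x` the maximum (`k = 1`) or the minimum (`k = -1`) of the products
of the input points with the vector in the real registers `y`, `z`. -/
def extentProg (k : ℤ) (x y z : ℕ) : Prog :=
  .seq (.seq (.setNat 8 (.const 0)) (.setReal x
      (.add (.mul (.load 0 (.const 0)) (.reg y)) (.mul (.load 1 (.const 0)) (.reg z)))))
    (.loop (.natLe (.add (.reg 8) (.const 1)) (.reg 0))
      (.seq (extendProg k x y z) (.setNat 8 (.add (.reg 8) (.const 1)))))

theorem copyProg_reach (k : ℤ) {s : State} {m n : ℕ} (h0 : s.natReg 0 = n) (hm : 50 * n + 50 ≤ m) :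
    Reach (copyProg k) s m fun s' m' => m ≤ m' + 50 * n + 50 ∧ s'.natReg 1 = n ∧
      ∀ a < n, s'.pt 2 3 a = (k : ℝ) • s.pt 0 1 a := by
  refine Reach.seq (Reach.exec 10 rfl (by decide) (by omega) ?_)
  refine Reach.loop (fun s' m' => ∃ i, s'.natReg 5 = i ∧ i ≤ n ∧ m ≤ m' + 10 + 50 * i ∧
    ∀ a < i, s'.pt 2 3 a = (k : ℝ) • s.pt 0 1 a) ?_ ?_ ?_ ?_
  · exact ⟨0, by simp [Prog.exec, NExpr.eval], by omega, by omega, fun a ha => by omega⟩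
  · rintro s' m' ⟨i, -, k1, k2, -⟩
    simp only [Test.cost, NExpr.cost]; omega
  · rintro s' m' hf ⟨i, k5, k1, k2, k3⟩ hb
    have e0 : s'.natReg 0 = n := by
      rw [hf.natReg 0 rfl]; simpa [Prog.exec] using h0
    have a0 : ∀ a, s'.realArr 0 a = s.realArr 0 a := fun a => by rw [hf.realArr 0 rfl]; rfl
    have a1 : ∀ a, s'.realArr 1 a = s.realArr 1 a := fun a => by rw [hf.realArr 1 rfl]; rfl
    simp only [Test.Holds, NExpr.eval, k5, e0] at hb
    simp only [Test.cost, NExpr.cost]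
    refine Reach.exec 30 rfl (by simp [Prog.bound, NExpr.cost, RExpr.cost]) (by omega) ?_
    refine ⟨i + 1, by simp [Prog.exec, NExpr.eval, k5], by omega, by omega, fun a ha => ?_⟩
    rcases Nat.lt_succ_iff_lt_or_eq.1 ha with ha | rfl
    · rw [← k3 a ha]
      have : a ≠ i := by omega
      simp [State.pt, Prog.exec, NExpr.eval, RExpr.eval, k5, this]
    · ext x
      fin_cases x <;> simp [State.pt, Prog.exec, NExpr.eval, RExpr.eval, k5, a0, a1]
  · rintro s' m' hf ⟨i, k5, k1, k2, k3⟩ hb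
    have e0 : s'.natReg 0 = n := by
      rw [hf.natReg 0 rfl]; simpa [Prog.exec] using h0
    have e1 : s'.natReg 1 = n := by
      rw [hf.natReg 1 rfl]; simpa [Prog.exec, NExpr.eval] using h0
    simp only [Test.Holds, NExpr.eval, k5, e0] at hb
    have : i = n := by omega
    subst this
    simp only [Test.cost, NExpr.cost]
    exact ⟨by omega, e1, k3⟩

theorem minProg_reach {s : State} {m K : ℕ} (h10 : s.natReg 10 = K) (hK : 2 ≤ K)
    (hc : UpperChain (s.pt 8 9) K) (hm : 200 * K + 50 ≤ m) :
    Reach minProg s m fun s' m' => m ≤ m' + 200 * K + 50 ∧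
      MinInv (s.pt 8 9) K (K - 1) !₂[s'.realReg 12, s'.realReg 13] (s'.realReg 14) := by
  refine Reach.seq (Reach.exec 20 rfl (by decide) (by omega) ?_)
  refine Reach.loop (fun s' m' => ∃ i, s'.natReg 8 = i ∧ i + 1 ≤ K ∧ m ≤ m' + 20 + 200 * i ∧
    MinInv (s.pt 8 9) K i !₂[s'.realReg 12, s'.realReg 13] (s'.realReg 14)) ?_ ?_ ?_ ?_
  · refine ⟨0, by simp [Prog.exec, NExpr.eval], by omega, by omega, ?_⟩
    have := MinInv.init hc
    simpa [Prog.exec, NExpr.eval, RExpr.eval, h10] using this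
  · rintro s' m' ⟨i, -, k1, k2, -⟩
    simp only [Test.cost, NExpr.cost]; omega
  · rintro s' m' hf ⟨i, k8, k1, k2, k3⟩ hb
    have e10 : s'.natReg 10 = K := by
      rw [hf.natReg 10 rfl]; simpa [Prog.exec] using h10
    have a0 : ∀ a, s'.realArr 8 a = s.realArr 8 a := fun a => by rw [hf.realArr 8 rfl]; rfl
    have a1 : ∀ a, s'.realArr 9 a = s.realArr 9 a := fun a => by rw [hf.realArr 9 rfl]; rfl
    simp only [Test.Holds, NExpr.eval, k8, e10] at hb
    simp only [Test.cost, NExpr.cost]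
    have hn : Real.sqrt (edgeNormal (s.pt 8 9) i 0 * edgeNormal (s.pt 8 9) i 0 +
        edgeNormal (s.pt 8 9) i 1 * edgeNormal (s.pt 8 9) i 1) = ‖edgeNormal (s.pt 8 9) i‖ := by
      rw [norm_eq_sqrt, sq, sq]
    have hx := Prog.frame_exec edgeProg rfl s'
    have x8 : (edgeProg.exec s').realReg 8 = edgeNormal (s.pt 8 9) i 0 := by
      simp [edgeProg, Prog.exec, NExpr.eval, RExpr.eval, k8, a1, edgeNormal]
    have x9 : (edgeProg.exec s').realReg 9 = edgeNormal (s.pt 8 9) i 1 := by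
      simp [edgeProg, Prog.exec, NExpr.eval, RExpr.eval, k8, a0, edgeNormal]
    have x10 : (edgeProg.exec s').realReg 10 = ‖edgeNormal (s.pt 8 9) i‖ := by
      rw [← hn]
      simp [edgeProg, Prog.exec, NExpr.eval, RExpr.eval, k8, a0, a1, edgeNormal]
    have x11 : (edgeProg.exec s').realReg 11 =
        dot (s.pt 8 9 i) (edgeNormal (s.pt 8 9) i) / ‖edgeNormal (s.pt 8 9) i‖ := by
      rw [← hn]
      simp [edgeProg, Prog.exec, NExpr.eval, RExpr.eval, k8, a0, a1, edgeNormal, dot]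
    refine Reach.seq (Reach.exec 60 rfl (by decide) (by omega) ?_)
    generalize edgeProg.exec s' = x at *
    have y8 := (hx.natReg 8 rfl).trans k8
    have x12 := hx.realReg 12 rfl
    have x13 := hx.realReg 13 rfl
    have x14 := hx.realReg 14 rfl
    refine Reach.cond ?_ ?_ ?_
    · simp only [Test.cost, RExpr.cost]; omega
    · intro hle
      simp only [Test.cost, RExpr.cost]
      simp only [Test.Holds, RExpr.eval, x11, x14] at hle
      refine Reach.exec 30 rfl (by decide) (by omega) ?_
      refine ⟨i + 1, by simp [Prog.exec, NExpr.eval, y8], by omega, by omega, ?_⟩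
      have := k3.replace hc hb hle
      convert this using 1
      · ext t
        fin_cases t <;> simp [Prog.exec, RExpr.eval, x8, x9, x10, inv_mul_eq_div]
      · simp [Prog.exec, RExpr.eval, x11]
    · intro hle
      simp only [Test.cost, RExpr.cost]
      simp only [Test.Holds, RExpr.eval, x11, x14, not_le] at hle
      refine Reach.exec 30 rfl (by decide) (by omega) ?_
      refine ⟨i + 1, by simp [Prog.exec, NExpr.eval, y8], by omega, by omega, ?_⟩
      have := k3.keep hc hb hle.le
      simpa [Prog.exec, x12, x13, x14] using this
  · rintro s' m' hf ⟨i, k8, k1, k2, k3⟩ hb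
    have e10 : s'.natReg 10 = K := by
      rw [hf.natReg 10 rfl]; simpa [Prog.exec] using h10
    simp only [Test.Holds, NExpr.eval, k8, e10] at hb
    have : i = K - 1 := by omega
    subst this
    simp only [Test.cost, NExpr.cost]
    exact ⟨by omega, k3⟩

/-- The factor `k` on both sides lets one statement cover maxima and minima. The register starts
with the product of point 0, so its value is always attained. -/
theorem extentProg_reach (k : ℤ) {x y z : ℕ} (hx : 8 < x) (hy : 8 < y) (hz : 8 < z) (hxy : x ≠ y)
    (hxz : x ≠ z) {s : State} {m n : ℕ} (h0 : s.natReg 0 = n) (hn : 1 ≤ n)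
    (hm : 100 * n + 50 ≤ m) :
    Reach (extentProg k x y z) s m fun s' m' => m ≤ m' + 100 * n + 50 ∧
      (∃ a < n, s'.realReg x = dot (s.pt 0 1 a) !₂[s.realReg y, s.realReg z]) ∧
      ∀ a < n, k * dot (s.pt 0 1 a) !₂[s.realReg y, s.realReg z] ≤ k * s'.realReg x := by
  have n1 : x ≠ 8 := by omega
  have n2 : y ≠ 8 := by omega
  have n3 : z ≠ 8 := by omega
  refine Reach.seq (Reach.exec 20 rfl (by simp [Prog.bound, NExpr.cost, RExpr.cost]) (by omega) ?_)
  refine Reach.loop (fun s' m' => ∃ i, s'.natReg 8 = i ∧ i ≤ n ∧ m ≤ m' + 20 + 100 * i ∧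
    (∃ a < n, s'.realReg x = dot (s.pt 0 1 a) !₂[s.realReg y, s.realReg z]) ∧
    ∀ a < i, k * dot (s.pt 0 1 a) !₂[s.realReg y, s.realReg z] ≤ k * s'.realReg x) ?_ ?_ ?_ ?_
  · refine ⟨0, by simp [Prog.exec, NExpr.eval], by omega, by omega, ⟨0, by omega, ?_⟩,
      fun a ha => by omega⟩
    simp [Prog.exec, NExpr.eval, RExpr.eval, dot]
  · rintro s' m' ⟨i, -, k1, k2, -⟩
    simp only [Test.cost, NExpr.cost]; omega
  · rintro s' m' hf ⟨i, k8, k1, k2, k3, k4⟩ hb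
    have e0 : s'.natReg 0 = n := by
      rw [hf.natReg 0 rfl]; simpa [Prog.exec] using h0
    have a0 : ∀ a, s'.realArr 0 a = s.realArr 0 a := fun a => by rw [hf.realArr 0 rfl]; rfl
    have a1 : ∀ a, s'.realArr 1 a = s.realArr 1 a := fun a => by rw [hf.realArr 1 rfl]; rfl
    have ry : s'.realReg y = s.realReg y := by
      rw [hf.realReg y (by simp [Prog.keepsRealReg, extendProg, n2, hxy.symm])]
      simp [Prog.exec, hxy.symm]
    have rz : s'.realReg z = s.realReg z := by
      rw [hf.realReg z (by simp [Prog.keepsRealReg, extendProg, n3, hxz.symm])]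
      simp [Prog.exec, hxz.symm]
    simp only [Test.Holds, NExpr.eval, k8, e0] at hb
    simp only [Test.cost, NExpr.cost]
    refine Reach.exec 50 rfl (by simp [Prog.bound, NExpr.cost, RExpr.cost, extendProg, Test.cost])
      (by omega) ?_
    set D := dot (s.pt 0 1 i) !₂[s.realReg y, s.realReg z] with hD
    have hD' : s.realArr 0 i * s.realReg y + s.realArr 1 i * s.realReg z = D := by
      simp [hD, dot]
    by_cases hle : (k : ℝ) * s'.realReg x ≤ k * D
    · have hres : ((extendProg k x y z).seq (.setNat 8 (.add (.reg 8) (.const 1)))).exec s' =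
          ((s'.setReal 8 D).setReal x D).setNat 8 (i + 1) := by
        simp [Prog.exec, extendProg, NExpr.eval, RExpr.eval, Test.Holds, k8, a0, a1, ry, rz, n1,
          hD', hle]
      rw [hres]
      refine ⟨i + 1, by simp, by omega, by omega, ⟨i, hb, by simp [hD]⟩, fun a ha => ?_⟩
      simp only [State.setNat_realReg, State.setReal_realReg, if_true]
      rcases Nat.lt_succ_iff_lt_or_eq.1 ha with ha | rfl
      · exact (k4 a ha).trans hle
      · exact le_rfl
    · have hres : ((extendProg k x y z).seq (.setNat 8 (.add (.reg 8) (.const 1)))).exec s' =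
          (s'.setReal 8 D).setNat 8 (i + 1) := by
        simp [Prog.exec, extendProg, NExpr.eval, RExpr.eval, Test.Holds, k8, a0, a1, ry, rz, n1,
          hD', hle]
      rw [hres]
      refine ⟨i + 1, by simp, by omega, by omega, ?_, fun a ha => ?_⟩
      · simpa [n1] using k3
      · simp only [State.setNat_realReg, State.setReal_realReg, n1, if_false]
        rcases Nat.lt_succ_iff_lt_or_eq.1 ha with ha | rfl
        · exact k4 a ha
        · exact (not_le.1 hle).le
  · rintro s' m' hf ⟨i, k8, k1, k2, k3, k4⟩ hb
    have e0 : s'.natReg 0 = n := by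
      rw [hf.natReg 0 rfl]; simpa [Prog.exec] using h0
    simp only [Test.Holds, NExpr.eval, k8, e0] at hb
    have : i = n := by omega
    subst this
    simp only [Test.cost, NExpr.cost]
    exact ⟨by omega, k3, k4⟩

end RealRAM

/-! ### Smallest enclosing rhombi from narrowest directions -/

/-- Rotation by the angle with cosine `C` and sine `S`. -/
noncomputable def rot (C S : ℝ) (u : Plane) : Plane := !₂[C * u 0 - S * u 1, S * u 0 + C * u 1]

theorem dot_rotBack (C S : ℝ) (d u : Plane) : dot (rotBack C S d) u = dot d (rot C S u) := by
  simp [dot, rotBack, rot]; ring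

theorem dot_rot (C S : ℝ) (d u : Plane) : dot d (rot C S u) = C * dot d u + S * dot d (perp u) := by
  simp [dot, perp, rot]; ring

theorem rot_neg (C S : ℝ) (u : Plane) : rot C S (-u) = -rot C S u := by
  ext x
  fin_cases x <;> simp [rot] <;> ring

/-- The widths of `p 0, …, p (n - 1)` in direction `u` and in the rotated direction are at most `m`. -/
def WidthsLE (C S : ℝ) (p : ℕ → Plane) (n : ℕ) (u : Plane) (m : ℝ) : Prop :=
  ∀ a < n, ∀ b < n, dot (p a - p b) u ≤ m ∧ dot (p a - p b) (rot C S u) ≤ m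

theorem WidthsLE.neg {C S : ℝ} {p : ℕ → Plane} {n : ℕ} {u : Plane} {m : ℝ}
    (h : WidthsLE C S p n u m) : WidthsLE C S p n (-u) m := by
  intro a ha b hb
  have := h b hb a ha
  rw [rot_neg, dot_neg_right, dot_neg_right, ← dot_neg_left, ← dot_neg_left, neg_sub]
  exact this

/-- Since `S ≠ 0`, the directions `u` and `rot C S u` span the plane, so two distinct points cannot
have zero difference in both. -/
theorem WidthsLE.pos {C S : ℝ} (hS : S ≠ 0) {p : ℕ → Plane} {n : ℕ} {u : Plane} {m : ℝ}
    (h : WidthsLE C S p n u m) (hu : ‖u‖ = 1) {a b : ℕ} (ha : a < n) (hb : b < n)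
    (hab : p a ≠ p b) : 0 < m := by
  by_contra hm
  have h1 := h a ha b hb
  have h2 := h b hb a ha
  rw [← neg_sub, dot_neg_left, dot_neg_left] at h2
  have e1 : dot (p a - p b) u = 0 := by linarith
  have e2 : dot (p a - p b) (rot C S u) = 0 := by linarith
  rw [dot_rot, e1, mul_zero, zero_add] at e2
  have e3 := (mul_eq_zero.1 e2).resolve_left hS
  have := eq_dot_smul hu (p a - p b)
  rw [e1, e3, zero_smul, zero_smul, add_zero] at this
  exact hab (sub_eq_zero.1 this)

/-- The points `e 0, …, e (N - 1)` are differences of the points `p a`, or rotated differences, and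
dominate all of these in the upward directions. -/
structure DifferenceSet (C S : ℝ) (p e : ℕ → Plane) (n N : ℕ) : Prop where
  mem : ∀ k < N, ∃ a < n, ∃ b < n, e k = p a - p b ∨ e k = rotBack C S (p a - p b)
  dom : ∀ u : Plane, 0 ≤ u 1 → ∀ a < n, ∀ b < n, ∃ k < N, dot (p a - p b) u ≤ dot (e k) u
  dom_rot : ∀ u : Plane, 0 ≤ u 1 → ∀ a < n, ∀ b < n, ∃ k < N,
    dot (p a - p b) (rot C S u) ≤ dot (e k) u
  neg : ∀ k < N, ∃ k' < N, e k' = -e k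

theorem rotBack_neg (C S : ℝ) (d : Plane) : rotBack C S (-d) = -rotBack C S d := by
  ext x
  fin_cases x <;> simp [rotBack] <;> ring

/-- The sums `d` dominate the differences only in upward directions. Turning an upward `u` may
produce a downward direction; there the negated rotated sums take over, with the two points of the
difference exchanged. -/
theorem Layout.differenceSet {C S : ℝ} {p A B d e : ℕ → Plane} {n KA KB L : ℕ}
    (hA : ScanInv A p KA n) (hB : ScanInv B (fun a => -p a) KB n) (he : Layout C S d e L)
    (hmem : ∀ l < L, ∃ a < KA, ∃ b < KB, d l = A a + B b)
    (hdom : ∀ u : Plane, 0 ≤ u 1 → ∃ l < L, ∀ a < KA, ∀ b < KB,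
      dot (A a) u + dot (B b) u ≤ dot (d l) u) : DifferenceSet C S p e n (4 * L) := by
  have hd : ∀ l < L, ∃ a < n, ∃ b < n, d l = p a - p b := fun l hl => by
    obtain ⟨a, ha, b, hb, h⟩ := hmem l hl
    obtain ⟨a', ha', h1⟩ := hA.mem a ha
    obtain ⟨b', hb', h2⟩ := hB.mem b hb
    exact ⟨a', ha', b', hb', by rw [h, h1, h2]; abel⟩
  have hd' : ∀ u : Plane, 0 ≤ u 1 → ∀ a < n, ∀ b < n, ∃ l < L, dot (p a - p b) u ≤ dot (d l) u := by
    intro u hu a ha b hb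
    obtain ⟨l, hl, h⟩ := hdom u hu
    obtain ⟨a', ha', h1⟩ := hA.dom a ha u hu
    obtain ⟨b', hb', h2⟩ := hB.dom b hb u hu
    refine ⟨l, hl, ?_⟩
    have := h a' ha' b' hb'
    rw [dot_neg_left] at h2
    rw [dot_sub_left]
    linarith
  have hk : ∀ k < 4 * L, ∃ l < L, k = 4 * l ∨ k = 4 * l + 1 ∨ k = 4 * l + 2 ∨ k = 4 * l + 3 :=
    fun k hk => ⟨k / 4, by omega, by omega⟩
  refine ⟨fun k hk' => ?_, fun u hu a ha b hb => ?_, fun u hu a ha b hb => ?_, fun k hk' => ?_⟩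
  · obtain ⟨l, hl, h⟩ := hk k hk'
    obtain ⟨a, ha, b, hb, hab⟩ := hd l hl
    obtain ⟨h0, h1, h2, h3⟩ := he l hl
    rw [hab] at h0 h1 h2 h3
    rw [← rotBack_neg, neg_sub] at h3
    rw [neg_sub] at h1
    rcases h with rfl | rfl | rfl | rfl
    · exact ⟨a, ha, b, hb, Or.inl h0⟩
    · exact ⟨b, hb, a, ha, Or.inl h1⟩
    · exact ⟨a, ha, b, hb, Or.inr h2⟩
    · exact ⟨b, hb, a, ha, Or.inr h3⟩
  · obtain ⟨l, hl, h⟩ := hd' u hu a ha b hb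
    exact ⟨4 * l, by omega, by rw [(he l hl).1]; exact h⟩
  · rcases le_total 0 (rot C S u 1) with hw | hw
    · obtain ⟨l, hl, h⟩ := hd' _ hw a ha b hb
      exact ⟨4 * l + 2, by omega, by rw [(he l hl).2.2.1, dot_rotBack]; exact h⟩
    · obtain ⟨l, hl, h⟩ := hd' (-rot C S u) (by simpa using hw) b hb a ha
      refine ⟨4 * l + 3, by omega, ?_⟩
      rw [(he l hl).2.2.2, dot_neg_left, dot_rotBack, ← dot_neg_right]
      refine le_trans (le_of_eq ?_) h
      rw [dot_neg_right, ← dot_neg_left, neg_sub]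
  · obtain ⟨l, hl, h⟩ := hk k hk'
    obtain ⟨h0, h1, h2, h3⟩ := he l hl
    rcases h with rfl | rfl | rfl | rfl
    · exact ⟨4 * l + 1, by omega, by rw [h1, h0]⟩
    · exact ⟨4 * l, by omega, by rw [h1, h0, neg_neg]⟩
    · exact ⟨4 * l + 3, by omega, by rw [h3, h2]⟩
    · exact ⟨4 * l + 2, by omega, by rw [h3, h2, neg_neg]⟩

section Narrowest

variable {C S : ℝ} {p e c : ℕ → Plane} {n N K : ℕ}

theorem DifferenceSet.widthsLE (hE : DifferenceSet C S p e n N) (hc : ScanInv c e K N) {u : Plane}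
    (hu : 0 ≤ u 1) {m : ℝ} (hm : ∀ l < K, dot (c l) u ≤ m) : WidthsLE C S p n u m := by
  intro a ha b hb
  constructor
  · obtain ⟨k, hk, h⟩ := hE.dom u hu a ha b hb
    obtain ⟨l, hl, h'⟩ := hc.dom k hk u hu
    exact h.trans (h'.trans (hm l hl))
  · obtain ⟨k, hk, h⟩ := hE.dom_rot u hu a ha b hb
    obtain ⟨l, hl, h'⟩ := hc.dom k hk u hu
    exact h.trans (h'.trans (hm l hl))

/-- By central symmetry the reflection of the rightmost vertex is in the set, and no point lies to
the left of `c 0`. Thus the horizontal value tested at the right end also serves at the left end. -/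
theorem DifferenceSet.last_le_neg_first (hE : DifferenceSet C S p e n N) (hc : ScanInv c e K N) :
    c (K - 1) 0 ≤ -c 0 0 := by
  have hK := hc.pos
  obtain ⟨k, hk, h⟩ := hc.mem (K - 1) (by omega)
  obtain ⟨k', hk', h'⟩ := hE.neg k hk
  obtain ⟨l, hl, h''⟩ := hc.dom k' hk' !₂[-1, 0] (by simp)
  have := hc.chain.dot_le (i := 0) (u := !₂[-1, 0]) (by simp) (fun h0 => by
    have := hc.chain.lt 0 h0
    simp only [zero_add] at this
    simp [dot]; linarith) l (by omega) hl
  have := h''.trans this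
  rw [h', ← h] at this
  simpa [dot] using this

/-- A one-vertex chain would, by symmetry, have abscissa at most 0, and both widths for the
horizontal direction would be at most 0. -/
theorem DifferenceSet.two_le (hS : S ≠ 0) (hE : DifferenceSet C S p e n N) (hc : ScanInv c e K N)
    {a b : ℕ} (ha : a < n) (hb : b < n) (hab : p a ≠ p b) : 2 ≤ K := by
  have hK := hc.pos
  by_contra hcon
  have hK1 : K = 1 := by omega
  subst hK1
  have h1 := hE.last_le_neg_first hc
  simp only [Nat.sub_self] at h1
  have := (hE.widthsLE hc (u := !₂[1, 0]) (by simp) (m := 0) fun l hl => by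
    have : l = 0 := by omega
    subst this
    simp [dot]; linarith).pos hS norm_basis.1 ha hb hab
  exact lt_irrefl _ this

/-- Optimality of the selected direction: after a change of sign `u` points upward, some vertex has
product at least `m` with it, and this vertex is a difference or a rotated difference, hence bounded
by the widths. -/
theorem DifferenceSet.le_of_widthsLE (hE : DifferenceSet C S p e n N) (hc : ScanInv c e K N)
    (hK : 2 ≤ K) {b : Plane} {m : ℝ} (hm : MinInv c K (K - 1) b m) {u : Plane} (hu : ‖u‖ = 1)
    {m' : ℝ} (hw : WidthsLE C S p n u m') : m ≤ m' := by
  wlog hu1 : 0 ≤ u 1 generalizing u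
  · exact this (u := -u) (by rwa [norm_neg]) hw.neg (by simpa using (not_le.1 hu1).le)
  -- A vertex and its reflection both have product at most `m` with `b`.
  have hm0 : 0 ≤ m := by
    obtain ⟨k, hk, h⟩ := hc.mem 0 (by omega)
    obtain ⟨k', hk', h'⟩ := hE.neg k hk
    obtain ⟨l, hl, h''⟩ := hc.dom k' hk' b hm.nonneg
    have h1 := hm.dot_le l hl
    have h2 := hm.dot_le 0 (by omega)
    rw [h', ← h, dot_neg_left] at h''
    linarith
  obtain ⟨l, hl, h⟩ := hc.chain.exists_mul_norm_le hK hm0 hm.le_last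
    (hm.le_last.trans (hE.last_le_neg_first hc)) (fun l hl => hm.le_edge l (by omega)) hu1
  rw [hu, mul_one] at h
  obtain ⟨k, hk, h'⟩ := hc.mem l hl
  obtain ⟨a, ha, b, hb, h''⟩ := hE.mem k hk
  rw [h'] at h
  refine h.trans ?_
  rcases h'' with h'' | h''
  · rw [h'']; exact (hw a ha b hb).1
  · rw [h'', dot_rotBack]; exact (hw a ha b hb).2

end Narrowest

theorem norm_rot {c s : ℝ} (hcs : c ^ 2 + s ^ 2 = 1) (u : Plane) : ‖rot c s u‖ = ‖u‖ := by
  rw [← sq_eq_sq₀ (norm_nonneg _) (norm_nonneg _), norm_sq_plane, norm_sq_plane]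
  simp [rot]
  linear_combination (u.ofLp 0 ^ 2 + u.ofLp 1 ^ 2) * hcs

theorem normal₁_rot {c s : ℝ} (hcs : c ^ 2 + s ^ 2 = 1) (u : Plane) :
    normal₁ c s (rot c s u) = u := by
  ext x
  fin_cases x
  · simp [normal₁, rot, perp]; linear_combination (u.ofLp 0) * hcs
  · simp [normal₁, rot, perp]; linear_combination (u.ofLp 1) * hcs

theorem normal₂_rot (c s : ℝ) (u : Plane) :
    normal₂ c s (rot c s u) = rot (c * c - s * s) (2 * c * s) u := by
  ext x
  fin_cases x <;> simp [normal₂, rot, perp] <;> ring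

theorem rot_normal₁ {c s : ℝ} (hcs : c ^ 2 + s ^ 2 = 1) (e : Plane) :
    rot c s (normal₁ c s e) = e := by
  ext x
  fin_cases x
  · simp [normal₁, rot, perp]; linear_combination (e.ofLp 0) * hcs
  · simp [normal₁, rot, perp]; linear_combination (e.ofLp 1) * hcs

/-- Rotation by the angle with cosine `c` and sine `s` takes the first side normal to the axis, and
by twice this angle to the second side normal. Rhombi of all orientations thus correspond to unit
vectors `u`, and an enclosing one has both widths at most `2 * (size * s)`. -/
theorem exists_smallest_rhombus {c s : ℝ} (hc : 0 < c) (hs : 0 < s) (hcs : c ^ 2 + s ^ 2 = 1)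
    {p : ℕ → Plane} {n : ℕ} {b : Plane} {m : ℝ} (hb : ‖b‖ = 1) (hm : 0 < m)
    (hw : ∀ u : Plane, ∀ m', ‖u‖ = 1 →
      WidthsLE (c * c - s * s) (2 * c * s) p n u m' → m ≤ m') {m₁ m₂ : ℝ}
    (h₁ : ∀ a < n, |dot (p a) b - m₁| ≤ m / 2)
    (h₂ : ∀ a < n, |dot (p a) (rot (c * c - s * s) (2 * c * s) b) - m₂| ≤ m / 2) :
    ∃ R : Rhombus (s / c), R.IsSmallestEnclosing {x | ∃ a < n, p a = x} ∧
      R.center = centerOf c s (rot c s b) m₁ m₂ ∧ R.axis = rot c s b := by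
  have he : ‖rot c s b‖ = 1 := by rw [norm_rot hcs, hb]
  refine ⟨_, ⟨Rhombus.subset_carrier_of_strips hc hs he (half_pos hm) (m₁ := m₁) (m₂ := m₂)
    ?_ ?_, fun R' hR' => ?_⟩, rfl, rfl⟩
  · rintro _ ⟨a, ha, rfl⟩
    rw [normal₁_rot hcs]; exact h₁ a ha
  · rintro _ ⟨a, ha, rfl⟩
    rw [normal₂_rot]; exact h₂ a ha
  · have hu : ‖normal₁ c s R'.axis‖ = 1 := by
      rw [← norm_rot hcs, rot_normal₁ hcs, R'.norm_axis]
    have := hw _ (2 * (R'.size * s)) hu fun a ha b hb => by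
      have := R'.dot_sub_le hc hs (hR' ⟨a, ha, rfl⟩) (hR' ⟨b, hb, rfl⟩)
      rw [← normal₂_rot, rot_normal₁ hcs]
      exact this
    simp only
    rw [div_le_iff₀ hs]
    linarith

/-! ### The complete algorithm. -/

namespace RealRAM

/-- Computes the cosine and sine of the angle of the rhombus, and of twice this angle. -/
def setupProg : Prog :=
  .seq (.setReal 4 (.div (.const 1) (.reg 0)))
  (.seq (.setReal 5 (.sqrt (.sub (.const 1) (.mul (.reg 4) (.reg 4)))))
  (.seq (.setReal 6 (.sub (.mul (.reg 4) (.reg 4)) (.mul (.reg 5) (.reg 5))))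
    (.setReal 7 (.mul (.mul (.const 2) (.reg 4)) (.reg 5)))))

/-- Computes the normal of the second strip. -/
def turnProg : Prog :=
  .seq (.setReal 15 (.sub (.mul (.reg 6) (.reg 12)) (.mul (.reg 7) (.reg 13))))
    (.setReal 16 (.add (.mul (.reg 7) (.reg 12)) (.mul (.reg 6) (.reg 13))))

/-- Computes the extents of the input in the directions of both normals. -/
def stripsProg : Prog :=
  .seq (extentProg 1 17 12 13) (.seq (extentProg (-1) 18 12 13)
    (.seq (extentProg 1 19 15 16) (extentProg (-1) 20 15 16)))

/-- Computes the center of the rhombus and a second point on its main diagonal. -/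
def outputProg : Prog :=
  .seq (.setReal 8 (.sub (.mul (.reg 4) (.reg 12)) (.mul (.reg 5) (.reg 13))))
  (.seq (.setReal 9 (.add (.mul (.reg 5) (.reg 12)) (.mul (.reg 4) (.reg 13))))
  (.seq (.setReal 10 (.div (.add (.reg 17) (.reg 18)) (.const 2)))
  (.seq (.setReal 11 (.div (.add (.reg 19) (.reg 20)) (.const 2)))
  (.seq (.setReal 12 (.div (.add (.reg 10) (.reg 11)) (.mul (.const 2) (.reg 4))))
  (.seq (.setReal 13 (.div (.sub (.reg 11) (.reg 10)) (.mul (.const 2) (.reg 5))))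
  (.seq (.setReal 0 (.sub (.mul (.reg 12) (.reg 8)) (.mul (.reg 13) (.reg 9))))
  (.seq (.setReal 1 (.add (.mul (.reg 12) (.reg 9)) (.mul (.reg 13) (.reg 8))))
  (.seq (.setReal 2 (.add (.reg 0) (.reg 8)))
    (.setReal 3 (.add (.reg 1) (.reg 9)))))))))))

/-- The first half of the algorithm: differences and rotated differences of hull vertices. -/
def differenceProg : Prog :=
  .seq setupProg (.seq (copyProg 1) (.seq (hullProg 4 5) (.seq (.setNat 11 (.reg 10))
    (.seq (copyProg (-1)) (.seq (hullProg 6 7) sumProg)))))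

/-- The algorithm. -/
def rhombusProg : Prog :=
  .seq differenceProg (.seq (hullProg 8 9) (.seq minProg (.seq turnProg (.seq stripsProg outputProg))))

theorem stripsProg_reach {s : State} {m n : ℕ} (h0 : s.natReg 0 = n) (hn : 1 ≤ n)
    (hm : 400 * n + 200 ≤ m) {b w : Plane} (hb : b = !₂[s.realReg 12, s.realReg 13])
    (hw : w = !₂[s.realReg 15, s.realReg 16]) {p : ℕ → Plane} (hp : s.pt 0 1 = p) {μ : ℝ}
    (hμ : ∀ a < n, ∀ a' < n, dot (p a - p a') b ≤ μ ∧ dot (p a - p a') w ≤ μ) :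
    Reach stripsProg s m fun s' m' => m ≤ m' + 400 * n + 200 ∧
      (∀ a < n, |dot (p a) b - (s'.realReg 17 + s'.realReg 18) / 2| ≤ μ / 2) ∧
      ∀ a < n, |dot (p a) w - (s'.realReg 19 + s'.realReg 20) / 2| ≤ μ / 2 := by
  refine Reach.seq ((extentProg_reach 1 (by norm_num) (by norm_num) (by norm_num) (by norm_num)
    (by norm_num) h0 hn (by omega)).mono ?_)
  rintro s₁ m₁ f₁ ⟨t₁, ⟨a₁, l₁, e₁⟩, d₁⟩
  have p₁ : s₁.pt 0 1 = p := by
    rw [← hp]; funext a; simp only [State.pt, f₁.realArr 0 rfl, f₁.realArr 1 rfl]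
  refine Reach.seq ((extentProg_reach (-1) (by norm_num) (by norm_num) (by norm_num) (by norm_num)
    (by norm_num) ((f₁.natReg 0 rfl).trans h0) hn (by omega)).mono ?_)
  rintro s₂ m₂ f₂ ⟨t₂, ⟨a₂, l₂, e₂⟩, d₂⟩
  have p₂ : s₂.pt 0 1 = p := by
    rw [← p₁]; funext a; simp only [State.pt, f₂.realArr 0 rfl, f₂.realArr 1 rfl]
  refine Reach.seq ((extentProg_reach 1 (by norm_num) (by norm_num) (by norm_num) (by norm_num)
    (by norm_num) ((f₂.natReg 0 rfl).trans ((f₁.natReg 0 rfl).trans h0)) hn (by omega)).mono ?_)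
  rintro s₃ m₃ f₃ ⟨t₃, ⟨a₃, l₃, e₃⟩, d₃⟩
  have p₃ : s₃.pt 0 1 = p := by
    rw [← p₂]; funext a; simp only [State.pt, f₃.realArr 0 rfl, f₃.realArr 1 rfl]
  refine (extentProg_reach (-1) (by norm_num) (by norm_num) (by norm_num) (by norm_num)
    (by norm_num) ((f₃.natReg 0 rfl).trans ((f₂.natReg 0 rfl).trans ((f₁.natReg 0 rfl).trans h0)))
    hn (by omega)).mono ?_
  rintro s₄ m₄ f₄ ⟨t₄, ⟨a₄, l₄, e₄⟩, d₄⟩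
  have r12₁ := f₁.realReg 12 rfl
  have r13₁ := f₁.realReg 13 rfl
  have r15₂ := (f₂.realReg 15 rfl).trans (f₁.realReg 15 rfl)
  have r16₂ := (f₂.realReg 16 rfl).trans (f₁.realReg 16 rfl)
  have r15₃ := (f₃.realReg 15 rfl).trans r15₂
  have r16₃ := (f₃.realReg 16 rfl).trans r16₂
  rw [hp, ← hb] at e₁ d₁
  rw [p₁, r12₁, r13₁, ← hb] at e₂ d₂
  rw [p₂, r15₂, r16₂, ← hw] at e₃ d₃
  rw [p₃, r15₃, r16₃, ← hw] at e₄ d₄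
  rw [f₄.realReg 17 rfl, f₃.realReg 17 rfl, f₂.realReg 17 rfl, f₄.realReg 18 rfl, f₃.realReg 18 rfl,
    f₄.realReg 19 rfl]
  simp only [Int.cast_one, one_mul, Int.cast_neg, neg_mul, neg_le_neg_iff] at d₁ d₂ d₃ d₄
  have w₁ := (hμ a₁ l₁ a₂ l₂).1
  have w₂ := (hμ a₃ l₃ a₄ l₄).2
  rw [dot_sub_left] at w₁ w₂
  refine ⟨by omega, fun a ha => abs_le.2 ?_, fun a ha => abs_le.2 ?_⟩
  · have := d₁ a ha; have := d₂ a ha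
    constructor <;> linarith
  · have := d₃ a ha; have := d₄ a ha
    constructor <;> linarith

theorem outputProg_exec (s : State) :
    (outputProg.exec s).out₁ = centerOf (s.realReg 4) (s.realReg 5)
      (rot (s.realReg 4) (s.realReg 5) !₂[s.realReg 12, s.realReg 13])
      ((s.realReg 17 + s.realReg 18) / 2) ((s.realReg 19 + s.realReg 20) / 2) ∧
    (outputProg.exec s).out₂ = (outputProg.exec s).out₁ +
      rot (s.realReg 4) (s.realReg 5) !₂[s.realReg 12, s.realReg 13] := by
  constructor
  · ext x
    fin_cases x
    · simp [outputProg, Prog.exec, RExpr.eval, State.out₁, centerOf, rot, perp]; ring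
    · simp [outputProg, Prog.exec, RExpr.eval, State.out₁, centerOf, rot, perp]
  · ext x
    fin_cases x <;> simp [outputProg, Prog.exec, RExpr.eval, State.out₁, State.out₂, rot]

/-- Multiplying the number of points by 8 = 2 ^ 3 adds at most 3 to the number of passes. -/
theorem hull_cost_le {n N : ℕ} (hn : 3 ≤ n) (hN : N ≤ 8 * n) :
    (500 * N + 100) * Nat.clog 2 N + 500 * N + 100 ≤ 4100 * (n * Nat.clog 2 n) + 16500 * n := by
  have h1 : Nat.clog 2 N ≤ Nat.clog 2 n + 3 := by
    refine Nat.clog_le_of_le_pow ?_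
    have := Nat.le_pow_clog one_lt_two n
    rw [pow_add]
    omega
  calc (500 * N + 100) * Nat.clog 2 N + 500 * N + 100
      ≤ (500 * (8 * n) + 100) * (Nat.clog 2 n + 3) + 500 * (8 * n) + 100 := by gcongr
    _ = 4000 * (n * Nat.clog 2 n) + 100 * Nat.clog 2 n + 16000 * n + 400 := by ring
    _ ≤ 4100 * (n * Nat.clog 2 n) + 16500 * n := by
        have : 1 * Nat.clog 2 n ≤ n * Nat.clog 2 n := Nat.mul_le_mul_right _ (by omega)
        omega

/-- Two hulls of `n` points make up the `n log n` part of the cost. Their sum has at most `2 * n`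
vertices, each giving four points, whence `N ≤ 8 * n`. -/
theorem differenceProg_reach {s : State} {m n : ℕ} (h0 : s.natReg 0 = n) (hn : 3 ≤ n)
    (hm : 9000 * (n * Nat.clog 2 n) + 40000 * n ≤ m) :
    Reach differenceProg s m fun s' m' => m ≤ m' + (9000 * (n * Nat.clog 2 n) + 40000 * n) ∧
      s'.realReg 4 = 1 / s.realReg 0 ∧
      s'.realReg 5 = Real.sqrt (1 - s'.realReg 4 * s'.realReg 4) ∧
      s'.realReg 6 = s'.realReg 4 * s'.realReg 4 - s'.realReg 5 * s'.realReg 5 ∧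
      s'.realReg 7 = 2 * s'.realReg 4 * s'.realReg 5 ∧
      ∃ N, s'.natReg 1 = N ∧ 1 ≤ N ∧ N ≤ 8 * n ∧
        DifferenceSet (s'.realReg 6) (s'.realReg 7) (s.pt 0 1) (s'.pt 2 3) n N := by
  have hc := hull_cost_le (N := n) hn (by omega)
  refine Reach.seq (Reach.exec 40 rfl (by decide) (by omega) ?_)
  have f₀ := Prog.frame_exec setupProg rfl s
  have s4 : (setupProg.exec s).realReg 4 = 1 / s.realReg 0 := by
    simp [setupProg, Prog.exec, RExpr.eval]
  have s5 : (setupProg.exec s).realReg 5 =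
      Real.sqrt (1 - (setupProg.exec s).realReg 4 * (setupProg.exec s).realReg 4) := by
    simp [setupProg, Prog.exec, RExpr.eval]
  have s6 : (setupProg.exec s).realReg 6 = (setupProg.exec s).realReg 4 * (setupProg.exec s).realReg 4
      - (setupProg.exec s).realReg 5 * (setupProg.exec s).realReg 5 := by
    simp [setupProg, Prog.exec, RExpr.eval]
  have s7 : (setupProg.exec s).realReg 7 =
      2 * (setupProg.exec s).realReg 4 * (setupProg.exec s).realReg 5 := by
    simp [setupProg, Prog.exec, RExpr.eval]
  generalize setupProg.exec s = s₀ at *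
  have p₀ : s₀.pt 0 1 = s.pt 0 1 := by
    funext a; simp only [State.pt, f₀.realArr 0 rfl, f₀.realArr 1 rfl]
  have n₀ := (f₀.natReg 0 rfl).trans h0
  refine Reach.seq ((copyProg_reach 1 n₀ (by omega)).mono ?_)
  rintro s₁ m₁ f₁ ⟨t₁, n₁, c₁⟩
  refine Reach.seq ((hullProg_reach (by norm_num) (by norm_num) n₁ (by omega) (by omega)).mono ?_)
  rintro s₂ m₂ f₂ ⟨t₂, KA, k₂, c₂⟩
  refine Reach.seq (Reach.exec 10 rfl (by decide) (by omega) ?_)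
  have f₃ := Prog.frame_exec (.setNat 11 (.reg 10)) rfl s₂
  have k₃ : (Prog.exec (.setNat 11 (.reg 10)) s₂).natReg 11 = KA := by
    simp [Prog.exec, NExpr.eval, k₂]
  generalize Prog.exec (.setNat 11 (.reg 10)) s₂ = s₃ at *
  have n₃ := (f₃.natReg 0 rfl).trans ((f₂.natReg 0 rfl).trans ((f₁.natReg 0 rfl).trans n₀))
  have p₃ : s₃.pt 0 1 = s.pt 0 1 := by
    rw [← p₀]
    funext a
    simp only [State.pt, f₃.realArr 0 rfl, f₂.realArr 0 rfl, f₁.realArr 0 rfl, f₃.realArr 1 rfl,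
      f₂.realArr 1 rfl, f₁.realArr 1 rfl]
  refine Reach.seq ((copyProg_reach (-1) n₃ (by omega)).mono ?_)
  rintro s₄ m₄ f₄ ⟨t₄, n₄, c₄⟩
  refine Reach.seq ((hullProg_reach (by norm_num) (by norm_num) n₄ (by omega) (by omega)).mono ?_)
  rintro s₅ m₅ f₅ ⟨t₅, KB, k₅, c₅⟩
  have hA : ScanInv (s₅.pt 4 5) (s.pt 0 1) KA n := by
    have e : s₅.pt 4 5 = s₂.pt 4 5 := by
      funext a
      simp only [State.pt, f₅.realArr 4 rfl, f₄.realArr 4 rfl, f₃.realArr 4 rfl, f₅.realArr 5 rfl,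
        f₄.realArr 5 rfl, f₃.realArr 5 rfl]
    rw [e]
    refine c₂.congr fun a ha => ?_
    rw [c₁ a ha, p₀]; simp
  have hB : ScanInv (s₅.pt 6 7) (fun a => -s.pt 0 1 a) KB n := by
    refine c₅.congr fun a ha => ?_
    rw [c₄ a ha, p₃]; simp
  have k₅' : s₅.natReg 11 = KA := (f₅.natReg 11 rfl).trans ((f₄.natReg 11 rfl).trans k₃)
  have := hA.le
  have := hB.le
  refine (sumProg_reach k₅' k₅ hA.pos hB.pos hA.chain hB.chain (by omega)).mono ?_
  rintro s₆ m₆ f₆ ⟨t₆, L, d, n₆, l₆, l₆', e₆, g₆, g₆'⟩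
  have keep : ∀ x, x = 4 ∨ x = 5 ∨ x = 6 ∨ x = 7 →
      s₆.realReg x = s₀.realReg x ∧ s₅.realReg x = s₀.realReg x := by
    rintro x (rfl | rfl | rfl | rfl)
    all_goals
      refine (and_iff_right_of_imp fun h => (f₆.realReg _ rfl).trans h).2 ?_
      rw [f₅.realReg _ rfl, f₄.realReg _ rfl, f₃.realReg _ rfl, f₂.realReg _ rfl, f₁.realReg _ rfl]
  rw [(keep 4 (by simp)).1, (keep 5 (by simp)).1, (keep 6 (by simp)).1, (keep 7 (by simp)).1]
  rw [(keep 6 (by simp)).2, (keep 7 (by simp)).2] at e₆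
  exact ⟨by omega, s4, s5, s6, s7, 4 * L, n₆, by omega, by omega,
    e₆.differenceSet hA hB g₆ g₆'⟩

theorem rhombusProg_reach {v : ℝ} (hv : 1 < v) {s : State} {m n : ℕ} (h0 : s.natReg 0 = n)
    (hr : s.realReg 0 = v) (hn : 3 ≤ n) (hinj : s.pt 0 1 0 ≠ s.pt 0 1 1)
    (hm : 14000 * (n * Nat.clog 2 n) + 60000 * n ≤ m) :
    Reach rhombusProg s m fun s' _ =>
      ∃ R : Rhombus (Real.tan (Real.arccos (1 / v))),
        R.IsSmallestEnclosing {x | ∃ a < n, s.pt 0 1 a = x} ∧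
        s'.out₁ = R.center ∧ s'.out₂ = R.center + R.axis := by
  obtain ⟨-, hc, hs, hcs⟩ := sin_data hv
  refine Reach.seq ((differenceProg_reach h0 hn (by omega)).mono ?_)
  rintro s₁ m₁ f₁ ⟨t₁, r4, r5, r6, r7, N, n₁, hN, hN', hE⟩
  have hcost := hull_cost_le hn hN'
  -- This register holds sin 2α, nonzero because 0 < α < π/2.
  have hS : s₁.realReg 7 ≠ 0 := by
    rw [r7, r5, r4, hr, ← sq]; positivity
  refine Reach.seq ((hullProg_reach (by norm_num) (by norm_num) n₁ hN (by omega)).mono ?_)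
  rintro s₂ m₂ f₂ ⟨t₂, K, k₂, c₂⟩
  have hK := hE.two_le hS c₂ (a := 0) (b := 1) (by omega) (by omega) hinj
  have hKN := c₂.le
  refine Reach.seq ((minProg_reach k₂ hK c₂.chain (by omega)).mono ?_)
  rintro s₃ m₃ f₃ ⟨t₃, hM⟩
  set b : Plane := !₂[s₃.realReg 12, s₃.realReg 13] with hb
  have hW := hE.widthsLE c₂ hM.nonneg hM.dot_le
  have hμ := hW.pos hS hM.norm (a := 0) (b := 1) (by omega) (by omega) hinj
  have hmin : ∀ u : Plane, ∀ m', ‖u‖ = 1 →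
      WidthsLE (s₁.realReg 6) (s₁.realReg 7) (s.pt 0 1) n u m' → s₃.realReg 14 ≤ m' :=
    fun u m' hu hw => hE.le_of_widthsLE c₂ hK hM hu hw
  refine Reach.seq (Reach.exec 20 rfl (by decide) (by omega) ?_)
  have f₄ := Prog.frame_exec turnProg rfl s₃
  have q6 : s₃.realReg 6 = s₁.realReg 6 := (f₃.realReg 6 rfl).trans (f₂.realReg 6 rfl)
  have q7 : s₃.realReg 7 = s₁.realReg 7 := (f₃.realReg 7 rfl).trans (f₂.realReg 7 rfl)
  have hw : rot (s₁.realReg 6) (s₁.realReg 7) b =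
      !₂[(turnProg.exec s₃).realReg 15, (turnProg.exec s₃).realReg 16] := by
    rw [← q6, ← q7]
    ext x
    fin_cases x <;> simp [hb, turnProg, Prog.exec, RExpr.eval, rot]
  generalize turnProg.exec s₃ = s₄ at *
  have b₄ : b = !₂[s₄.realReg 12, s₄.realReg 13] := by
    rw [f₄.realReg 12 rfl, f₄.realReg 13 rfl]
  have p₄ : s₄.pt 0 1 = s.pt 0 1 := by
    funext a
    simp only [State.pt, f₄.realArr 0 rfl, f₃.realArr 0 rfl, f₂.realArr 0 rfl, f₁.realArr 0 rfl,
      f₄.realArr 1 rfl, f₃.realArr 1 rfl, f₂.realArr 1 rfl, f₁.realArr 1 rfl]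
  have n₄ : s₄.natReg 0 = n := (f₄.natReg 0 rfl).trans ((f₃.natReg 0 rfl).trans
    ((f₂.natReg 0 rfl).trans ((f₁.natReg 0 rfl).trans h0)))
  refine Reach.seq ((stripsProg_reach n₄ (by omega) (by omega) b₄ hw p₄ hW).mono ?_)
  rintro s₅ m₅ f₅ ⟨t₅, d₁, d₂⟩
  refine Reach.exec 100 rfl (by decide) (by omega) ?_
  have z4 : s₅.realReg 4 = 1 / v := by
    rw [f₅.realReg 4 rfl, f₄.realReg 4 rfl, f₃.realReg 4 rfl, f₂.realReg 4 rfl, r4, hr]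
  have z5 : s₅.realReg 5 = Real.sqrt (1 - (1 / v) ^ 2) := by
    rw [f₅.realReg 5 rfl, f₄.realReg 5 rfl, f₃.realReg 5 rfl, f₂.realReg 5 rfl, r5, r4, hr, sq]
  have zb : !₂[s₅.realReg 12, s₅.realReg 13] = b := by
    rw [b₄, f₅.realReg 12 rfl, f₅.realReg 13 rfl]
  obtain ⟨o₁, o₂⟩ := outputProg_exec s₅
  rw [z4, z5, zb] at o₁ o₂
  have w4 : s₁.realReg 4 = 1 / v := by rw [r4, hr]
  have w5 : s₁.realReg 5 = Real.sqrt (1 - (1 / v) ^ 2) := by rw [r5, w4, sq]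
  rw [w4, w5] at r6 r7
  rw [r6, r7] at hmin d₂
  obtain ⟨R, hR, hc', ha⟩ := exists_smallest_rhombus hc hs hcs hM.norm hμ hmin d₁ d₂
  rw [tan_arccos_one_div]
  exact ⟨R, hR, by rw [o₁, hc'], by rw [o₂, o₁, hc', ha]⟩

end RealRAM

/-- From `n ≥ 3 > e` one gets `1 ≤ log n`, so `Nat.clog 2 n ≤ 1 + log n / log 2 ≤ 3 * log n`, and
102000 = 3 · 14000 + 60000. -/
theorem clog_cost_le {n : ℕ} (hn : 3 ≤ n) :
    ((14000 * (n * Nat.clog 2 n) + 60000 * n : ℕ) : ℝ) ≤ 102000 * ((n : ℝ) * Real.log n) := by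
  have hn' : (3 : ℝ) ≤ n := by exact_mod_cast hn
  have hlog : 1 ≤ Real.log n := by
    rw [Real.le_log_iff_exp_le (by linarith)]
    exact Real.exp_one_lt_three.le.trans hn'
  have h1 : 2 ^ (Nat.clog 2 n - 1) < n := Nat.pow_pred_clog_lt_self one_lt_two (by omega)
  have h2 : ((Nat.clog 2 n - 1 : ℕ) : ℝ) * Real.log 2 ≤ Real.log n := by
    rw [← Real.log_pow]
    refine Real.log_le_log (by positivity) ?_
    exact_mod_cast h1.le
  have h3 : 1 ≤ Nat.clog 2 n := Nat.clog_pos one_lt_two (by omega)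
  rw [Nat.cast_sub h3, Nat.cast_one] at h2
  have h4 := Real.log_two_gt_d9
  have h5 : (0 : ℝ) ≤ (Nat.clog 2 n : ℝ) - 1 := by
    rw [sub_nonneg]; exact_mod_cast h3
  have h6 : (Nat.clog 2 n : ℝ) ≤ 3 * Real.log n := by nlinarith
  push_cast
  nlinarith [mul_le_mul_of_nonneg_left h6 (show (0 : ℝ) ≤ n by linarith),
    mul_le_mul_of_nonneg_left hlog (show (0 : ℝ) ≤ n by linarith)]

theorem mainTheorem3 :
    (∀ v : ℝ, 1 < v → approxFactor v ≤ Real.sqrt 2) ∧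
    (∀ v : ℝ, 1 < v → ∀ S : Set Plane, S.Finite → 3 ≤ S.ncard →
      ∀ R : Rhombus (Real.tan (Real.arccos (1 / v))), R.IsSmallestEnclosing S →
        IsHighway R.mainDiagonal ∧
        ∀ h : AffineSubspace ℝ Plane, IsHighway h →
          travelDiam v R.mainDiagonal S ≤ approxFactor v * travelDiam v h S) ∧
    ∃ (P : RealRAM.Prog) (C : ℝ), ∀ v : ℝ, 1 < v → ∀ n : ℕ, 3 ≤ n →
      ∀ p : Fin n → Plane, Function.Injective p →
        ∃ (t : ℕ) (s : RealRAM.State), RealRAM.Runs P (RealRAM.input v p) t s ∧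
          (t : ℝ) ≤ C * ((n : ℝ) * Real.log n) ∧
          s.out₁ ≠ s.out₂ ∧
          (∃ R : Rhombus (Real.tan (Real.arccos (1 / v))),
            R.IsSmallestEnclosing (Set.range p) ∧ line[ℝ, s.out₁, s.out₂] = R.mainDiagonal) ∧
          ∀ h : AffineSubspace ℝ Plane, IsHighway h →
            travelDiam v line[ℝ, s.out₁, s.out₂] (Set.range p) ≤
              approxFactor v * travelDiam v h (Set.range p) := by
  have hρ : ∀ {v : ℝ}, 1 < v → 0 < Real.tan (Real.arccos (1 / v)) := fun hv => by
    obtain ⟨-, hc, hs, -⟩ := sin_data hv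
    rw [tan_arccos_one_div]
    exact div_pos hs hc
  refine ⟨fun v _ => approxFactor_le_sqrt_two, fun v hv S hfin hS R hR =>
    ⟨R.isHighway_mainDiagonal (hρ hv), fun h hh => travelDiam_mainDiagonal_le hv hfin ?_ hR hh⟩,
    RealRAM.rhombusProg, 102000, fun v hv n hn p hp => ?_⟩
  · have := hfin.to_subtype
    exact Set.one_lt_ncard_iff_nontrivial.1 (by omega)
  -- The verification works with sequences indexed by `ℕ`; only the first `n` cells matter.
  have hpt : ∀ (a : ℕ) (ha : a < n), (RealRAM.input v p).pt 0 1 a = p ⟨a, ha⟩ := fun a ha => by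
    ext x
    fin_cases x <;> simp [RealRAM.input, ha]
  have hrange : {x | ∃ a < n, (RealRAM.input v p).pt 0 1 a = x} = Set.range p := by
    ext x
    constructor
    · rintro ⟨a, ha, rfl⟩
      exact ⟨⟨a, ha⟩, (hpt a ha).symm⟩
    · rintro ⟨a, rfl⟩
      exact ⟨a, a.2, hpt a a.2⟩
  obtain ⟨t, s, m', hrun, ht, R, hR, h₁, h₂⟩ := RealRAM.rhombusProg_reach hv
    (s := RealRAM.input v p) (n := n) rfl rfl hn (by
      rw [hpt 0 (by omega), hpt 1 (by omega)]
      intro h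
      simpa using hp h) le_rfl
  rw [hrange] at hR
  have hline : line[ℝ, s.out₁, s.out₂] = R.mainDiagonal := by
    rw [h₁, h₂, R.mainDiagonal_eq (hρ hv)]
  refine ⟨t, s, hrun, ?_, ?_, ⟨R, hR, hline⟩, fun h hh => ?_⟩
  · refine le_trans ?_ (clog_cost_le hn)
    exact_mod_cast (by omega : t ≤ 14000 * (n * Nat.clog 2 n) + 60000 * n)
  · rw [h₁, h₂]
    intro h
    have h0 : R.axis = 0 := by simpa using h
    have := R.norm_axis
    rw [h0, norm_zero] at this
    exact zero_ne_one this
  · rw [hline]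
    refine travelDiam_mainDiagonal_le hv (Set.finite_range p) ?_ hR hh
    refine ⟨p ⟨0, by omega⟩, ⟨_, rfl⟩, p ⟨1, by omega⟩, ⟨_, rfl⟩, fun h => ?_⟩
    simpa using hp h
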